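/- Let $n\ge 1$ and let $(M,J)$ be a $C^\infty$ almost complex manifold of complex dimension $n$ (Hausdorff and second countable, of real dimension $2n$, $J$ of class $C^\infty$, $J^2=-\mathrm{Id}$), and let $g$ be a $C^\infty$ Hermitian metric on $M$, i.e. a Riemannian metric with $g(Jv,Jw)=g(v,w)$. For a differentiable function $F$ with values in $\mathbb C$ let $\overline\partial_J F$ be the $(0,1)$-part of $dF$, that is, $\overline\partial_J F(v)=\tfrac12\big(dF(v)+i\,dF(Jv)\big)$. Let $\rho_1,\dots,\rho_n:M\to\mathbb R$ be $C^\infty$ functions and put $$E=\{p\in M:\rho_j(p)=0,\ j=1,\dots,n\},\qquad W(E)=\{p\in M:\rho_j(p)<0,\ j=1,\dots,n\}.$$ Assume that $\overline\partial_J\rho_1\wedge\dots\wedge\overline\partial_J\rho_n\ne 0$ near $E$; thus $E$ is a totally real submanifold of real dimension $n$, and $W(E)$ is a wedge with the totally real edge $E$. A non-tangential cone in $W(E)$ with vertex $p\in E$ is a set $K\subset W(E)$ which, in some smooth local coordinates of $M$ near $p$, is an open truncated circular cone with vertex at $p$, such that some open circular cone (in the same coordinates and truncated at the same radius) with the same vertex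 and axis and a strictly larger angle is also contained in $W(E)$. A function $F:W(E)\to\mathbb C$ has the non-tangential limit $L\in\mathbb C$ at $p$ if $F(z)\to L$ as $K\ni z\to p$ for every non-tangential cone $K$ in $W(E)$ with vertex $p$. Suppose that $F:W(E)\to\mathbb C$ is a bounded function of class $C^1$ and that $\overline\partial_J F$ is bounded on $W(E)$, i.e. there is a constant $C$ with $|\overline\partial_J F(v)|\le C\,g(v,v)^{1/2}$ for all $p\in W(E)$ and $v\in T_pM$. Then $F$ has a non-tangential limit at almost every point of $E$: the set of the points of $E$ at which $F$ has no non-tangential limit has $n$-dimensional measure zero (zero $n$-dimensional Hausdorff measure in local coordinates of $M$). -/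

import Mathlib

open Set Filter MeasureTheory
open scoped Manifold ContDiff Topology Bundle

noncomputable section

/-- The real model space `ℝ²ⁿ` of a manifold of real dimension `2n`. -/
abbrev ModelR (n : ℕ) : Type := EuclideanSpace ℝ (Fin (2 * n))

/-- An almost complex structure on a smooth manifold `M` of real dimension `2n`: a smooth field of
endomorphisms `J p` of the tangent spaces with `(J p)² = -Id`. -/
structure AlmostComplexStructure (n : ℕ) (M : Type*) [TopologicalSpace M]
    [ChartedSpace (ModelR n) M] [IsManifold 𝓘(ℝ, ModelR n) ∞ M] where
  /-- the endomorphism of the tangent space at a point -/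
  J (p : M) : TangentSpace 𝓘(ℝ, ModelR n) p →L[ℝ] TangentSpace 𝓘(ℝ, ModelR n) p
  sq_eq_neg (p : M) (v : TangentSpace 𝓘(ℝ, ModelR n) p) : J p (J p v) = -v
  contMDiff : ContMDiff 𝓘(ℝ, ModelR n)
    (𝓘(ℝ, ModelR n).prod 𝓘(ℝ, ModelR n →L[ℝ] ModelR n)) ∞
    (fun p ↦ Bundle.TotalSpace.mk' (ModelR n →L[ℝ] ModelR n)
      (E := fun p : M ↦ TangentSpace 𝓘(ℝ, ModelR n) p →L[ℝ] TangentSpace 𝓘(ℝ, ModelR n) p)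
      p (J p))

namespace AlmostComplexStructure

variable {n : ℕ} {M : Type*} [TopologicalSpace M]
    [ChartedSpace (ModelR n) M] [IsManifold 𝓘(ℝ, ModelR n) ∞ M]

/-- A smooth Riemannian metric `g` is Hermitian for `J` if `g(Jv, Jw) = g(v, w)`. -/
def IsHermitianMetric (𝒥 : AlmostComplexStructure n M)
    (g : Bundle.ContMDiffRiemannianMetric 𝓘(ℝ, ModelR n) ∞ (ModelR n)
      (fun p : M ↦ TangentSpace 𝓘(ℝ, ModelR n) p)) : Prop :=
  ∀ (p : M) (v w : TangentSpace 𝓘(ℝ, ModelR n) p),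
    g.inner p (𝒥.J p v) (𝒥.J p w) = g.inner p v w

/-- The differential of a complex function, as a real-linear form with complex values. -/
def diffC (F : M → ℂ) (p : M) : TangentSpace 𝓘(ℝ, ModelR n) p →L[ℝ] ℂ :=
  mfderiv 𝓘(ℝ, ModelR n) 𝓘(ℝ, ℂ) F p

/-- `∂̄_J F` at `p`, the `(0,1)`-part `v ↦ (dF(v) + i dF(Jv)) / 2` of the differential. -/
def dbar (𝒥 : AlmostComplexStructure n M) (F : M → ℂ) (p : M) :
    TangentSpace 𝓘(ℝ, ModelR n) p →L[ℝ] ℂ :=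
  (1 / 2 : ℂ) • (diffC F p + Complex.I • (diffC F p).comp (𝒥.J p))

/-- `∂̄_J F` is bounded on `W`, with respect to the metric `g`. -/
def DbarBoundedOn (𝒥 : AlmostComplexStructure n M)
    (g : Bundle.ContMDiffRiemannianMetric 𝓘(ℝ, ModelR n) ∞ (ModelR n)
      (fun p : M ↦ TangentSpace 𝓘(ℝ, ModelR n) p)) (F : M → ℂ) (W : Set M) : Prop :=
  ∃ C : ℝ, ∀ p ∈ W, ∀ v : TangentSpace 𝓘(ℝ, ModelR n) p,
    ‖𝒥.dbar F p v‖ ≤ C * Real.sqrt (g.inner p v v)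

/-- The value of `∂̄_J ρ₁ ∧ … ∧ ∂̄_J ρ_k` at `p` on the tangent vectors `v₁, …, v_k`. -/
def dbarWedge (𝒥 : AlmostComplexStructure n M) {k : ℕ} (ρ : Fin k → M → ℝ) (p : M)
    (v : Fin k → TangentSpace 𝓘(ℝ, ModelR n) p) : ℂ :=
  Matrix.det (Matrix.of fun i j ↦ 𝒥.dbar (fun q ↦ (ρ i q : ℂ)) p (v j))

end AlmostComplexStructure

/-- The edge `{ρ₁ = … = ρ_k = 0}`. -/
def edge {M : Type*} {k : ℕ} (ρ : Fin k → M → ℝ) : Set M := {p | ∀ j, ρ j p = 0}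

/-- The wedge `{ρ₁ < 0, …, ρ_k < 0}`. -/
def wedge {M : Type*} {k : ℕ} (ρ : Fin k → M → ℝ) : Set M := {p | ∀ j, ρ j p < 0}

namespace AlmostComplexStructure

variable {n : ℕ} {M : Type*} [TopologicalSpace M]
    [ChartedSpace (ModelR n) M] [IsManifold 𝓘(ℝ, ModelR n) ∞ M]

/-- The functions `ρ₁, …, ρ_k` are smooth and `∂̄_J ρ₁ ∧ … ∧ ∂̄_J ρ_k ≠ 0` near their common zero
set, which is thus a generic submanifold of real codimension `k`. -/
structure IsGeneric (𝒥 : AlmostComplexStructure n M) {k : ℕ} (ρ : Fin k → M → ℝ) : Prop where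
  smooth (j : Fin k) : ContMDiff 𝓘(ℝ, ModelR n) 𝓘(ℝ, ℝ) ∞ (ρ j)
  wedge_ne_zero : ∀ᶠ p in 𝓝ˢ (edge ρ), ∃ v, 𝒥.dbarWedge ρ p v ≠ 0

/-- The edge of `ρ₁, …, ρ_k` is totally real: it is generic, of the maximal codimension `k = n`. -/
def IsTotallyReal (𝒥 : AlmostComplexStructure n M) {k : ℕ} (ρ : Fin k → M → ℝ) : Prop :=
  𝒥.IsGeneric ρ ∧ k = n

end AlmostComplexStructure

/-- The open circular cone in `ℝ²ⁿ` with vertex `a`, directed by `v`, of half-angle `θ`,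
truncated at distance `r` from its vertex. -/
def circularCone {n : ℕ} (a v : ModelR n) (θ r : ℝ) : Set (ModelR n) :=
  {x | InnerProductGeometry.angle v (x - a) < θ ∧ ‖x - a‖ < r}

/-- `K ⊆ Ω` is a non-tangential cone with vertex `p`: in some local coordinates near `p` it is a
(truncated) circular cone with vertex at `p`, and some circular cone with the same vertex and axis
and a strictly larger angle is still contained in `Ω`. -/
def IsNontangentialCone (n : ℕ) {M : Type*} [TopologicalSpace M] [ChartedSpace (ModelR n) M]
    (Ω : Set M) (p : M) (K : Set M) : Prop :=
  ∃ φ ∈ IsManifold.maximalAtlas 𝓘(ℝ, ModelR n) ∞ M, p ∈ φ.source ∧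
    ∃ (v : ModelR n) (θ θ' r : ℝ), v ≠ 0 ∧ 0 < θ ∧ θ < θ' ∧ 0 < r ∧
      circularCone (φ p) v θ' r ⊆ φ.target ∧
      φ.symm '' circularCone (φ p) v θ' r ⊆ Ω ∧
      K = φ.symm '' circularCone (φ p) v θ r

/-- `F` admits the non-tangential limit `L` at `p`: it tends to `L` along every non-tangential
cone in `Ω` with vertex `p`. -/
def HasNontangentialLimit (n : ℕ) {M : Type*} [TopologicalSpace M] [ChartedSpace (ModelR n) M]
    (Ω : Set M) (F : M → ℂ) (p : M) (L : ℂ) : Prop :=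
  ∀ K : Set M, IsNontangentialCone n Ω p K → Tendsto F (𝓝[K] p) (𝓝 L)

/-- A subset `N` of `M` has `d`-dimensional measure zero: its image in all local coordinates has
zero `d`-dimensional Hausdorff measure. For a subset of a `d`-dimensional submanifold this means
that it is a null set of this submanifold. -/
def IsNullOfDim (n : ℕ) {M : Type*} [TopologicalSpace M] [ChartedSpace (ModelR n) M]
    (d : ℕ) (N : Set M) : Prop :=
  ∀ φ ∈ IsManifold.maximalAtlas 𝓘(ℝ, ModelR n) ∞ M,
    μH[(d : ℝ)] (φ '' (N ∩ φ.source)) = 0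

end

/-!
The statement is local, so it is proved in coordinates `(x, y)` of `X × X`, `X = ℝⁿ`, in which the
edge is `y = 0`, the wedge is given by the positive orthant of the `y`-space, and the almost complex
structure `J` is standard at one point of the edge. Such coordinates exist because the edge is
totally real: at that point `v ↦ (-dρ(Jv), -dρ(v))` is an isomorphism (`exists_adapted_chart`).
Every non-tangential cone, in whatever chart, lies near its vertex in a region of the form
`c * ‖w - z‖ ≤ -ρ w` (`exists_mul_norm_le_neg`, `hasNontangentialLimit_of_tendsto`), so that it is
enough to find limits in these regions; and sets of measure zero are preserved by the changes of
coordinates.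

*Boundary values.* Near the base point the vectors tangent to the `x`-space span the tangent space
over `J`. Hence boundedness of `∂̄F` means that the `y`-derivatives of `F` are complex combinations
`P + iQ` of its `x`-derivatives, up to a bounded error (`IsTubeSolution`). Integration by parts then
moves an average of `F` over `X × {y₁}` to an average over `X × {y₀}`, with an error of order
`‖y₁ - y₀‖`, if the weight nearly solves the transport equation with the complex velocity `P + iQ`
(`IsTubeSolution.norm_integral_sub_integral_le`). Although transport with a complex velocity is
ill-posed, Gaussians are entire functions, and a Gaussian whose centre moves in the complexification
of `X` solves the equation with constant velocity. If its width and `‖y₁‖` are both of order `t`,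
the complexified Gaussian remains bounded by a real one and freezing `P` and `Q` at a point of the
edge costs `O(t)` (`IsTubeSolution.exists_norm_integral_gaussian_sub_le`). Bounded functions have a
weak limit along an ultrafilter of planes `X × {y}` approaching the edge. At each of its Lebesgue
points, thus almost everywhere, all Gaussian averages of `F` of width comparable to the distance to
the edge converge to the value of the weak limit, uniformly over non-tangential approach
(`IsTubeSolution.ae_exists_gaussian_limit`).

*From averages to values.* `F` is merely `C¹` and its gradient is not controlled, but `F` almost has
the mean value property. Let `χ` be a weight invariant under the rotations generated by `J z`
(`exists_invariant_weight`). The `s`-derivative of `∫ F(z + sw) χ(w) dw` is the average of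
`dF(w)`, which is `-i dF(Jw)` up to a bounded error. The latter is a derivative along the rotation
field, which preserves `χ` and is free of divergence because `tr J = 0`, and so the divergence
theorem bounds its average as well (`norm_mul_integral_sub_integral_le`). Therefore, at distance `d`
from the vertex of a region as above, `F z` is within `O(d)` of its average at scale comparable to
`d`. This average changes only by `O(κ)` under a Gaussian smoothing at scale `κd` in the
`x`-directions, and the smoothed function is close to the limit by the first part
(`norm_sub_mul_le_of_gaussian`). Letting `d → 0` and then `κ → 0` gives the limit of `F`
(`ae_exists_tendsto_orthant`).
-/

noncomputable section

/-! ### The divergence theorem for compactly supported functions -/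

section Divergence

variable {V : Type*} [NormedAddCommGroup V] [NormedSpace ℝ V]

lemma ContDiff.continuous_fderiv_apply_const {G : V → ℂ} (hG : ContDiff ℝ 1 G) (v : V) :
    Continuous fun x ↦ fderiv ℝ G x v :=
  (hG.continuous_fderiv one_ne_zero).clm_apply continuous_const

variable [FiniteDimensional ℝ V]

/-- The trace of an endomorphism, as a continuous linear form. -/
def traceCLM (V : Type*) [NormedAddCommGroup V] [NormedSpace ℝ V] [FiniteDimensional ℝ V] :
    (V →L[ℝ] V) →L[ℝ] ℝ :=
  LinearMap.toContinuousLinearMap (LinearMap.trace ℝ V ∘ₗ ContinuousLinearMap.coeLM ℝ)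

lemma traceCLM_apply (T : V →L[ℝ] V) : traceCLM V T = LinearMap.trace ℝ V (T : V →ₗ[ℝ] V) := rfl

lemma traceCLM_eq_sum {ι : Type*} [Fintype ι] [DecidableEq ι] (b : Module.Basis ι ℝ V)
    (T : V →L[ℝ] V) : traceCLM V T = ∑ i, b.coord i (T (b i)) := by
  rw [traceCLM_apply, LinearMap.trace_eq_matrix_trace ℝ b]
  simp [Matrix.trace, LinearMap.toMatrix_apply]

/-- A real endomorphism of square `-1` has trace zero: it is skew-adjoint for the inner product
`⟨v, w⟩ + ⟨Jv, Jw⟩`. -/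
lemma traceCLM_eq_zero_of_sq_eq_neg {J : V →L[ℝ] V} (hJ : ∀ v, J (J v) = -v) :
    traceCLM V J = 0 := by
  classical
  let b := Module.finBasis ℝ V
  rw [traceCLM_apply, LinearMap.trace_eq_matrix_trace ℝ b]
  set A := LinearMap.toMatrix b b (J : V →ₗ[ℝ] V) with hA
  have hAA : A * A = -1 := by
    rw [hA, ← LinearMap.toMatrix_comp b b b]
    have : (J : V →ₗ[ℝ] V) ∘ₗ (J : V →ₗ[ℝ] V) = -LinearMap.id := by
      ext v; simp [hJ]
    rw [this]; simp
  set S := 1 + A.transpose * A with hS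
  have hSpd : S.PosDef := by
    have h1 : (1 : Matrix (Fin (Module.finrank ℝ V)) (Fin (Module.finrank ℝ V)) ℝ).PosDef :=
      Matrix.PosDef.one
    have h2 := Matrix.posSemidef_conjTranspose_mul_self A
    simpa [hS] using h1.add_posSemidef h2
  have hdet : IsUnit S.det := hSpd.det_pos.ne'.isUnit
  have hST : S.transpose = S := by simp [hS]
  have hSA : S * A = A - A.transpose := by
    rw [hS, add_mul, one_mul, mul_assoc, hAA]; simp [sub_eq_add_neg]
  have hAeq : A = S⁻¹ * (A - A.transpose) := by
    rw [← hSA, ← mul_assoc, Matrix.nonsing_inv_mul _ hdet, one_mul]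
  have key : A.trace = -A.trace := by
    conv_lhs => rw [hAeq, ← Matrix.trace_transpose, Matrix.transpose_mul,
      Matrix.transpose_nonsing_inv, hST, Matrix.trace_mul_comm]
    conv_rhs => rw [hAeq]
    rw [← Matrix.trace_neg, ← mul_neg]
    simp
  linarith

variable [MeasurableSpace V] [BorelSpace V] (μ : Measure V) [μ.IsAddHaarMeasure]

lemma integral_fderiv_apply_eq_zero {G : V → ℂ} (hG : ContDiff ℝ 1 G)
    (hGc : HasCompactSupport G) (v : V) : ∫ x, fderiv ℝ G x v ∂μ = 0 := by
  have h := integral_mul_fderiv_eq_neg_fderiv_mul_of_integrable (μ := μ) (𝕜 := ℂ)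
    (f := fun _ ↦ 1) (g := G) (v := v) (by simp)
    (by
      simp only [one_mul]
      exact (hG.continuous_fderiv_apply_const v).integrable_of_hasCompactSupport
        (hGc.fderiv_apply ℝ v))
    (by simpa using hG.continuous.integrable_of_hasCompactSupport hGc)
    (fun x _ ↦ differentiableAt_const _)
    (fun x _ ↦ hG.differentiable one_ne_zero x)
  simpa using h

/-- The divergence theorem for the vector field `G • P`, where `G` is complex valued and compactly
supported in the domain of `P`. -/
theorem integral_fderiv_apply_add_trace_mul {G : V → ℂ} (hG : ContDiff ℝ 1 G)
    (hGc : HasCompactSupport G) {U : Set V} (hU : IsOpen U) (hGU : tsupport G ⊆ U) {P : V → V}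
    (hP : ContDiffOn ℝ 1 P U) :
    Integrable (fun x ↦ fderiv ℝ G x (P x)) μ ∧
    Integrable (fun x ↦ (traceCLM V (fderiv ℝ P x) : ℂ) * G x) μ ∧
    ∫ x, fderiv ℝ G x (P x) ∂μ = - ∫ x, (traceCLM V (fderiv ℝ P x) : ℂ) * G x ∂μ := by
  classical
  let b := Module.finBasis ℝ V
  let c : Fin (Module.finrank ℝ V) → V →L[ℝ] ℝ := fun i ↦
    LinearMap.toContinuousLinearMap (b.coord i)
  let h : Fin (Module.finrank ℝ V) → V → ℂ := fun i x ↦ c i (P x) • G x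
  have hPat : ∀ x ∈ tsupport G, ContDiffAt ℝ 1 P x := fun x hx ↦
    hP.contDiffAt (hU.mem_nhds (hGU hx))
  have hzero : ∀ x ∉ tsupport G, G x = 0 ∧ fderiv ℝ G x = 0 := fun x hx ↦
    ⟨image_eq_zero_of_notMem_tsupport hx, by
      have : G =ᶠ[𝓝 x] 0 := notMem_tsupport_iff_eventuallyEq.1 hx
      simpa using this.fderiv_eq⟩
  have hsupp : ∀ i, tsupport (h i) ⊆ tsupport G := fun i ↦
    closure_mono fun x hx hGx ↦ hx (by simp [h, hGx])
  have hh : ∀ i, ContDiff ℝ 1 (h i) := fun i ↦ by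
    rw [contDiff_iff_contDiffAt]
    intro x
    by_cases hx : x ∈ tsupport G
    · have h1 : ContDiffAt ℝ 1 (fun y ↦ c i (P y)) x :=
        (c i).contDiff.contDiffAt.comp x (hPat x hx)
      exact ContDiffAt.smul (f := fun y ↦ c i (P y)) h1 hG.contDiffAt
    · have : h i =ᶠ[𝓝 x] fun _ ↦ 0 :=
        notMem_tsupport_iff_eventuallyEq.1 (fun h' ↦ hx (hsupp i h'))
      exact contDiffAt_const.congr_of_eventuallyEq this
  have hhc : ∀ i, HasCompactSupport (h i) := fun i ↦
    HasCompactSupport.intro hGc fun x hx ↦ by simp [h, (hzero x hx).1]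
  have hfd : ∀ i, ∀ x, fderiv ℝ (h i) x (b i) =
      c i (P x) • fderiv ℝ G x (b i) + (c i (fderiv ℝ P x (b i)) : ℂ) * G x := by
    intro i x
    by_cases hx : x ∈ tsupport G
    · have h1 : HasFDerivAt P (fderiv ℝ P x) x :=
        ((hPat x hx).differentiableAt one_ne_zero).hasFDerivAt
      have h2 := HasFDerivAt.smul ((c i).hasFDerivAt.comp x h1)
        (hG.differentiable one_ne_zero x).hasFDerivAt
      have h3 : fderiv ℝ (h i) x = _ := h2.fderiv
      rw [h3]
      simp
    · have : fderiv ℝ (h i) x = 0 := by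
        have : h i =ᶠ[𝓝 x] 0 := notMem_tsupport_iff_eventuallyEq.1 (fun h' ↦ hx (hsupp i h'))
        simpa using this.fderiv_eq
      simp [this, hzero x hx]
  have hcontf : Continuous fun x ↦ fderiv ℝ G x (P x) := by
    rw [continuous_iff_continuousAt]
    intro x
    by_cases hx : x ∈ tsupport G
    · exact (hG.continuous_fderiv one_ne_zero).continuousAt.clm_apply (hPat x hx).continuousAt
    · have : (fun x ↦ fderiv ℝ G x (P x)) =ᶠ[𝓝 x] fun _ ↦ 0 := by
        filter_upwards [(isClosed_tsupport G).isOpen_compl.mem_nhds hx] with y hy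
        simp [(hzero y hy).2]
      exact this.continuousAt
  have hcontt : Continuous fun x ↦ (traceCLM V (fderiv ℝ P x) : ℂ) * G x := by
    rw [continuous_iff_continuousAt]
    intro x
    by_cases hx : x ∈ tsupport G
    · have h1 : ContinuousAt (fderiv ℝ P) x :=
        (((hP.continuousOn_fderiv_of_isOpen hU le_rfl) x (hGU hx)).continuousAt
          (hU.mem_nhds (hGU hx)))
      exact (Complex.continuous_ofReal.continuousAt.comp
        ((traceCLM V).continuous.continuousAt.comp h1)).mul hG.continuous.continuousAt
    · have : (fun x ↦ (traceCLM V (fderiv ℝ P x) : ℂ) * G x) =ᶠ[𝓝 x] fun _ ↦ 0 := by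
        filter_upwards [(isClosed_tsupport G).isOpen_compl.mem_nhds hx] with y hy
        simp [(hzero y hy).1]
      exact this.continuousAt
  have hi1 : Integrable (fun x ↦ fderiv ℝ G x (P x)) μ :=
    hcontf.integrable_of_hasCompactSupport (HasCompactSupport.intro hGc fun x hx ↦ by
      simp [(hzero x hx).2])
  have hi2 : Integrable (fun x ↦ (traceCLM V (fderiv ℝ P x) : ℂ) * G x) μ :=
    hcontt.integrable_of_hasCompactSupport (HasCompactSupport.intro hGc fun x hx ↦ by
      simp [(hzero x hx).1])
  refine ⟨hi1, hi2, ?_⟩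
  rw [eq_neg_iff_add_eq_zero, ← integral_add hi1 hi2]
  have hsum : ∀ x, fderiv ℝ G x (P x) + (traceCLM V (fderiv ℝ P x) : ℂ) * G x
      = ∑ i, fderiv ℝ (h i) x (b i) := by
    intro x
    simp_rw [hfd, Finset.sum_add_distrib]
    congr 1
    · conv_lhs => rw [← b.sum_repr (P x), map_sum]
      simp [c]
    · rw [traceCLM_eq_sum b, ← Finset.sum_mul]
      simp [c]
  simp_rw [hsum]
  rw [integral_finsetSum _ fun i _ ↦
    ((hh i).continuous_fderiv_apply_const _).integrable_of_hasCompactSupport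
        ((hhc i).fderiv_apply ℝ _)]
  exact Finset.sum_eq_zero fun i _ ↦ integral_fderiv_apply_eq_zero μ (hh i) (hhc i) _

end Divergence

/-! ### An approximate mean value property in the interior -/

section Interior

variable {V : Type*} [NormedAddCommGroup V]

lemma continuous_ofReal_mul_of_tsupport_subset {χ : V → ℝ} (hχ : Continuous χ) {U : Set V}
    (hU : IsOpen U) (hχU : tsupport χ ⊆ U) {H : V → ℂ} (hH : ContinuousOn H U) :
    Continuous fun w ↦ (χ w : ℂ) * H w := by
  refine continuous_of_tsupport fun x hx ↦ ?_
  have hsub : tsupport (fun w ↦ (χ w : ℂ) * H w) ⊆ tsupport χ :=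
    closure_mono fun y hy h0 ↦ hy (by simp [h0])
  have hx' : x ∈ tsupport χ := hsub hx
  exact (Complex.continuous_ofReal.continuousAt.comp hχ.continuousAt).mul
    (hH.continuousAt (hU.mem_nhds (hχU hx')))

variable [NormedSpace ℝ V]

lemma contDiff_ofReal_mul_of_tsupport_subset {χ : V → ℝ} (hχ : ContDiff ℝ 1 χ) {U : Set V}
    (hU : IsOpen U) (hχU : tsupport χ ⊆ U) {H : V → ℂ} (hH : ContDiffOn ℝ 1 H U) :
    ContDiff ℝ 1 fun w ↦ (χ w : ℂ) * H w := by
  rw [contDiff_iff_contDiffAt]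
  intro x
  by_cases hx : x ∈ tsupport χ
  · exact (Complex.ofRealCLM.contDiff.contDiffAt.comp x hχ.contDiffAt).mul
      (hH.contDiffAt (hU.mem_nhds (hχU hx)))
  · have : (fun w ↦ (χ w : ℂ) * H w) =ᶠ[𝓝 x] fun _ ↦ 0 := by
      filter_upwards [notMem_tsupport_iff_eventuallyEq.1 hx] with y hy
      simp [hy]
    exact contDiffAt_const.congr_of_eventuallyEq this

variable [FiniteDimensional ℝ V] [MeasurableSpace V]

lemma norm_integral_le_of_eq_zero_off_closedBall (μ : Measure V) [μ.IsAddHaarMeasure]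
    {f : V → ℂ} {B : ℝ} (hf : ∀ w ∈ Metric.closedBall (0 : V) 1, ‖f w‖ ≤ B)
    (hf0 : ∀ w ∉ Metric.closedBall (0 : V) 1, f w = 0) :
    ‖∫ w, f w ∂μ‖ ≤ B * μ.real (Metric.closedBall 0 1) := by
  rw [← setIntegral_eq_integral_of_forall_compl_eq_zero hf0]
  exact norm_setIntegral_le_of_norm_le_const
    (isCompact_closedBall (0 : V) 1).measure_lt_top hf

variable [BorelSpace V]

/-- The average of the derivative of `F` along the rotation field `w ↦ J w`, for a weight `χ`
invariant under the rotations generated by `J z₀`, is bounded in terms of `sup ‖F‖` alone, uniformly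
in the scale `s`. No bound for the gradient of `F` enters. -/
lemma norm_integral_fderiv_complexStructure_le (μ : Measure V) [μ.IsAddHaarMeasure]
    {z₀ : V} {R Λ M D : ℝ} {J : V → V →L[ℝ] V} {F : V → ℂ} {χ : V → ℝ}
    (hJ : ContDiffOn ℝ 1 J (Metric.ball z₀ R))
    (hJd : ∀ z ∈ Metric.ball z₀ R, ‖fderiv ℝ J z‖ ≤ Λ)
    (hJ2 : ∀ z ∈ Metric.ball z₀ R, ∀ v, J z (J z v) = -v)
    (hF : ContDiffOn ℝ 1 F (Metric.ball z₀ R))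
    (hM : ∀ z ∈ Metric.ball z₀ R, ‖F z‖ ≤ M)
    (hχ : ContDiff ℝ 1 χ) (hχs : tsupport χ ⊆ Metric.closedBall 0 1) (hχ1 : ∀ w, |χ w| ≤ 1)
    (hχd : ∀ w, ‖fderiv ℝ χ w‖ ≤ D) (hχJ : ∀ w, fderiv ℝ χ w (J z₀ w) = 0)
    {s : ℝ} (hs : 0 < s) (hsR : s < R) :
    ‖∫ w, (χ w : ℂ) * fderiv ℝ F (z₀ + s • w) (J (z₀ + s • w) w) ∂μ‖ ≤
      M * (D * Λ + ‖traceCLM V‖ * Λ) * μ.real (Metric.closedBall 0 1) := by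
  have hR : 0 < R := hs.trans hsR
  have hD : 0 ≤ D := (norm_nonneg _).trans (hχd 0)
  have hM0 : 0 ≤ M := (norm_nonneg _).trans (hM z₀ (Metric.mem_ball_self hR))
  have hΛ : 0 ≤ Λ := by
    have h := hJd z₀ (Metric.mem_ball_self hR)
    exact le_trans (ContinuousLinearMap.opNorm_nonneg _) h
  set U : Set V := Metric.ball 0 (R / s) with hUdef
  have hU : IsOpen U := Metric.isOpen_ball
  have hBU : Metric.closedBall (0 : V) 1 ⊆ U := by
    intro w hw
    rw [mem_closedBall_zero_iff] at hw
    rw [hUdef, mem_ball_zero_iff, lt_div_iff₀ hs]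
    nlinarith
  have hχU : tsupport χ ⊆ U := hχs.trans hBU
  have hmap : ∀ w ∈ U, z₀ + s • w ∈ Metric.ball z₀ R := by
    intro w hw
    rw [hUdef, mem_ball_zero_iff, lt_div_iff₀ hs] at hw
    rw [mem_ball_iff_norm, add_sub_cancel_left, norm_smul, Real.norm_of_nonneg hs.le]
    linarith
  have haff : ContDiff ℝ 1 fun w : V ↦ z₀ + s • w :=
    contDiff_const.add (contDiff_const.smul contDiff_id)
  have haff' : ∀ w : V, HasFDerivAt (fun w : V ↦ z₀ + s • w) (s • ContinuousLinearMap.id ℝ V) w :=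
    fun w ↦ ((hasFDerivAt_id w).const_smul s).const_add z₀
  have hFs : ContDiffOn ℝ 1 (fun w ↦ F (z₀ + s • w)) U := hF.comp haff.contDiffOn hmap
  have hJs : ContDiffOn ℝ 1 (fun w ↦ J (z₀ + s • w)) U := hJ.comp haff.contDiffOn hmap
  have hP : ContDiffOn ℝ 1 (fun w ↦ J (z₀ + s • w) w) U := hJs.clm_apply contDiffOn_id
  set G : V → ℂ := fun w ↦ (χ w : ℂ) * F (z₀ + s • w) with hGdef
  have hG : ContDiff ℝ 1 G := contDiff_ofReal_mul_of_tsupport_subset hχ hU hχU hFs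
  have hχc : HasCompactSupport χ :=
    (isCompact_closedBall (0 : V) 1).of_isClosed_subset (isClosed_tsupport χ) hχs
  have hGs : tsupport G ⊆ tsupport χ := closure_mono fun x hx h0 ↦ hx (by simp [hGdef, h0])
  have hGc : HasCompactSupport G := hχc.of_isClosed_subset (isClosed_tsupport G) hGs
  obtain ⟨hi1, hi2, hdiv⟩ := integral_fderiv_apply_add_trace_mul μ hG hGc hU (hGs.trans hχU) hP
  have hoff : ∀ w ∉ Metric.closedBall (0 : V) 1, χ w = 0 ∧ fderiv ℝ χ w = 0 := fun w hw ↦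
    ⟨image_eq_zero_of_notMem_tsupport fun h ↦ hw (hχs h), by
      have : χ =ᶠ[𝓝 w] 0 := notMem_tsupport_iff_eventuallyEq.1 fun h ↦ hw (hχs h)
      simpa using this.fderiv_eq⟩
  have hGoff : ∀ w ∉ Metric.closedBall (0 : V) 1, G w = 0 ∧ fderiv ℝ G w = 0 := fun w hw ↦
    ⟨by simp [hGdef, (hoff w hw).1], by
      have : G =ᶠ[𝓝 w] 0 := notMem_tsupport_iff_eventuallyEq.1 fun h ↦ hw (hχs (hGs h))
      simpa using this.fderiv_eq⟩
  have hFat : ∀ w ∈ U, DifferentiableAt ℝ F (z₀ + s • w) := fun w hw ↦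
    (hF.contDiffAt (Metric.isOpen_ball.mem_nhds (hmap w hw))).differentiableAt one_ne_zero
  have hJat : ∀ w ∈ U, DifferentiableAt ℝ J (z₀ + s • w) := fun w hw ↦
    (hJ.contDiffAt (Metric.isOpen_ball.mem_nhds (hmap w hw))).differentiableAt one_ne_zero
  -- the product rule for `G`
  have hGd : ∀ w, fderiv ℝ G w (J (z₀ + s • w) w) =
      (fderiv ℝ χ w (J (z₀ + s • w) w) : ℂ) * F (z₀ + s • w) +
        (s : ℂ) * ((χ w : ℂ) * fderiv ℝ F (z₀ + s • w) (J (z₀ + s • w) w)) := by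
    intro w
    by_cases hw : w ∈ Metric.closedBall (0 : V) 1
    · have h1 : HasFDerivAt (fun w ↦ F (z₀ + s • w)) _ w :=
        (hFat w (hBU hw)).hasFDerivAt.comp w (haff' w)
      have h2 : HasFDerivAt (fun w ↦ (χ w : ℂ)) _ w :=
        Complex.ofRealCLM.hasFDerivAt.comp w (hχ.differentiable one_ne_zero w).hasFDerivAt
      have h3 : fderiv ℝ G w = _ := (h2.mul h1).fderiv
      rw [h3]
      simp
      ring
    · simp [(hoff w hw).1, (hoff w hw).2, (hGoff w hw).2]
  have hPd : ∀ w ∈ U, ∀ v, fderiv ℝ (fun w ↦ J (z₀ + s • w) w) w v =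
      J (z₀ + s • w) v + s • fderiv ℝ J (z₀ + s • w) v w := by
    intro w hw v
    have h1 : HasFDerivAt (fun w ↦ J (z₀ + s • w)) _ w :=
      (hJat w hw).hasFDerivAt.comp w (haff' w)
    have h3 : fderiv ℝ (fun w ↦ J (z₀ + s • w) w) w = _ := (h1.clm_apply (hasFDerivAt_id w)).fderiv
    rw [h3]
    simp
  -- The divergence of `w ↦ J (z₀ + s w) w` is `tr J = 0` plus a term with the factor `s`.
  have htr : ∀ w ∈ Metric.closedBall (0 : V) 1,
      |traceCLM V (fderiv ℝ (fun w ↦ J (z₀ + s • w) w) w)| ≤ s * (‖traceCLM V‖ * Λ) := by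
    intro w hw
    have hz := hmap w (hBU hw)
    have h1 : fderiv ℝ (fun w ↦ J (z₀ + s • w) w) w =
        J (z₀ + s • w) + s • (fderiv ℝ J (z₀ + s • w)).flip w := by
      ext v; simp [hPd w (hBU hw) v]
    rw [h1, map_add, traceCLM_eq_zero_of_sq_eq_neg (hJ2 _ hz), zero_add, map_smul, smul_eq_mul,
      abs_mul, abs_of_pos hs]
    gcongr
    refine ((traceCLM V).le_opNorm _).trans ?_
    gcongr
    rw [mem_closedBall_zero_iff] at hw
    calc ‖(fderiv ℝ J (z₀ + s • w)).flip w‖ ≤ ‖(fderiv ℝ J (z₀ + s • w)).flip‖ * ‖w‖ :=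
          ContinuousLinearMap.le_opNorm _ _
      _ ≤ Λ * 1 := by
          rw [ContinuousLinearMap.opNorm_flip]
          gcongr
          exact hJd _ hz
      _ = Λ := mul_one _
  have hχP : ∀ w ∈ Metric.closedBall (0 : V) 1,
      |fderiv ℝ χ w (J (z₀ + s • w) w)| ≤ s * (D * Λ) := by
    intro w hw
    have hz := hmap w (hBU hw)
    rw [mem_closedBall_zero_iff] at hw
    have h1 : ‖J (z₀ + s • w) - J z₀‖ ≤ Λ * (s * 1) := by
      have := (convex_ball z₀ R).norm_image_sub_le_of_norm_fderiv_le (𝕜 := ℝ) (f := J)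
        (fun z hz ↦ (hJ.contDiffAt (Metric.isOpen_ball.mem_nhds hz)).differentiableAt one_ne_zero)
        hJd (Metric.mem_ball_self hR) hz
      refine this.trans ?_
      rw [add_sub_cancel_left, norm_smul, Real.norm_of_nonneg hs.le]
      gcongr
    have h2 : fderiv ℝ χ w (J (z₀ + s • w) w) = fderiv ℝ χ w ((J (z₀ + s • w) - J z₀) w) := by
      simp [hχJ]
    rw [h2, ← Real.norm_eq_abs]
    calc _ ≤ ‖fderiv ℝ χ w‖ * (‖J (z₀ + s • w) - J z₀‖ * ‖w‖) :=
          (ContinuousLinearMap.le_opNorm _ _).trans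
            (by gcongr; exact ContinuousLinearMap.le_opNorm _ _)
      _ ≤ D * ((Λ * (s * 1)) * 1) := by
          gcongr
          exact hχd w
      _ = _ := by ring
  have hi3 : Integrable (fun w ↦ (χ w : ℂ) * fderiv ℝ F (z₀ + s • w) (J (z₀ + s • w) w)) μ := by
    refine Continuous.integrable_of_hasCompactSupport ?_ (HasCompactSupport.intro
      (isCompact_closedBall (0 : V) 1) fun w hw ↦ by simp [(hoff w hw).1])
    refine continuous_ofReal_mul_of_tsupport_subset hχ.continuous hU hχU ?_
    exact ((hF.continuousOn_fderiv_of_isOpen Metric.isOpen_ball le_rfl).comp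
      haff.continuous.continuousOn hmap).clm_apply hP.continuousOn
  -- The divergence theorem for the field `w ↦ J (z₀ + s w) w`. Both terms on the right are `O(s)`,
  -- as `dχ (J z₀ w) = 0` and `tr J = 0`, so that the factor `s` of the chain rule cancels.
  have hkey : (s : ℂ) * ∫ w, (χ w : ℂ) * fderiv ℝ F (z₀ + s • w) (J (z₀ + s • w) w) ∂μ =
      ∫ w, -((traceCLM V (fderiv ℝ (fun w ↦ J (z₀ + s • w) w) w) : ℂ) * G w +
        (fderiv ℝ χ w (J (z₀ + s • w) w) : ℂ) * F (z₀ + s • w)) ∂μ := by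
    have hi4 : Integrable (fun w ↦ (fderiv ℝ χ w (J (z₀ + s • w) w) : ℂ) * F (z₀ + s • w)) μ := by
      have := hi1.sub (hi3.const_mul (s : ℂ))
      refine this.congr (Eventually.of_forall fun w ↦ ?_)
      simp only [Pi.sub_apply, hGd w]
      ring
    simp_rw [neg_add]
    have e1 : ∫ w, (-((traceCLM V (fderiv ℝ (fun w ↦ J (z₀ + s • w) w) w) : ℂ) * G w) +
        -((fderiv ℝ χ w (J (z₀ + s • w) w) : ℂ) * F (z₀ + s • w))) ∂μ = _ :=
      integral_add hi2.neg hi4.neg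
    have e2 : ∫ w, fderiv ℝ G w (J (z₀ + s • w) w) ∂μ =
        ∫ w, (fderiv ℝ χ w (J (z₀ + s • w) w) : ℂ) * F (z₀ + s • w) ∂μ +
        (s : ℂ) * ∫ w, (χ w : ℂ) * fderiv ℝ F (z₀ + s • w) (J (z₀ + s • w) w) ∂μ := by
      rw [← integral_const_mul, ← integral_add hi4 (hi3.const_mul _)]
      exact integral_congr_ae (Eventually.of_forall hGd)
    rw [e1, integral_neg, integral_neg, ← hdiv, e2]
    ring
  have hnorm : s * ‖∫ w, (χ w : ℂ) * fderiv ℝ F (z₀ + s • w) (J (z₀ + s • w) w) ∂μ‖ ≤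
      (s * (M * (D * Λ + ‖traceCLM V‖ * Λ))) * μ.real (Metric.closedBall 0 1) := by
    have : s * ‖∫ w, (χ w : ℂ) * fderiv ℝ F (z₀ + s • w) (J (z₀ + s • w) w) ∂μ‖ =
        ‖(s : ℂ) * ∫ w, (χ w : ℂ) * fderiv ℝ F (z₀ + s • w) (J (z₀ + s • w) w) ∂μ‖ := by
      rw [norm_mul, Complex.norm_real, Real.norm_of_nonneg hs.le]
    rw [this, hkey]
    refine norm_integral_le_of_eq_zero_off_closedBall μ (fun w hw ↦ ?_) (fun w hw ↦ ?_)
    · have hFw : ‖F (z₀ + s • w)‖ ≤ M := hM _ (hmap w (hBU hw))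
      have hGw : ‖G w‖ ≤ M := by
        rw [hGdef, norm_mul, Complex.norm_real, Real.norm_eq_abs]
        calc _ ≤ 1 * M := by gcongr; exact hχ1 w
          _ = M := one_mul _
      rw [norm_neg]
      have h1 : ‖(traceCLM V (fderiv ℝ (fun w ↦ J (z₀ + s • w) w) w) : ℂ) * G w‖ ≤
          (s * (‖traceCLM V‖ * Λ)) * M := by
        rw [norm_mul, Complex.norm_real, Real.norm_eq_abs]
        exact mul_le_mul (htr w hw) hGw (norm_nonneg _) (by positivity)
      have h2 : ‖(fderiv ℝ χ w (J (z₀ + s • w) w) : ℂ) * F (z₀ + s • w)‖ ≤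
          (s * (D * Λ)) * M := by
        rw [norm_mul, Complex.norm_real, Real.norm_eq_abs]
        exact mul_le_mul (hχP w hw) hFw (norm_nonneg _) (by positivity)
      linarith [norm_add_le ((traceCLM V (fderiv ℝ (fun w ↦ J (z₀ + s • w) w) w) : ℂ) * G w)
        ((fderiv ℝ χ w (J (z₀ + s • w) w) : ℂ) * F (z₀ + s • w))]
    · simp [(hGoff w hw).1, (hoff w hw).2]
  rw [mul_assoc] at hnorm
  exact le_of_mul_le_mul_left hnorm hs

/-- Approximate mean value property: if `dF ∘ J` is `i dF` up to a bounded error, then `F z₀` is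
the average of `F` over the ball of radius `r`, for a weight `χ` invariant under the rotations
generated by `J z₀`, up to an error of order `r`. -/
theorem norm_mul_integral_sub_integral_le (μ : Measure V) [μ.IsAddHaarMeasure]
    {z₀ : V} {R Λ M D C : ℝ} {J : V → V →L[ℝ] V} {F : V → ℂ} {χ : V → ℝ}
    (hJ : ContDiffOn ℝ 1 J (Metric.ball z₀ R))
    (hJd : ∀ z ∈ Metric.ball z₀ R, ‖fderiv ℝ J z‖ ≤ Λ)
    (hJ2 : ∀ z ∈ Metric.ball z₀ R, ∀ v, J z (J z v) = -v)
    (hF : ContDiffOn ℝ 1 F (Metric.ball z₀ R))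
    (hM : ∀ z ∈ Metric.ball z₀ R, ‖F z‖ ≤ M)
    (hC : ∀ z ∈ Metric.ball z₀ R, ∀ v,
      ‖fderiv ℝ F z v + Complex.I * fderiv ℝ F z (J z v)‖ ≤ C * ‖v‖) (hC0 : 0 ≤ C)
    (hχ : ContDiff ℝ 1 χ) (hχs : tsupport χ ⊆ Metric.closedBall 0 1) (hχ1 : ∀ w, |χ w| ≤ 1)
    (hχd : ∀ w, ‖fderiv ℝ χ w‖ ≤ D) (hχJ : ∀ w, fderiv ℝ χ w (J z₀ w) = 0)
    {r : ℝ} (hr : 0 < r) (hrR : r < R) :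
    ‖F z₀ * (∫ w, χ w ∂μ : ℝ) - ∫ w, (χ w : ℂ) * F (z₀ + r • w) ∂μ‖ ≤
      (C + M * (D * Λ + ‖traceCLM V‖ * Λ)) * μ.real (Metric.closedBall 0 1) * r := by
  set K := (C + M * (D * Λ + ‖traceCLM V‖ * Λ)) * μ.real (Metric.closedBall 0 1) with hK
  have hχ0 : ∀ w ∉ Metric.closedBall (0 : V) 1, χ w = 0 := fun w hw ↦
    image_eq_zero_of_notMem_tsupport fun h ↦ hw (hχs h)
  obtain ⟨r₁, hr₁, hr₁R⟩ := exists_between hrR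
  have hr₁0 : 0 < r₁ := hr.trans hr₁
  have hmap : ∀ s ∈ Ioo (-r₁) r₁, ∀ w ∈ Metric.closedBall (0 : V) 1,
      z₀ + s • w ∈ Metric.closedBall z₀ r₁ := by
    intro s hs w hw
    rw [mem_closedBall_zero_iff] at hw
    rw [mem_closedBall_iff_norm, add_sub_cancel_left, norm_smul]
    have : ‖s‖ ≤ r₁ := (abs_lt.2 hs).le
    calc ‖s‖ * ‖w‖ ≤ r₁ * 1 := by gcongr
      _ = r₁ := mul_one _
  have hsub : Metric.closedBall z₀ r₁ ⊆ Metric.ball z₀ R := Metric.closedBall_subset_ball hr₁R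
  have hFd : ∀ z ∈ Metric.ball z₀ R, DifferentiableAt ℝ F z := fun z hz ↦
    (hF.contDiffAt (Metric.isOpen_ball.mem_nhds hz)).differentiableAt one_ne_zero
  obtain ⟨B, hB⟩ := (isCompact_closedBall z₀ r₁).exists_bound_of_continuousOn
    ((hF.continuousOn_fderiv_of_isOpen Metric.isOpen_ball le_rfl).mono hsub)
  have hB0 : 0 ≤ B := (norm_nonneg _).trans (hB z₀ (Metric.mem_closedBall_self hr₁0.le))
  have hcont : ∀ s ∈ Ioo (-r₁) r₁, ∀ H : V → V → ℂ,
      ContinuousOn (fun p : V × V ↦ H p.1 p.2) (Metric.ball z₀ R ×ˢ univ) →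
      Integrable (fun w ↦ (χ w : ℂ) * H (z₀ + s • w) w) μ := by
    intro s hs H hH
    refine Continuous.integrable_of_hasCompactSupport ?_ (HasCompactSupport.intro
      (isCompact_closedBall (0 : V) 1) fun w hw ↦ by simp [hχ0 w hw])
    have hopen : IsOpen {w : V | z₀ + s • w ∈ Metric.ball z₀ R} :=
      Metric.isOpen_ball.preimage (by fun_prop)
    refine continuous_ofReal_mul_of_tsupport_subset hχ.continuous hopen
      (fun w hw ↦ hsub (hmap s hs w (hχs hw))) ?_
    exact hH.comp (f := fun w : V ↦ (z₀ + s • w, w)) (by fun_prop) fun w hw ↦ ⟨hw, mem_univ _⟩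
  have hDFc : ContinuousOn (fun p : V × V ↦ fderiv ℝ F p.1 p.2) (Metric.ball z₀ R ×ˢ univ) :=
    ((hF.continuousOn_fderiv_of_isOpen Metric.isOpen_ball le_rfl).comp continuousOn_fst
      fun p hp ↦ hp.1).clm_apply continuousOn_snd
  have hderiv : ∀ s ∈ Ioo (-r₁) r₁, HasDerivAt (fun s : ℝ ↦ ∫ w, (χ w : ℂ) * F (z₀ + s • w) ∂μ)
      (∫ w, (χ w : ℂ) * fderiv ℝ F (z₀ + s • w) w ∂μ) s := by
    intro s hs
    refine (hasDerivAt_integral_of_dominated_loc_of_deriv_le (s := Ioo (-r₁) r₁)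
      (bound := (Metric.closedBall (0 : V) 1).indicator fun _ ↦ B)
      (F' := fun s w ↦ (χ w : ℂ) * fderiv ℝ F (z₀ + s • w) w)
      (Ioo_mem_nhds hs.1 hs.2) ?_ ?_ ?_ ?_ ?_ ?_).2
    · filter_upwards [Ioo_mem_nhds hs.1 hs.2] with t ht
      exact (hcont t ht (fun z _ ↦ F z) (hF.continuousOn.comp continuousOn_fst
        fun p hp ↦ hp.1)).aestronglyMeasurable
    · exact hcont s hs (fun z _ ↦ F z) (hF.continuousOn.comp continuousOn_fst fun p hp ↦ hp.1)
    · exact (hcont s hs (fun z w ↦ fderiv ℝ F z w) hDFc).aestronglyMeasurable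
    · refine Eventually.of_forall fun w t ht ↦ ?_
      by_cases hw : w ∈ Metric.closedBall (0 : V) 1
      · rw [indicator_of_mem hw, norm_mul, Complex.norm_real, Real.norm_eq_abs]
        have h1 : ‖fderiv ℝ F (z₀ + t • w) w‖ ≤ B * 1 := by
          refine (ContinuousLinearMap.le_opNorm _ _).trans ?_
          rw [mem_closedBall_zero_iff] at hw
          gcongr
          exact hB _ (hmap t ht w (mem_closedBall_zero_iff.2 hw))
        calc _ ≤ 1 * (B * 1) := by gcongr; exact hχ1 w
          _ = B := by ring
      · simp [hχ0 w hw, indicator_of_notMem hw]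
    · exact (integrable_indicator_iff Metric.isClosed_closedBall.measurableSet).2
        (integrableOn_const (isCompact_closedBall (0 : V) 1).measure_lt_top.ne)
    · refine Eventually.of_forall fun w t ht ↦ ?_
      by_cases hw : w ∈ Metric.closedBall (0 : V) 1
      · have h1 : HasDerivAt (fun t : ℝ ↦ z₀ + t • w) w t := by
          simpa using ((hasDerivAt_id t).smul_const w).const_add z₀
        exact ((hFd _ (hsub (hmap t ht w hw))).hasFDerivAt.comp_hasDerivAt t h1).const_mul _
      · simpa [hχ0 w hw] using hasDerivAt_const t (0 : ℂ)
  have hbound : ∀ s ∈ Ioo 0 r₁, ‖∫ w, (χ w : ℂ) * fderiv ℝ F (z₀ + s • w) w ∂μ‖ ≤ K := by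
    intro s hs
    have hs' : s ∈ Ioo (-r₁) r₁ := ⟨by linarith [hs.1], hs.2⟩
    have hJc : ContinuousOn (fun p : V × V ↦ fderiv ℝ F p.1 (J p.1 p.2))
        (Metric.ball z₀ R ×ˢ univ) :=
      ((hF.continuousOn_fderiv_of_isOpen Metric.isOpen_ball le_rfl).comp continuousOn_fst
        fun p hp ↦ hp.1).clm_apply ((hJ.continuousOn.comp continuousOn_fst
        fun p hp ↦ hp.1).clm_apply continuousOn_snd)
    have hi1 := hcont s hs' (fun z w ↦ fderiv ℝ F z w) hDFc
    have hi2 := hcont s hs' (fun z w ↦ fderiv ℝ F z (J z w)) hJc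
    have e : ∫ w, (χ w : ℂ) * fderiv ℝ F (z₀ + s • w) w ∂μ =
        ∫ w, (χ w : ℂ) * (fderiv ℝ F (z₀ + s • w) w +
          Complex.I * fderiv ℝ F (z₀ + s • w) (J (z₀ + s • w) w)) ∂μ -
        Complex.I * ∫ w, (χ w : ℂ) * fderiv ℝ F (z₀ + s • w) (J (z₀ + s • w) w) ∂μ := by
      rw [← integral_const_mul, eq_sub_iff_add_eq, ← integral_add hi1 (hi2.const_mul _)]
      refine integral_congr_ae (Eventually.of_forall fun w ↦ ?_)
      simp only
      ring
    rw [e]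
    refine (norm_sub_le _ _).trans ?_
    rw [norm_mul, Complex.norm_I, one_mul, hK, add_mul]
    refine add_le_add (norm_integral_le_of_eq_zero_off_closedBall μ (fun w hw ↦ ?_)
      fun w hw ↦ by simp [hχ0 w hw])
      (norm_integral_fderiv_complexStructure_le μ hJ hJd hJ2 hF hM hχ hχs hχ1 hχd hχJ hs.1
        (hs.2.trans hr₁R))
    rw [norm_mul, Complex.norm_real, Real.norm_eq_abs]
    have h1 := hC _ (hsub (hmap s hs' w hw)) w
    rw [mem_closedBall_zero_iff] at hw
    calc _ ≤ 1 * (C * 1) := by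
          gcongr
          · exact hχ1 w
          · exact h1.trans (by gcongr)
      _ = C := by ring
  have hlip : ∀ s ∈ Ioo 0 r, ‖(∫ w, (χ w : ℂ) * F (z₀ + s • w) ∂μ) -
      ∫ w, (χ w : ℂ) * F (z₀ + r • w) ∂μ‖ ≤ K * (r - s) := by
    intro s hs
    have := (convex_Icc s r).norm_image_sub_le_of_norm_hasDerivWithin_le
      (f := fun s : ℝ ↦ ∫ w, (χ w : ℂ) * F (z₀ + s • w) ∂μ) (C := K)
      (fun t ht ↦ (hderiv t ⟨by linarith [hs.1, ht.1], by linarith [ht.2]⟩).hasDerivWithinAt)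
      (fun t ht ↦ hbound t ⟨by linarith [hs.1, ht.1], by linarith [ht.2]⟩)
      (right_mem_Icc.2 hs.2.le) (left_mem_Icc.2 hs.2.le)
    simpa [abs_of_nonpos (sub_nonpos.2 hs.2.le)] using this
  have hlim : Tendsto (fun s : ℝ ↦ ‖(∫ w, (χ w : ℂ) * F (z₀ + s • w) ∂μ) -
      ∫ w, (χ w : ℂ) * F (z₀ + r • w) ∂μ‖) (𝓝[>] 0)
      (𝓝 ‖(∫ w, (χ w : ℂ) * F (z₀ + (0 : ℝ) • w) ∂μ) -
        ∫ w, (χ w : ℂ) * F (z₀ + r • w) ∂μ‖) :=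
    (((hderiv 0 ⟨by linarith, hr₁0⟩).continuousAt.tendsto.mono_left
      nhdsWithin_le_nhds).sub_const _).norm
  have hlim2 : Tendsto (fun s : ℝ ↦ K * (r - s)) (𝓝[>] 0) (𝓝 (K * (r - 0))) :=
    ((by fun_prop : Continuous fun s : ℝ ↦ K * (r - s)).tendsto 0).mono_left nhdsWithin_le_nhds
  have := le_of_tendsto_of_tendsto hlim hlim2
    (by filter_upwards [Ioo_mem_nhdsGT hr] with s hs using hlip s hs)
  simp only [zero_smul, add_zero, sub_zero] at this
  rw [integral_mul_const, integral_complex_ofReal, mul_comm] at this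
  exact this

end Interior

/-! ### Weights invariant under a complex structure -/

section Weight

open scoped RealInnerProductSpace

lemma exists_forall_abs_deriv_smoothTransition_le :
    ∃ K : ℝ, 0 < K ∧ ∀ x, |deriv Real.smoothTransition x| ≤ K := by
  have hc : Continuous (deriv Real.smoothTransition) :=
    (Real.smoothTransition.contDiff (n := 1)).continuous_deriv le_rfl
  obtain ⟨K, hK⟩ := (isCompact_Icc (a := (0 : ℝ)) (b := 1)).exists_bound_of_continuousOn
    hc.continuousOn
  refine ⟨|K| + 1, by positivity, fun x ↦ ?_⟩
  by_cases hx : x ∈ Icc (0 : ℝ) 1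
  · linarith [hK x hx, le_abs_self K, Real.norm_eq_abs (deriv Real.smoothTransition x)]
  · have : deriv Real.smoothTransition x = 0 := by
      rw [mem_Icc, not_and_or, not_le, not_le] at hx
      rcases hx with hx | hx
      · have : Real.smoothTransition =ᶠ[𝓝 x] fun _ ↦ 0 := by
          filter_upwards [Iio_mem_nhds hx] with y hy
          exact Real.smoothTransition.zero_of_nonpos (le_of_lt hy)
        simpa using this.deriv_eq
      · have : Real.smoothTransition =ᶠ[𝓝 x] fun _ ↦ 1 := by
          filter_upwards [Ioi_mem_nhds hx] with y hy
          exact Real.smoothTransition.one_of_one_le (le_of_lt hy)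
        simpa using this.deriv_eq
    rw [this, abs_zero]
    positivity

variable {X : Type*} [NormedAddCommGroup X]

/-- The squared Euclidean norm on `X × X`, whose norm is the maximum norm. -/
def prodNormSq (w : X × X) : ℝ := ‖w.1‖ ^ 2 + ‖w.2‖ ^ 2

lemma norm_sq_le_prodNormSq (w : X × X) : ‖w‖ ^ 2 ≤ prodNormSq w := by
  rw [Prod.norm_def, prodNormSq]
  rcases max_cases ‖w.1‖ ‖w.2‖ with ⟨h, -⟩ | ⟨h, -⟩ <;> rw [h] <;>
    nlinarith [sq_nonneg ‖w.1‖, sq_nonneg ‖w.2‖]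

lemma prodNormSq_le (w : X × X) : prodNormSq w ≤ 2 * ‖w‖ ^ 2 := by
  rw [prodNormSq]
  have h1 := norm_fst_le w
  have h2 := norm_snd_le w
  nlinarith [norm_nonneg w.1, norm_nonneg w.2, norm_nonneg w]

variable [InnerProductSpace ℝ X]

lemma contDiff_prodNormSq : ContDiff ℝ 1 (prodNormSq : X × X → ℝ) :=
  (contDiff_fst.norm_sq ℝ).add (contDiff_snd.norm_sq ℝ)

lemma hasFDerivAt_prodNormSq (w : X × X) :
    ∃ L : X × X →L[ℝ] ℝ, HasFDerivAt prodNormSq L w ∧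
      ∀ v, L v = 2 * (⟪w.1, v.1⟫ + ⟪w.2, v.2⟫) := by
  have h1 := (hasFDerivAt_fst (𝕜 := ℝ) (p := w)).norm_sq
  have h2 := (hasFDerivAt_snd (𝕜 := ℝ) (p := w)).norm_sq
  refine ⟨_, h1.add h2, fun v ↦ ?_⟩
  simp
  ring

lemma abs_inner_add_inner_le (w v : X × X) : |⟪w.1, v.1⟫ + ⟪w.2, v.2⟫| ≤ 2 * (‖w‖ * ‖v‖) := by
  refine (abs_add_le _ _).trans ?_
  have h1 := (abs_real_inner_le_norm w.1 v.1).trans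
    (mul_le_mul (norm_fst_le w) (norm_fst_le v) (norm_nonneg _) (norm_nonneg _))
  have h2 := (abs_real_inner_le_norm w.2 v.2).trans
    (mul_le_mul (norm_snd_le w) (norm_snd_le v) (norm_nonneg _) (norm_nonneg _))
  linarith

/-- For every complex structure `J` on `X × X` there is a weight supported in the unit ball that is
invariant under the rotations generated by `J`; it is controlled by a bound for `J`. It is a
function of the quadratic form `|w|² + |Jw|²`. -/
lemma exists_invariant_weight [FiniteDimensional ℝ X] [MeasurableSpace X] [BorelSpace X]
    (μ : Measure (X × X)) [μ.IsAddHaarMeasure] {B : ℝ} (hB : 0 ≤ B) :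
    ∃ D m : ℝ, 0 < m ∧ ∀ J : X × X →L[ℝ] X × X, ‖J‖ ≤ B → (∀ v, J (J v) = -v) →
      ∃ χ : X × X → ℝ, ContDiff ℝ 1 χ ∧ tsupport χ ⊆ Metric.closedBall 0 1 ∧ (∀ w, |χ w| ≤ 1) ∧
        (∀ w, ‖fderiv ℝ χ w‖ ≤ D) ∧ (∀ w, fderiv ℝ χ w (J w) = 0) ∧ m ≤ ∫ w, χ w ∂μ := by
  obtain ⟨K, hK0, hK⟩ := exists_forall_abs_deriv_smoothTransition_le
  -- On the ball of radius `δ` the quadratic form is at most `1 / 2`, so that `χ = 1` there.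
  set δ : ℝ := 1 / (2 * (1 + B)) with hδ
  have hδ0 : 0 < δ := by positivity
  have hδB : δ ^ 2 * (2 + 2 * B ^ 2) ≤ 1 / 2 := by
    rw [hδ, div_pow, one_pow, div_mul_eq_mul_div, one_mul, div_le_iff₀ (by positivity)]
    nlinarith
  refine ⟨K * (2 * (4 + 4 * B ^ 2)), μ.real (Metric.closedBall 0 δ), ?_, fun J hJB hJ2 ↦ ?_⟩
  · exact ENNReal.toReal_pos (Metric.measure_closedBall_pos μ 0 hδ0).ne'
      (isCompact_closedBall _ _).measure_lt_top.ne
  have hJw : ∀ w, ‖J w‖ ≤ B * ‖w‖ := fun w ↦ J.le_of_opNorm_le hJB w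
  set q : X × X → ℝ := fun w ↦ prodNormSq w + prodNormSq (J w) with hq
  have hq1 : ∀ w, ‖w‖ ^ 2 ≤ q w := fun w ↦ by
    have h1 := norm_sq_le_prodNormSq w
    have h2 := norm_sq_le_prodNormSq (J w)
    simp only [hq]
    nlinarith [sq_nonneg ‖J w‖]
  have hq2 : ∀ w, q w ≤ ‖w‖ ^ 2 * (2 + 2 * B ^ 2) := fun w ↦ by
    have h1 := prodNormSq_le w
    have h2 := prodNormSq_le (J w)
    have h3 : ‖J w‖ ^ 2 ≤ (B * ‖w‖) ^ 2 := by gcongr; exact hJw w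
    simp only [hq]
    nlinarith
  have hqc : ContDiff ℝ 1 q := contDiff_prodNormSq.add (contDiff_prodNormSq.comp J.contDiff)
  have hqd : ∀ w v, fderiv ℝ q w v =
      2 * (⟪w.1, v.1⟫ + ⟪w.2, v.2⟫) + 2 * (⟪(J w).1, (J v).1⟫ + ⟪(J w).2, (J v).2⟫) := by
    intro w v
    obtain ⟨L, hL, hLv⟩ := hasFDerivAt_prodNormSq w
    obtain ⟨L', hL', hLv'⟩ := hasFDerivAt_prodNormSq (J w)
    have h : fderiv ℝ q w = _ := (hL.add (hL'.comp w J.hasFDerivAt)).fderiv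
    rw [h]
    simp [hLv, hLv']
  set χ : X × X → ℝ := fun w ↦ Real.smoothTransition (2 * (1 - q w)) with hχ
  have hχc : ContDiff ℝ 1 χ :=
    Real.smoothTransition.contDiff.comp (contDiff_const.mul (contDiff_const.sub hqc))
  have hχd : ∀ w v, fderiv ℝ χ w v =
      deriv Real.smoothTransition (2 * (1 - q w)) * (-2 * fderiv ℝ q w v) := by
    intro w v
    have h1 : HasFDerivAt (fun w ↦ 2 * (1 - q w)) _ w :=
      ((hqc.differentiable one_ne_zero w).hasFDerivAt.const_sub 1).const_mul 2
    have h2 : HasDerivAt Real.smoothTransition _ (2 * (1 - q w)) :=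
      ((Real.smoothTransition.contDiff (n := 1)).differentiable one_ne_zero _).hasDerivAt
    have h3 := (h2.comp_hasFDerivAt w h1).fderiv
    change fderiv ℝ χ w = _ at h3
    rw [h3]
    simp
  have hχ0 : ∀ w, 1 ≤ q w → χ w = 0 := fun w hw ↦
    Real.smoothTransition.zero_of_nonpos (by linarith)
  have hsupp : tsupport χ ⊆ Metric.closedBall 0 1 := by
    refine closure_minimal (fun w hw ↦ ?_) Metric.isClosed_closedBall
    by_contra hw'
    rw [mem_closedBall_zero_iff, not_le] at hw'
    exact hw (hχ0 w (by nlinarith [hq1 w]))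
  have hχcs : HasCompactSupport χ :=
    (isCompact_closedBall (0 : X × X) 1).of_isClosed_subset (isClosed_tsupport χ) hsupp
  refine ⟨χ, hχc, hsupp, fun w ↦ ?_, fun w ↦ ?_, fun w ↦ ?_, ?_⟩
  · rw [abs_of_nonneg (Real.smoothTransition.nonneg _)]
    exact Real.smoothTransition.le_one _
  · refine ContinuousLinearMap.opNorm_le_bound _ (by positivity) fun v ↦ ?_
    by_cases hw : ‖w‖ ≤ 1
    · rw [hχd, hqd, Real.norm_eq_abs, abs_mul, abs_mul]
      have h1 := abs_inner_add_inner_le w v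
      have h2 := abs_inner_add_inner_le (J w) (J v)
      have h3 : ‖w‖ * ‖v‖ ≤ ‖v‖ := by nlinarith [norm_nonneg v]
      have h4 : ‖J w‖ * ‖J v‖ ≤ B ^ 2 * ‖v‖ := by
        calc ‖J w‖ * ‖J v‖ ≤ (B * ‖w‖) * (B * ‖v‖) := by
              gcongr <;> exact hJw _
          _ = B ^ 2 * (‖w‖ * ‖v‖) := by ring
          _ ≤ B ^ 2 * ‖v‖ := by gcongr
      have h5 := abs_add_le (2 * (⟪w.1, v.1⟫ + ⟪w.2, v.2⟫))
        (2 * (⟪(J w).1, (J v).1⟫ + ⟪(J w).2, (J v).2⟫))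
      rw [abs_mul, abs_mul 2] at h5
      simp only [abs_two] at h5
      rw [abs_neg, abs_two]
      calc _ ≤ K * (2 * ((4 + 4 * B ^ 2) * ‖v‖)) := by
            gcongr
            · exact hK _
            · linarith
        _ = _ := by ring
    · have : fderiv ℝ χ w = 0 := by
        have : χ =ᶠ[𝓝 w] 0 := notMem_tsupport_iff_eventuallyEq.1 fun h ↦
          hw (mem_closedBall_zero_iff.1 (hsupp h))
        simpa using this.fderiv_eq
      rw [this]
      simp only [zero_apply, norm_zero]
      positivity
  · rw [hχd, hqd, hJ2]
    simp only [Prod.fst_neg, Prod.snd_neg, inner_neg_right, real_inner_comm]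
    ring
  · have h1 : ∫ w in Metric.closedBall (0 : X × X) δ, (1 : ℝ) ∂μ =
        μ.real (Metric.closedBall 0 δ) := by
      simp
    rw [← h1]
    refine (setIntegral_congr_fun Metric.isClosed_closedBall.measurableSet fun w hw ↦ ?_).trans_le
      (setIntegral_le_integral (hχc.continuous.integrable_of_hasCompactSupport hχcs)
        (Eventually.of_forall fun w ↦ Real.smoothTransition.nonneg _))
    rw [mem_closedBall_zero_iff] at hw
    refine (Real.smoothTransition.one_of_one_le ?_).symm
    have h2 : ‖w‖ ^ 2 * (2 + 2 * B ^ 2) ≤ δ ^ 2 * (2 + 2 * B ^ 2) := by gcongr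
    linarith [hq2 w]

end Weight

/-! ### Weak limits -/

section WeakLimit

/-- Along an ultrafilter, a bounded family in a Hilbert space has a weak limit. -/
lemma exists_weak_limit {H : Type*} [NormedAddCommGroup H] [InnerProductSpace ℂ H]
    [CompleteSpace H] {ι : Type*} (l : Ultrafilter ι) (v : ι → H) {R : ℝ} (hv : ∀ i, ‖v i‖ ≤ R) :
    ∃ g : H, ∀ ψ : H, Tendsto (fun i ↦ inner ℂ (v i) ψ) l (𝓝 (inner ℂ g ψ)) := by
  let T : ι → WeakDual ℂ H := fun i ↦
    StrongDual.toWeakDual (𝕜 := ℂ) (E := H) (InnerProductSpace.toDual ℂ H (v i))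
  have hc := WeakDual.isCompact_closedBall (𝕜 := ℂ) (E := H) 0 R
  have hmem : ∀ i, T i ∈ WeakDual.toStrongDual (𝕜 := ℂ) (E := H) ⁻¹'
      Metric.closedBall (0 : StrongDual ℂ H) R := by
    intro i
    rw [mem_preimage, mem_closedBall_zero_iff]
    exact ((InnerProductSpace.toDual ℂ H).norm_map (v i)).trans_le (hv i)
  obtain ⟨S, -, hS⟩ := hc.ultrafilter_le_nhds (l.map T)
    (le_principal_iff.2 (Ultrafilter.mem_map.2 (univ_mem' hmem)))
  refine ⟨(InnerProductSpace.toDual ℂ H).symm (WeakDual.toStrongDual S), fun ψ ↦ ?_⟩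
  have h1 : Tendsto T l (𝓝 S) := hS
  have h2 := ((WeakDual.eval_continuous (𝕜 := ℂ) ψ).tendsto S).comp h1
  rw [InnerProductSpace.toDual_symm_apply]
  exact h2

/-- A uniformly bounded family of functions supported in a fixed ball converges weakly, along an
ultrafilter, to a square integrable function. -/
lemma exists_weak_limit_of_bounded {X : Type*} [NormedAddCommGroup X] [NormedSpace ℝ X]
    [FiniteDimensional ℝ X] [MeasurableSpace X] [BorelSpace X] (μ : Measure X)
    [IsFiniteMeasureOnCompacts μ] {ι : Type*} (l : Ultrafilter ι) (u : ι → X → ℂ) {M r : ℝ}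
    (hum : ∀ᶠ i in (l : Filter ι), AEStronglyMeasurable (u i) μ)
    (huM : ∀ᶠ i in (l : Filter ι), ∀ x, ‖u i x‖ ≤ M)
    (hur : ∀ᶠ i in (l : Filter ι), ∀ x ∉ Metric.closedBall (0 : X) r, u i x = 0) :
    ∃ f : X → ℂ, MemLp f 2 μ ∧ ∀ ψ : X → ℂ, MemLp ψ 2 μ →
      Tendsto (fun i ↦ ∫ x, u i x * ψ x ∂μ) l (𝓝 (∫ x, f x * ψ x ∂μ)) := by
  classical
  let k : X → ℝ := (Metric.closedBall (0 : X) r).indicator fun _ ↦ M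
  have hk : MemLp k 2 μ := memLp_indicator_const 2 Metric.isClosed_closedBall.measurableSet M
    (Or.inr (isCompact_closedBall (0 : X) r).measure_lt_top.ne)
  let good : ι → Prop := fun i ↦ AEStronglyMeasurable (u i) μ ∧ (∀ x, ‖u i x‖ ≤ M) ∧
    ∀ x ∉ Metric.closedBall (0 : X) r, u i x = 0
  have hgood : ∀ᶠ i in (l : Filter ι), good i := hum.and (huM.and hur)
  have hle : ∀ i, good i → ∀ x, ‖u i x‖ ≤ ‖k x‖ := by
    intro i hi x
    by_cases hx : x ∈ Metric.closedBall (0 : X) r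
    · simp only [k, indicator_of_mem hx]
      exact (hi.2.1 x).trans (le_abs_self M)
    · simp [hi.2.2 x hx]
  have hmem : ∀ i, good i → MemLp (fun x ↦ star (u i x)) 2 μ := fun i hi ↦
    hk.mono hi.1.star (Eventually.of_forall fun x ↦ by simpa using hle i hi x)
  -- Conjugation, because the inner product of `Lp` is antilinear in its first argument.
  let v : ι → Lp ℂ 2 μ := fun i ↦ if hi : good i then (hmem i hi).toLp _ else 0
  have hv : ∀ i, ‖v i‖ ≤ ‖hk.toLp k‖ := by
    intro i
    by_cases hi : good i
    · simp only [v, dif_pos hi]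
      refine Lp.norm_le_norm_of_ae_le ?_
      filter_upwards [(hmem i hi).coeFn_toLp, hk.coeFn_toLp] with x h1 h2
      rw [h1, h2]
      simpa using hle i hi x
    · simp only [v, dif_neg hi, norm_zero]
      exact norm_nonneg _
  obtain ⟨g, hg⟩ := exists_weak_limit l v hv
  refine ⟨fun x ↦ star (g x), (Lp.memLp g).star, fun ψ hψ ↦ ?_⟩
  have h := hg (hψ.toLp ψ)
  have e1 : inner ℂ g (hψ.toLp ψ) = ∫ x, star (g x) * ψ x ∂μ := by
    rw [L2.inner_def]
    refine integral_congr_ae ?_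
    filter_upwards [hψ.coeFn_toLp] with x hx
    rw [hx, RCLike.inner_apply, mul_comm]
    rfl
  rw [e1] at h
  refine h.congr' ?_
  filter_upwards [hgood] with i hi
  rw [L2.inner_def]
  refine integral_congr_ae ?_
  simp only [v, dif_pos hi]
  filter_upwards [hψ.coeFn_toLp, (hmem i hi).coeFn_toLp] with x hx hx'
  rw [hx, hx', RCLike.inner_apply, mul_comm]
  simp

end WeakLimit

/-! ### Transport of averages towards the edge -/

section Transport

variable {X : Type*} [NormedAddCommGroup X] [NormedSpace ℝ X] [FiniteDimensional ℝ X]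
  [MeasurableSpace X] [BorelSpace X]

lemma hasDerivAt_integral_of_contDiffOn (μ : Measure X) [IsFiniteMeasureOnCompacts μ]
    {H : ℝ × X → ℂ} {S : Set ℝ} (hS : IsOpen S) (hH : ContDiffOn ℝ 1 H (S ×ˢ univ)) {r : ℝ}
    (hH0 : ∀ s ∈ S, ∀ x ∉ Metric.closedBall (0 : X) r, H (s, x) = 0) {s₀ : ℝ} (hs₀ : s₀ ∈ S) :
    Integrable (fun x ↦ fderiv ℝ H (s₀, x) (1, 0)) μ ∧
    HasDerivAt (fun s ↦ ∫ x, H (s, x) ∂μ) (∫ x, fderiv ℝ H (s₀, x) (1, 0) ∂μ) s₀ := by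
  have hSo : IsOpen (S ×ˢ (univ : Set X)) := hS.prod isOpen_univ
  have hHd : ∀ s ∈ S, ∀ x, DifferentiableAt ℝ H (s, x) := fun s hs x ↦
    (hH.contDiffAt (hSo.mem_nhds ⟨hs, mem_univ _⟩)).differentiableAt one_ne_zero
  have hfc : ContinuousOn (fderiv ℝ H) (S ×ˢ univ) := hH.continuousOn_fderiv_of_isOpen hSo le_rfl
  have hd0 : ∀ s ∈ S, ∀ x ∉ Metric.closedBall (0 : X) r, fderiv ℝ H (s, x) = 0 := by
    intro s hs x hx
    have hn : S ×ˢ (Metric.closedBall (0 : X) r)ᶜ ∈ 𝓝 (s, x) :=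
      (hS.prod Metric.isClosed_closedBall.isOpen_compl).mem_nhds ⟨hs, hx⟩
    have : H =ᶠ[𝓝 (s, x)] fun _ ↦ 0 := by
      filter_upwards [hn] with p hp using hH0 p.1 hp.1 p.2 hp.2
    simpa using this.fderiv_eq
  obtain ⟨δ, hδ, hδS⟩ := Metric.nhds_basis_closedBall.mem_iff.1 (hS.mem_nhds hs₀)
  obtain ⟨B, hB⟩ := ((isCompact_closedBall s₀ δ).prod
    (isCompact_closedBall (0 : X) r)).exists_bound_of_continuousOn
    (hfc.mono (prod_mono hδS (subset_univ _)))
  have hint : ∀ s ∈ S, ∀ (K : ℝ × X → ℂ), ContinuousOn K (S ×ˢ univ) →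
      (∀ x ∉ Metric.closedBall (0 : X) r, K (s, x) = 0) → Integrable (fun x ↦ K (s, x)) μ := by
    intro s hs K hK hK0
    refine Continuous.integrable_of_hasCompactSupport ?_
      (HasCompactSupport.intro (isCompact_closedBall (0 : X) r) hK0)
    exact hK.comp_continuous (by fun_prop) fun x ↦ ⟨hs, mem_univ _⟩
  have hfc1 : ContinuousOn (fun p ↦ fderiv ℝ H p (1, 0)) (S ×ˢ univ) :=
    hfc.clm_apply continuousOn_const
  refine hasDerivAt_integral_of_dominated_loc_of_deriv_le (s := Metric.closedBall s₀ δ)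
    (bound := (Metric.closedBall (0 : X) r).indicator fun _ ↦ B)
    (F' := fun s x ↦ fderiv ℝ H (s, x) (1, 0)) (Metric.closedBall_mem_nhds s₀ hδ) ?_ ?_ ?_ ?_ ?_ ?_
  · filter_upwards [hS.mem_nhds hs₀] with s hs
    exact (hint s hs H hH.continuousOn (hH0 s hs)).aestronglyMeasurable
  · exact hint s₀ hs₀ H hH.continuousOn (hH0 s₀ hs₀)
  · exact (hint s₀ hs₀ (fun p ↦ fderiv ℝ H p (1, 0)) hfc1
      (fun x hx ↦ by simp [hd0 s₀ hs₀ x hx])).aestronglyMeasurable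
  · refine Eventually.of_forall fun x s hs ↦ ?_
    by_cases hx : x ∈ Metric.closedBall (0 : X) r
    · rw [indicator_of_mem hx]
      refine (ContinuousLinearMap.le_opNorm _ _).trans ?_
      have h1 : ‖((1 : ℝ), (0 : X))‖ = 1 := by simp [Prod.norm_def]
      rw [h1, mul_one]
      exact hB (s, x) ⟨hs, hx⟩
    · simp [hd0 s (hδS hs) x hx, indicator_of_notMem hx]
  · exact (integrable_indicator_iff Metric.isClosed_closedBall.measurableSet).2
      (integrableOn_const (isCompact_closedBall (0 : X) r).measure_lt_top.ne)
  · refine Eventually.of_forall fun x s hs ↦ ?_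
    have h1 : HasDerivAt (fun s : ℝ ↦ (s, x)) ((1 : ℝ), (0 : X)) s :=
      (hasDerivAt_id s).prodMk (hasDerivAt_const s x)
    exact (hHd s (hδS hs) x).hasFDerivAt.comp_hasDerivAt s h1

/-- A bounded `C¹` function `F` on the tube `X × O`, supported in `‖x‖ ≤ r₁`, whose derivatives in
the directions of `y ∈ O` are the complex combinations `P + iQ` of its derivatives in the directions
of `x ∈ X`, up to a bounded error. -/
structure IsTubeSolution (F : X × X → ℂ) (O : Set X) (P Q : X × X → X →L[ℝ] X)
    (r₁ r₂ M B C : ℝ) : Prop where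
  isOpen : IsOpen O
  convex : Convex ℝ O
  subset : O ⊆ Metric.ball 0 r₂
  lt : r₁ < r₂
  contDiffOn : ContDiffOn ℝ 1 F (univ ×ˢ O)
  eq_zero : ∀ y ∈ O, ∀ x ∉ Metric.closedBall (0 : X) r₁, F (x, y) = 0
  norm_le : ∀ x, ∀ y ∈ O, ‖F (x, y)‖ ≤ M
  contDiffOn_P : ContDiffOn ℝ 1 P (Metric.ball 0 r₂)
  contDiffOn_Q : ContDiffOn ℝ 1 Q (Metric.ball 0 r₂)
  P_le : ∀ z ∈ Metric.ball 0 r₂, ‖P z‖ ≤ B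
  Q_le : ∀ z ∈ Metric.ball 0 r₂, ‖Q z‖ ≤ B
  fderiv_P_le : ∀ z ∈ Metric.ball 0 r₂, ‖fderiv ℝ P z‖ ≤ B
  fderiv_Q_le : ∀ z ∈ Metric.ball 0 r₂, ‖fderiv ℝ Q z‖ ≤ B
  B_nonneg : 0 ≤ B
  C_nonneg : 0 ≤ C
  M_nonneg : 0 ≤ M
  norm_sub_le : ∀ x ∈ Metric.ball (0 : X) r₂, ∀ y ∈ O, ∀ v,
    ‖fderiv ℝ F (x, y) (0, v) - fderiv ℝ F (x, y) (P (x, y) v, 0) -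
      Complex.I * fderiv ℝ F (x, y) (Q (x, y) v, 0)‖ ≤ C * ‖v‖

lemma contDiffOn_apply_and_abs_trace_le {X : Type*} [NormedAddCommGroup X] [NormedSpace ℝ X]
    [FiniteDimensional ℝ X] {P : X × X → X →L[ℝ] X} {r B : ℝ}
    (hP : ContDiffOn ℝ 1 P (Metric.ball 0 r)) (hPd : ∀ z ∈ Metric.ball 0 r, ‖fderiv ℝ P z‖ ≤ B)
    (hB : 0 ≤ B) {y : X} (hy : y ∈ Metric.ball (0 : X) r) (v : X) :
    ContDiffOn ℝ 1 (fun x ↦ P (x, y) v) (Metric.ball 0 r) ∧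
    ∀ x ∈ Metric.ball (0 : X) r,
      |traceCLM X (fderiv ℝ (fun x ↦ P (x, y) v) x)| ≤ ‖traceCLM X‖ * (B * ‖v‖) := by
  have hmem : ∀ x ∈ Metric.ball (0 : X) r, (x, y) ∈ Metric.ball (0 : X × X) r := by
    intro x hx
    rw [mem_ball_zero_iff] at hx hy ⊢
    rw [Prod.norm_def]
    exact max_lt hx hy
  refine ⟨(hP.comp (f := fun x : X ↦ (x, y)) (by fun_prop) hmem).clm_apply contDiffOn_const,
    fun x hx ↦ ?_⟩
  have h1 : HasFDerivAt P (fderiv ℝ P (x, y)) (x, y) :=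
    ((hP.contDiffAt (Metric.isOpen_ball.mem_nhds (hmem x hx))).differentiableAt
      one_ne_zero).hasFDerivAt
  have h2 := (h1.comp x (hasFDerivAt_prodMk_left (𝕜 := ℝ) x y)).clm_apply (hasFDerivAt_const v x)
  have h3 : ∀ u, fderiv ℝ (fun x ↦ P (x, y) v) x u = fderiv ℝ P (x, y) (u, 0) v := by
    intro u
    have h4 := h2.fderiv
    simp only [Function.comp_apply] at h4
    rw [h4]
    simp
  have h5 : ‖fderiv ℝ (fun x ↦ P (x, y) v) x‖ ≤ B * ‖v‖ := by
    refine ContinuousLinearMap.opNorm_le_bound _ (by positivity) fun u ↦ ?_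
    rw [h3]
    have h6 : ‖fderiv ℝ P (x, y) (u, 0)‖ ≤ B * ‖u‖ := by
      have h7 := (fderiv ℝ P (x, y)).le_of_opNorm_le (hPd _ (hmem x hx)) (u, 0)
      have h8 : ‖((u : X), (0 : X))‖ = ‖u‖ := by simp [Prod.norm_def]
      rwa [h8] at h7
    calc ‖fderiv ℝ P (x, y) (u, 0) v‖ ≤ (B * ‖u‖) * ‖v‖ :=
          (fderiv ℝ P (x, y) (u, 0)).le_of_opNorm_le h6 v
      _ = B * ‖v‖ * ‖u‖ := by ring
  rw [← Real.norm_eq_abs]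
  exact (traceCLM X).le_opNorm_of_le h5

/-- Averages of `F` over `X × {y₁}` and `X × {y₀}` with weights `ψ (1, ·)` and `ψ (0, ·)`
differ little if `ψ` nearly solves the transport equation adjoint to the one for `F`. -/
theorem IsTubeSolution.norm_integral_sub_integral_le {F : X × X → ℂ} {O : Set X}
    {P Q : X × X → X →L[ℝ] X} {r₁ r₂ M B C : ℝ} (h : IsTubeSolution F O P Q r₁ r₂ M B C)
    (μ : Measure X) [μ.IsAddHaarMeasure] {y₀ y₁ : X} (hy₀ : y₀ ∈ O) (hy₁ : y₁ ∈ O)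
    {ψ : ℝ × X → ℂ} (hψ : ContDiff ℝ 1 ψ) {g k : X → ℝ} (hg : Integrable g μ) (hg0 : ∀ x, 0 ≤ g x)
    (hk : Integrable k μ) (hψk : ∀ s ∈ Icc (0 : ℝ) 1, ∀ x, ‖ψ (s, x)‖ ≤ k x)
    (hψg : ∀ s ∈ Icc (0 : ℝ) 1, ∀ x ∈ Metric.closedBall (0 : X) r₁,
      ‖fderiv ℝ ψ (s, x) (1, 0) -
        fderiv ℝ ψ (s, x) (0, P (x, y₀ + s • (y₁ - y₀)) (y₁ - y₀)) -
        Complex.I * fderiv ℝ ψ (s, x) (0, Q (x, y₀ + s • (y₁ - y₀)) (y₁ - y₀))‖ ≤ g x) :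
    ‖(∫ x, F (x, y₁) * ψ (1, x) ∂μ) - ∫ x, F (x, y₀) * ψ (0, x) ∂μ‖ ≤
      M * (∫ x, g x ∂μ) + (C + 2 * ‖traceCLM X‖ * B * M) * ‖y₁ - y₀‖ * ∫ x, k x ∂μ := by
  set v := y₁ - y₀ with hv
  have hB := h.B_nonneg
  have hC := h.C_nonneg
  have hM := h.M_nonneg
  have hk0 : ∀ x, 0 ≤ k x := fun x ↦ (norm_nonneg _).trans (hψk 0 (by simp) x)
  set S : Set ℝ := {s | y₀ + s • v ∈ O} with hSdef
  have hS : IsOpen S := h.isOpen.preimage (by fun_prop)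
  have hIS : Icc (0 : ℝ) 1 ⊆ S := by
    intro s hs
    have := h.convex hy₀ hy₁ (sub_nonneg.2 hs.2) hs.1 (by ring)
    change y₀ + s • v ∈ O
    rw [hv]
    convert this using 1
    module
  have hSo : IsOpen (S ×ˢ (univ : Set X)) := hS.prod isOpen_univ
  have hOo : IsOpen ((univ : Set X) ×ˢ O) := isOpen_univ.prod h.isOpen
  set H : ℝ × X → ℂ := fun p ↦ F (p.2, y₀ + p.1 • v) * ψ p with hHdef
  have hH : ContDiffOn ℝ 1 H (S ×ˢ univ) :=
    (h.contDiffOn.comp (f := fun p : ℝ × X ↦ (p.2, y₀ + p.1 • v)) (by fun_prop)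
      fun p hp ↦ ⟨mem_univ _, hp.1⟩).mul hψ.contDiffOn
  have hH0 : ∀ s ∈ S, ∀ x ∉ Metric.closedBall (0 : X) r₁, H (s, x) = 0 := by
    intro s hs x hx
    simp [hHdef, h.eq_zero _ hs x hx]
  have hD := fun s (hs : s ∈ S) ↦ hasDerivAt_integral_of_contDiffOn μ hS hH hH0 hs
  have hFd : ∀ x, ∀ y ∈ O, HasFDerivAt F (fderiv ℝ F (x, y)) (x, y) := fun x y hy ↦
    ((h.contDiffOn.contDiffAt (hOo.mem_nhds ⟨mem_univ _, hy⟩)).differentiableAt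
      one_ne_zero).hasFDerivAt
  have hψd : ∀ p, HasFDerivAt ψ (fderiv ℝ ψ p) p := fun p ↦
    (hψ.differentiable one_ne_zero p).hasFDerivAt
  have hbound : ∀ s ∈ Icc (0 : ℝ) 1, ‖∫ x, fderiv ℝ H (s, x) (1, 0) ∂μ‖ ≤
      M * (∫ x, g x ∂μ) + (C + 2 * ‖traceCLM X‖ * B * M) * ‖v‖ * ∫ x, k x ∂μ := by
    intro s hs
    have hsS := hIS hs
    set y := y₀ + s • v with hy
    have hyO : y ∈ O := hsS
    have hyr := h.subset hyO
    set G : X → ℂ := fun x ↦ H (s, x) with hGdef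
    have hG : ContDiff ℝ 1 G := by
      rw [← contDiffOn_univ]
      exact hH.comp (f := fun x : X ↦ (s, x)) (by fun_prop) fun x _ ↦ ⟨hsS, mem_univ _⟩
    have hGs : tsupport G ⊆ Metric.closedBall 0 r₁ :=
      closure_minimal (fun x hx ↦ by_contra fun h' ↦ hx (hH0 s hsS x h'))
        Metric.isClosed_closedBall
    have hGc : HasCompactSupport G :=
      (isCompact_closedBall (0 : X) r₁).of_isClosed_subset (isClosed_tsupport G) hGs
    have hGU : tsupport G ⊆ Metric.ball 0 r₂ :=
      hGs.trans (Metric.closedBall_subset_ball h.lt)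
    obtain ⟨hPc, hPt⟩ := contDiffOn_apply_and_abs_trace_le h.contDiffOn_P h.fderiv_P_le hB hyr v
    obtain ⟨hQc, hQt⟩ := contDiffOn_apply_and_abs_trace_le h.contDiffOn_Q h.fderiv_Q_le hB hyr v
    obtain ⟨hp1, hp2, hp3⟩ :=
      integral_fderiv_apply_add_trace_mul μ hG hGc Metric.isOpen_ball hGU hPc
    obtain ⟨hq1, hq2, hq3⟩ :=
      integral_fderiv_apply_add_trace_mul μ hG hGc Metric.isOpen_ball hGU hQc
    have hHd : ∀ x σ, fderiv ℝ H (s, x) (σ, 0) =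
        fderiv ℝ F (x, y) (0, σ • v) * ψ (s, x) + F (x, y) * fderiv ℝ ψ (s, x) (σ, 0) := by
      intro x σ
      have h1 : HasFDerivAt (fun p : ℝ × X ↦ (p.2, y₀ + p.1 • v)) _ (s, x) :=
        (hasFDerivAt_snd (𝕜 := ℝ) (p := (s, x))).prodMk
          (((hasFDerivAt_fst (𝕜 := ℝ) (p := (s, x))).smul_const v).const_add y₀)
      have h2 := ((hFd x y hyO).comp (s, x) h1).mul (hψd (s, x))
      have h3 := h2.fderiv
      change fderiv ℝ H (s, x) = _ at h3
      rw [h3]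
      simp
      ring
    have hGd : ∀ x u, fderiv ℝ G x u =
        fderiv ℝ F (x, y) (u, 0) * ψ (s, x) + F (x, y) * fderiv ℝ ψ (s, x) (0, u) := by
      intro x u
      have h2 := ((hFd x y hyO).comp x (hasFDerivAt_prodMk_left (𝕜 := ℝ) x y)).mul
        ((hψd (s, x)).comp x (hasFDerivAt_prodMk_right (𝕜 := ℝ) s x))
      have h3 := h2.fderiv
      change fderiv ℝ G x = _ at h3
      rw [h3]
      simp
      ring
    have hoff : ∀ x ∉ Metric.closedBall (0 : X) r₁,
        G x = 0 ∧ fderiv ℝ G x = 0 ∧ fderiv ℝ H (s, x) = 0 := by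
      intro x hx
      refine ⟨hH0 s hsS x hx, ?_, ?_⟩
      · have : G =ᶠ[𝓝 x] 0 := notMem_tsupport_iff_eventuallyEq.1 fun h' ↦ hx (hGs h')
        simpa using this.fderiv_eq
      · have hn : S ×ˢ (Metric.closedBall (0 : X) r₁)ᶜ ∈ 𝓝 (s, x) :=
          (hS.prod Metric.isClosed_closedBall.isOpen_compl).mem_nhds ⟨hsS, hx⟩
        have : H =ᶠ[𝓝 (s, x)] fun _ ↦ 0 := by
          filter_upwards [hn] with p hp using hH0 p.1 hp.1 p.2 hp.2
        simpa using this.fderiv_eq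
    -- subtract the divergence of the complex vector field `G • (P + iQ) v`
    have e : ∫ x, fderiv ℝ H (s, x) (1, 0) ∂μ = ∫ x, (fderiv ℝ H (s, x) (1, 0) -
        ((fderiv ℝ G x (P (x, y) v) + (traceCLM X (fderiv ℝ (fun x ↦ P (x, y) v) x) : ℂ) * G x) +
        Complex.I * (fderiv ℝ G x (Q (x, y) v) +
          (traceCLM X (fderiv ℝ (fun x ↦ Q (x, y) v) x) : ℂ) * G x))) ∂μ := by
      have ip : Integrable (fun x ↦ fderiv ℝ G x (P (x, y) v) +
          (traceCLM X (fderiv ℝ (fun x ↦ P (x, y) v) x) : ℂ) * G x) μ := hp1.add hp2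
      have iq : Integrable (fun x ↦ Complex.I * (fderiv ℝ G x (Q (x, y) v) +
          (traceCLM X (fderiv ℝ (fun x ↦ Q (x, y) v) x) : ℂ) * G x)) μ :=
        (hq1.add hq2).const_mul _
      refine ((integral_sub (hD s hsS).1 (ip.add iq)).trans ?_).symm
      rw [integral_add' ip iq, integral_const_mul,
        integral_add hp1 hp2, integral_add hq1 hq2, hp3, hq3]
      ring
    rw [e]
    have hb : Integrable (fun x ↦ M * g x + (C + 2 * ‖traceCLM X‖ * B * M) * ‖v‖ * k x) μ :=
      (hg.const_mul _).add (hk.const_mul _)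
    have hbi : ∫ x, (M * g x + (C + 2 * ‖traceCLM X‖ * B * M) * ‖v‖ * k x) ∂μ =
        M * (∫ x, g x ∂μ) + (C + 2 * ‖traceCLM X‖ * B * M) * ‖v‖ * ∫ x, k x ∂μ := by
      rw [integral_add (hg.const_mul _) (hk.const_mul _), integral_const_mul, integral_const_mul]
    rw [← hbi]
    refine norm_integral_le_of_norm_le hb (Eventually.of_forall fun x ↦ ?_)
    by_cases hx : x ∈ Metric.closedBall (0 : X) r₁
    · have hxr : x ∈ Metric.ball (0 : X) r₂ := Metric.closedBall_subset_ball h.lt hx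
      have hGx : ‖G x‖ ≤ M * k x := by
        simp only [hGdef, hHdef, norm_mul]
        exact mul_le_mul (h.norm_le x y hyO) (hψk s hs x) (norm_nonneg _) hM
      have e2 : fderiv ℝ H (s, x) (1, 0) -
        ((fderiv ℝ G x (P (x, y) v) + (traceCLM X (fderiv ℝ (fun x ↦ P (x, y) v) x) : ℂ) * G x) +
        Complex.I * (fderiv ℝ G x (Q (x, y) v) +
          (traceCLM X (fderiv ℝ (fun x ↦ Q (x, y) v) x) : ℂ) * G x)) =
        F (x, y) * (fderiv ℝ ψ (s, x) (1, 0) - fderiv ℝ ψ (s, x) (0, P (x, y) v) -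
          Complex.I * fderiv ℝ ψ (s, x) (0, Q (x, y) v)) +
        (fderiv ℝ F (x, y) (0, v) - fderiv ℝ F (x, y) (P (x, y) v, 0) -
          Complex.I * fderiv ℝ F (x, y) (Q (x, y) v, 0)) * ψ (s, x) -
        (traceCLM X (fderiv ℝ (fun x ↦ P (x, y) v) x) : ℂ) * G x -
        Complex.I * ((traceCLM X (fderiv ℝ (fun x ↦ Q (x, y) v) x) : ℂ) * G x) := by
        rw [hHd, hGd, hGd, one_smul]
        ring
      rw [e2]
      have n1 : ‖F (x, y) * (fderiv ℝ ψ (s, x) (1, 0) - fderiv ℝ ψ (s, x) (0, P (x, y) v) -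
          Complex.I * fderiv ℝ ψ (s, x) (0, Q (x, y) v))‖ ≤ M * g x := by
        rw [norm_mul]
        exact mul_le_mul (h.norm_le x y hyO) (hψg s hs x hx) (norm_nonneg _) hM
      have n2 : ‖(fderiv ℝ F (x, y) (0, v) - fderiv ℝ F (x, y) (P (x, y) v, 0) -
          Complex.I * fderiv ℝ F (x, y) (Q (x, y) v, 0)) * ψ (s, x)‖ ≤ C * ‖v‖ * k x := by
        rw [norm_mul]
        exact mul_le_mul (h.norm_sub_le x hxr y hyO v) (hψk s hs x) (norm_nonneg _)
          (by positivity)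
      have n3 : ‖(traceCLM X (fderiv ℝ (fun x ↦ P (x, y) v) x) : ℂ) * G x‖ ≤
          ‖traceCLM X‖ * (B * ‖v‖) * (M * k x) := by
        rw [norm_mul, Complex.norm_real, Real.norm_eq_abs]
        exact mul_le_mul (hPt x hxr) hGx (norm_nonneg _) (by positivity)
      have n4 : ‖Complex.I * ((traceCLM X (fderiv ℝ (fun x ↦ Q (x, y) v) x) : ℂ) * G x)‖ ≤
          ‖traceCLM X‖ * (B * ‖v‖) * (M * k x) := by
        rw [norm_mul, Complex.norm_I, one_mul, norm_mul, Complex.norm_real, Real.norm_eq_abs]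
        exact mul_le_mul (hQt x hxr) hGx (norm_nonneg _) (by positivity)
      refine (_root_.norm_sub_le _ _).trans ((add_le_add ((_root_.norm_sub_le _ _).trans
        (add_le_add ((norm_add_le _ _).trans (add_le_add n1 n2)) n3)) n4).trans (le_of_eq ?_))
      ring
    · obtain ⟨z1, z2, z3⟩ := hoff x hx
      rw [z1, z2, z3]
      simp only [zero_apply, mul_zero, add_zero, sub_zero, norm_zero]
      have := hg0 x
      have := hk0 x
      positivity
  -- integrate over the segment from `y₀` to `y₁`
  have hfin := (convex_Icc (0 : ℝ) 1).norm_image_sub_le_of_norm_hasDerivWithin_le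
    (f := fun s : ℝ ↦ ∫ x, H (s, x) ∂μ)
    (fun s hs ↦ (hD s (hIS hs)).2.hasDerivWithinAt) hbound
    (left_mem_Icc.2 zero_le_one) (right_mem_Icc.2 zero_le_one)
  have e1 : ∀ x, H (1, x) = F (x, y₁) * ψ (1, x) := fun x ↦ by simp [hHdef, hv]
  have e0 : ∀ x, H (0, x) = F (x, y₀) * ψ (0, x) := fun x ↦ by simp [hHdef]
  simpa [e1, e0] using hfin

end Transport

/-! ### Gaussians with complex centre -/

section Gaussian

open scoped RealInnerProductSpace

variable {X : Type*} [NormedAddCommGroup X] [InnerProductSpace ℝ X]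

/-- The entire extension `exp (-(a + ib)²)` of the Gaussian, at the point `a + ib` of the
complexification of `X`. -/
def complexGaussian (a b : X) : ℂ :=
  Complex.exp (-((‖a‖ ^ 2 - ‖b‖ ^ 2 : ℝ) : ℂ) - ((2 * ⟪a, b⟫ : ℝ) : ℂ) * Complex.I)

lemma norm_complexGaussian (a b : X) :
    ‖complexGaussian a b‖ = Real.exp (‖b‖ ^ 2 - ‖a‖ ^ 2) := by
  rw [complexGaussian, Complex.norm_exp]
  congr 1
  simp [-Complex.ofReal_mul, -Complex.ofReal_sub]

lemma norm_complexGaussian_add_le {ξ p b : X} {A : ℝ} (hp : ‖p‖ ≤ A) (hb : ‖b‖ ≤ A) :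
    ‖complexGaussian (ξ + p) b‖ ≤ Real.exp (2 * A ^ 2) * Real.exp (-(1 / 2) * ‖ξ‖ ^ 2) := by
  rw [norm_complexGaussian, ← Real.exp_add, Real.exp_le_exp]
  have h1 : ‖ξ‖ ≤ ‖ξ + p‖ + ‖p‖ := by
    simpa using norm_sub_le (ξ + p) p
  have h2 : ‖ξ‖ ^ 2 ≤ 2 * ‖ξ + p‖ ^ 2 + 2 * ‖p‖ ^ 2 := by
    have : ‖ξ‖ ^ 2 ≤ (‖ξ + p‖ + ‖p‖) ^ 2 := by gcongr
    nlinarith [sq_nonneg (‖ξ + p‖ - ‖p‖)]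
  have h3 : ‖p‖ ^ 2 ≤ A ^ 2 := by gcongr
  have h4 : ‖b‖ ^ 2 ≤ A ^ 2 := by gcongr
  linarith

/-- The complex Gaussian whose centre moves along a complex line, from `x₁ + h(p + iq)` at time `0`
to `x₁` at time `1`. -/
def movingGaussian (x₁ p q : X) (h : ℝ) (z : ℝ × X) : ℂ :=
  complexGaussian (h⁻¹ • (z.2 - x₁) + (z.1 - 1) • p) ((z.1 - 1) • q)

lemma contDiff_movingGaussian (x₁ p q : X) (h : ℝ) : ContDiff ℝ 1 (movingGaussian x₁ p q h) := by
  have ha : ContDiff ℝ 1 fun z : ℝ × X ↦ h⁻¹ • (z.2 - x₁) + (z.1 - 1) • p := by fun_prop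
  have hb : ContDiff ℝ 1 fun z : ℝ × X ↦ (z.1 - 1) • q := by fun_prop
  refine Complex.contDiff_exp.comp (ContDiff.sub ?_ (ContDiff.mul ?_ contDiff_const))
  · exact (Complex.ofRealCLM.contDiff.comp ((ha.norm_sq ℝ).sub (hb.norm_sq ℝ))).neg
  · exact Complex.ofRealCLM.contDiff.comp (contDiff_const.mul (ha.inner ℝ hb))

lemma fderiv_movingGaussian (x₁ p q : X) (h s : ℝ) (x : X) (σ : ℝ) (u : X) :
    fderiv ℝ (movingGaussian x₁ p q h) (s, x) (σ, u) = movingGaussian x₁ p q h (s, x) *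
      (-((2 * ⟪h⁻¹ • (x - x₁) + (s - 1) • p, h⁻¹ • u + σ • p⟫ -
        2 * ⟪(s - 1) • q, σ • q⟫ : ℝ) : ℂ) -
        ((2 * (⟪h⁻¹ • (x - x₁) + (s - 1) • p, σ • q⟫ +
          ⟪h⁻¹ • u + σ • p, (s - 1) • q⟫) : ℝ) : ℂ) * Complex.I) := by
  have ha : HasFDerivAt (fun z : ℝ × X ↦ h⁻¹ • (z.2 - x₁) + (z.1 - 1) • p) _ (s, x) :=
    (((hasFDerivAt_snd (𝕜 := ℝ) (p := (s, x))).sub_const x₁).const_smul h⁻¹).add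
      (((hasFDerivAt_fst (𝕜 := ℝ) (p := (s, x))).sub_const 1).smul_const p)
  have hb : HasFDerivAt (fun z : ℝ × X ↦ (z.1 - 1) • q) _ (s, x) :=
    ((hasFDerivAt_fst (𝕜 := ℝ) (p := (s, x))).sub_const 1).smul_const q
  have h1 := Complex.ofRealCLM.hasFDerivAt.comp (s, x) (ha.norm_sq.sub hb.norm_sq)
  have h2 := Complex.ofRealCLM.hasFDerivAt.comp (s, x) ((ha.inner ℝ hb).const_mul 2)
  have h3 := ((h1.neg.sub (h2.mul_const Complex.I)).cexp).fderiv
  change fderiv ℝ (movingGaussian x₁ p q h) (s, x) = _ at h3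
  rw [h3]
  simp only [FunLike.coe_smul, FunLike.coe_sub, Pi.smul_apply, Pi.sub_apply, smul_eq_mul]
  congr 1
  simp [inner_add_left, inner_add_right, inner_sub_left, inner_smul_left, inner_smul_right]
  ring

/-- The moving Gaussian solves the transport equation with the constant complex velocity
`h (p + iq)`, hence nearly solves it with a velocity `P + iQ` close to this one. -/
lemma norm_fderiv_movingGaussian_sub_le (x₁ p q : X) {h : ℝ} (hh : 0 < h) (s : ℝ) (x P Q : X) :
    ‖fderiv ℝ (movingGaussian x₁ p q h) (s, x) (1, 0) -
      fderiv ℝ (movingGaussian x₁ p q h) (s, x) (0, P) -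
      Complex.I * fderiv ℝ (movingGaussian x₁ p q h) (s, x) (0, Q)‖ ≤
    ‖movingGaussian x₁ p q h (s, x)‖ * (2 * h⁻¹ *
      (‖h⁻¹ • (x - x₁) + (s - 1) • p‖ + ‖(s - 1) • q‖) * (‖h • p - P‖ + ‖h • q - Q‖)) := by
  set a := h⁻¹ • (x - x₁) + (s - 1) • p with ha
  set b := (s - 1) • q with hb
  set ψ := movingGaussian x₁ p q h (s, x) with hψ
  have key : ∀ u, ‖fderiv ℝ (movingGaussian x₁ p q h) (s, x) (0, u)‖ ≤
      ‖ψ‖ * (2 * h⁻¹ * (‖a‖ + ‖b‖) * ‖u‖) := by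
    intro u
    rw [fderiv_movingGaussian, norm_mul]
    gcongr
    simp only [zero_smul, add_zero, inner_zero_right, mul_zero, sub_zero, zero_add]
    refine (norm_sub_le _ _).trans ?_
    rw [norm_neg, norm_mul, Complex.norm_I, mul_one, Complex.norm_real, Complex.norm_real,
      Real.norm_eq_abs, Real.norm_eq_abs, abs_mul, abs_mul, abs_two]
    have h1 := abs_real_inner_le_norm a (h⁻¹ • u)
    have h2 := abs_real_inner_le_norm (h⁻¹ • u) b
    have h3 : ‖h⁻¹ • u‖ = h⁻¹ * ‖u‖ := by
      rw [norm_smul, Real.norm_of_nonneg (inv_pos.2 hh).le]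
    rw [h3] at h1 h2
    calc _ ≤ 2 * (‖a‖ * (h⁻¹ * ‖u‖)) + 2 * (h⁻¹ * ‖u‖ * ‖b‖) := by gcongr
      _ = _ := by ring
  have e : fderiv ℝ (movingGaussian x₁ p q h) (s, x) (1, 0) =
      fderiv ℝ (movingGaussian x₁ p q h) (s, x) (0, h • p) +
      Complex.I * fderiv ℝ (movingGaussian x₁ p q h) (s, x) (0, h • q) := by
    simp only [fderiv_movingGaussian, ← ha, ← hb, ← hψ]
    simp only [smul_zero, zero_add, one_smul, zero_smul, add_zero, inv_smul_smul₀ hh.ne',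
      inner_zero_right, mul_zero, sub_zero]
    rw [real_inner_comm q b]
    push_cast
    linear_combination (2 * ψ * (⟪q, b⟫ : ℂ)) * Complex.I_sq
  have e2 : fderiv ℝ (movingGaussian x₁ p q h) (s, x) (1, 0) -
      fderiv ℝ (movingGaussian x₁ p q h) (s, x) (0, P) -
      Complex.I * fderiv ℝ (movingGaussian x₁ p q h) (s, x) (0, Q) =
      fderiv ℝ (movingGaussian x₁ p q h) (s, x) (0, h • p - P) +
      Complex.I * fderiv ℝ (movingGaussian x₁ p q h) (s, x) (0, h • q - Q) := by
    have h1 : ∀ u w : X, ((0 : ℝ), u - w) = (0, u) - (0, w) := fun u w ↦ by simp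
    rw [e, h1, h1, map_sub, map_sub]
    ring
  rw [e2]
  refine (norm_add_le _ _).trans ?_
  rw [norm_mul, Complex.norm_I, one_mul]
  calc _ ≤ _ := add_le_add (key _) (key _)
    _ = _ := by ring

variable [FiniteDimensional ℝ X] [MeasurableSpace X] [BorelSpace X]

lemma integrable_exp_neg_mul_norm_sq {b : ℝ} (hb : 0 < b) :
    Integrable fun ξ : X ↦ Real.exp (-b * ‖ξ‖ ^ 2) := by
  have := (GaussianFourier.integrable_cexp_neg_mul_sq_norm_add (V := X) (b := (b : ℂ))
    (by simpa using hb) 0 0).norm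
  refine this.congr (Eventually.of_forall fun ξ ↦ ?_)
  simp only [Complex.norm_exp]
  congr 1
  norm_cast
  simp

lemma integral_complexGaussian_add (p q : X) :
    ∫ ξ, complexGaussian (ξ + p) q = (Real.pi : ℂ) ^ (Module.finrank ℝ X / 2 : ℂ) := by
  rw [integral_add_right_eq_self (fun ξ ↦ complexGaussian ξ q) p]
  have h := GaussianFourier.integral_cexp_neg_mul_sq_norm_add (V := X) (b := 1) (by simp)
    (-2 * Complex.I) q
  have e : ∀ ξ : X, complexGaussian ξ q = Complex.exp ((‖q‖ ^ 2 : ℝ)) *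
      Complex.exp (-1 * ‖ξ‖ ^ 2 + -2 * Complex.I * ⟪q, ξ⟫) := by
    intro ξ
    rw [complexGaussian, ← Complex.exp_add, real_inner_comm]
    congr 1
    push_cast
    ring
  simp_rw [e]
  rw [integral_const_mul, h, mul_left_comm, ← Complex.exp_add]
  have e0 : ((‖q‖ ^ 2 : ℝ) : ℂ) + (-2 * Complex.I) ^ 2 * ‖q‖ ^ 2 / (4 * 1) = 0 := by
    push_cast
    linear_combination (‖q‖ : ℂ) ^ 2 * Complex.I_sq
  rw [e0, Complex.exp_zero, mul_one, div_one]

lemma integral_comp_add_smul {E : Type*} [NormedAddCommGroup E] [NormedSpace ℝ E] (f : X → E)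
    (x₁ : X) {h : ℝ} (hh : 0 < h) :
    ∫ ξ, f (x₁ + h • ξ) = (h ^ Module.finrank ℝ X)⁻¹ • ∫ x, f x := by
  rw [Measure.integral_comp_smul volume (fun x ↦ f (x₁ + x)) h,
    integral_add_left_eq_self f x₁, abs_of_pos (by positivity)]

lemma one_add_norm_sq_mul_exp_le (u : ℝ) :
    (1 + u) ^ 2 * Real.exp (-(1 / 2) * u ^ 2) ≤ 8 * Real.exp (-(1 / 4) * u ^ 2) := by
  have h1 : (1 + u) ^ 2 ≤ 8 * Real.exp (1 / 4 * u ^ 2) := by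
    have := Real.add_one_le_exp (1 / 4 * u ^ 2)
    nlinarith [sq_nonneg (1 - u)]
  calc _ ≤ 8 * Real.exp (1 / 4 * u ^ 2) * Real.exp (-(1 / 2) * u ^ 2) := by gcongr
    _ = _ := by
      rw [mul_assoc, ← Real.exp_add]
      congr 2
      ring

end Gaussian

/-! ### Convergence of Gaussian averages at Lebesgue points -/

section Averages

variable {X : Type*} [NormedAddCommGroup X] [InnerProductSpace ℝ X]

/-- The error made by freezing the coefficients `T` of the transport at `(x₀, 0)`. -/
lemma norm_frozen_coefficient_sub_le {T : X × X → X →L[ℝ] X} {O : Set X} {r₁ r₂ B A κ t : ℝ}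
    (hO : Convex ℝ O) (hOr : O ⊆ Metric.ball 0 r₂) (hr : r₁ < r₂)
    (hT : ContDiffOn ℝ 1 T (Metric.ball 0 r₂)) (hTB : ∀ z ∈ Metric.ball 0 r₂, ‖T z‖ ≤ B)
    (hTd : ∀ z ∈ Metric.ball 0 r₂, ‖fderiv ℝ T z‖ ≤ B) (hB : 0 ≤ B) (hA : 0 ≤ A) (hκ : 0 < κ)
    (ht : 0 < t) (ht1 : t ≤ 1) {x₀ x₁ x y₀ y₁ : X} (hz₀ : (x₀, (0 : X)) ∈ Metric.ball 0 r₂)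
    (hx₁ : ‖x₁ - x₀‖ ≤ A * t) (hy₀ : y₀ ∈ O) (hy₁ : y₁ ∈ O) (hy₁t : ‖y₁‖ ≤ A * t)
    (hy₀t : ‖y₀‖ ≤ t ^ 2) {s : ℝ} (hs : s ∈ Icc (0 : ℝ) 1) (hx : x ∈ Metric.closedBall 0 r₁) :
    ‖(κ * t) • ((κ * t)⁻¹ • T (x₀, 0) y₁) - T (x, y₀ + s • (y₁ - y₀)) (y₁ - y₀)‖ ≤
      B * t ^ 2 * ((κ + 2 * A + 1) * A + 1) * (1 + ‖(κ * t)⁻¹ • (x - x₁)‖) := by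
  set η := κ * t with hη
  have hη0 : 0 < η := by positivity
  have hyO : y₀ + s • (y₁ - y₀) ∈ O := by
    have := hO hy₀ hy₁ (sub_nonneg.2 hs.2) hs.1 (by ring)
    convert this using 1
    module
  set y := y₀ + s • (y₁ - y₀) with hy
  have hyn : ‖y‖ ≤ A * t + t := by
    have e : y = (1 - s) • y₀ + s • y₁ := by rw [hy]; module
    rw [e]
    refine (norm_add_le _ _).trans ?_
    rw [norm_smul, norm_smul, Real.norm_of_nonneg hs.1, Real.norm_of_nonneg (sub_nonneg.2 hs.2)]
    have h1 : (1 - s) * ‖y₀‖ ≤ 1 * t := by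
      gcongr
      · linarith [hs.1]
      · exact hy₀t.trans (by nlinarith)
    have h2 : s * ‖y₁‖ ≤ 1 * (A * t) := by
      gcongr
      exact hs.2
    linarith
  have hz : (x, y) ∈ Metric.ball (0 : X × X) r₂ := by
    have h1 := Metric.closedBall_subset_ball hr hx
    have h2 := hOr hyO
    rw [mem_ball_zero_iff] at h1 h2 ⊢
    rw [Prod.norm_def]
    exact max_lt h1 h2
  set u := ‖η⁻¹ • (x - x₁)‖ with hu
  have hu0 : 0 ≤ u := norm_nonneg _
  have hxx : ‖x - x₁‖ = η * u := by
    rw [hu, norm_smul, Real.norm_of_nonneg (inv_pos.2 hη0).le, mul_inv_cancel_left₀ hη0.ne']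
  have hdist : ‖(x₀, (0 : X)) - (x, y)‖ ≤ η * u + (2 * A + 1) * t := by
    rw [Prod.mk_sub_mk, Prod.norm_def]
    refine max_le ?_ ?_
    · have h1 : ‖x₀ - x‖ ≤ ‖x - x₁‖ + ‖x₁ - x₀‖ := by
        rw [norm_sub_rev x₀ x]
        exact norm_sub_le_norm_sub_add_norm_sub x x₁ x₀
      change ‖x₀ - x‖ ≤ _
      nlinarith
    · change ‖0 - y‖ ≤ _
      rw [zero_sub, norm_neg]
      nlinarith [mul_nonneg hη0.le hu0, mul_nonneg hA ht.le]
  have hLip : ‖T (x₀, 0) - T (x, y)‖ ≤ B * (η * u + (2 * A + 1) * t) := by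
    have := (convex_ball (0 : X × X) r₂).norm_image_sub_le_of_norm_fderiv_le (𝕜 := ℝ) (f := T)
      (fun z hz ↦ (hT.contDiffAt (Metric.isOpen_ball.mem_nhds hz)).differentiableAt one_ne_zero)
      hTd hz hz₀
    exact this.trans (by gcongr)
  have e : η • (η⁻¹ • T (x₀, 0) y₁) - T (x, y) (y₁ - y₀) =
      (T (x₀, 0) - T (x, y)) y₁ + T (x, y) y₀ := by
    rw [smul_inv_smul₀ hη0.ne', map_sub, sub_apply]
    abel
  rw [e]
  have h1 : ‖(T (x₀, 0) - T (x, y)) y₁‖ ≤ B * (η * u + (2 * A + 1) * t) * (A * t) :=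
    ((T (x₀, 0) - T (x, y)).le_of_opNorm_le hLip y₁).trans (by gcongr)
  have h2 : ‖T (x, y) y₀‖ ≤ B * t ^ 2 :=
    ((T (x, y)).le_of_opNorm_le (hTB _ hz) y₀).trans (by gcongr)
  calc _ ≤ B * (η * u + (2 * A + 1) * t) * (A * t) + B * t ^ 2 :=
        (norm_add_le _ _).trans (add_le_add h1 h2)
    _ = B * t ^ 2 * (κ * A * u + ((2 * A + 1) * A + 1)) := by rw [hη]; ring
    _ ≤ B * t ^ 2 * (((κ + 2 * A + 1) * A + 1) * (1 + u)) := by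
        gcongr
        have h5 : 0 ≤ κ * A := by positivity
        have h6 : 0 ≤ ((2 * A + 1) * A + 1) * u := by positivity
        nlinarith
    _ = _ := by ring

variable [FiniteDimensional ℝ X] [MeasurableSpace X] [BorelSpace X]

set_option maxHeartbeats 1000000 in
/-- Transport of Gaussian averages of width `κ t`, from `y₁` at distance `O(t)` from the edge to
`y₀` much closer to the edge, with the transport coefficients frozen at the point `(x₀, 0)`. -/
theorem IsTubeSolution.exists_norm_integral_gaussian_sub_le {F : X × X → ℂ} {O : Set X}
    {P Q : X × X → X →L[ℝ] X} {r₁ r₂ M B C : ℝ} (h : IsTubeSolution F O P Q r₁ r₂ M B C)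
    {A κ : ℝ} (hA : 0 ≤ A) (hκ : 0 < κ) :
    ∃ c : ℝ, 0 ≤ c ∧ ∀ t : ℝ, 0 < t → t ≤ 1 → ∀ x₀ ∈ Metric.ball (0 : X) r₂, ∀ x₁ : X,
      ‖x₁ - x₀‖ ≤ A * t → ∀ y₀ ∈ O, ∀ y₁ ∈ O, ‖y₁‖ ≤ A * t → ‖y₀‖ ≤ t ^ 2 →
      ‖(∫ ξ, F (x₁ + (κ * t) • ξ, y₁) * complexGaussian ξ 0) -
        ∫ ξ, F (x₁ + (κ * t) • ξ, y₀) *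
          complexGaussian (ξ + -((κ * t)⁻¹ • P (x₀, 0) y₁)) (-((κ * t)⁻¹ • Q (x₀, 0) y₁))‖ ≤
        c * t := by
  have hB := h.B_nonneg
  have hC := h.C_nonneg
  have hM := h.M_nonneg
  set A₂ : ℝ := κ⁻¹ * (B * A) with hA₂
  have hA₂0 : 0 ≤ A₂ := by positivity
  set c₂ : ℝ := (κ + 2 * A + 1) * A + 1 with hc₂
  have hc₂0 : 0 ≤ c₂ := by positivity
  set c₃ : ℝ := Real.exp (2 * A₂ ^ 2) * (32 * κ⁻¹ * B * c₂ * (1 + 2 * A₂)) with hc₃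
  set I₄ : ℝ := ∫ ξ : X, Real.exp (-(1 / 4) * ‖ξ‖ ^ 2) with hI₄
  set I₂ : ℝ := ∫ ξ : X, Real.exp (-(1 / 2) * ‖ξ‖ ^ 2) with hI₂
  have hI₄0 : 0 ≤ I₄ := integral_nonneg fun ξ ↦ (Real.exp_pos _).le
  have hI₂0 : 0 ≤ I₂ := integral_nonneg fun ξ ↦ (Real.exp_pos _).le
  refine ⟨M * c₃ * I₄ + (C + 2 * ‖traceCLM X‖ * B * M) * (A + 1) * (Real.exp (2 * A₂ ^ 2) * I₂),
    by positivity, fun t ht ht1 x₀ hx₀ x₁ hx₁ y₀ hy₀ y₁ hy₁ hy₁t hy₀t ↦ ?_⟩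
  set η := κ * t with hη
  have hη0 : 0 < η := by positivity
  have hr₂ : 0 < r₂ := by
    rw [mem_ball_zero_iff] at hx₀
    exact (norm_nonneg _).trans_lt hx₀
  have hz₀ : (x₀, (0 : X)) ∈ Metric.ball (0 : X × X) r₂ := by
    rw [mem_ball_zero_iff] at hx₀ ⊢
    rw [Prod.norm_def]
    exact max_lt hx₀ (by simpa using hr₂)
  -- The velocity `h (p + iq)` of the Gaussian is that of the transport to `y₁`, frozen at the edge.
  set p := η⁻¹ • P (x₀, 0) y₁ with hp
  set q := η⁻¹ • Q (x₀, 0) y₁ with hq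
  have hlin : ∀ T : X →L[ℝ] X, ‖T‖ ≤ B → ‖η⁻¹ • T y₁‖ ≤ A₂ := by
    intro T hT
    rw [norm_smul, Real.norm_of_nonneg (inv_pos.2 hη0).le]
    calc η⁻¹ * ‖T y₁‖ ≤ η⁻¹ * (B * (A * t)) := by
          gcongr
          exact (T.le_of_opNorm_le hT y₁).trans (by gcongr)
      _ = A₂ := by rw [hη, hA₂]; field_simp
  have hpA : ‖p‖ ≤ A₂ := hlin _ (h.P_le _ hz₀)
  have hqA : ‖q‖ ≤ A₂ := hlin _ (h.Q_le _ hz₀)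
  have hsm : ∀ s ∈ Icc (0 : ℝ) 1, ∀ w : X, ‖w‖ ≤ A₂ → ‖(s - 1) • w‖ ≤ A₂ := by
    intro s hs w hw
    rw [norm_smul, Real.norm_eq_abs]
    have : |s - 1| ≤ 1 := abs_le.2 ⟨by linarith [hs.1], by linarith [hs.2]⟩
    calc |s - 1| * ‖w‖ ≤ 1 * A₂ := by gcongr
      _ = A₂ := one_mul _
  set k : X → ℝ := fun x ↦ Real.exp (2 * A₂ ^ 2) * Real.exp (-(1 / 2) * ‖η⁻¹ • (x - x₁)‖ ^ 2)
    with hk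
  set g : X → ℝ := fun x ↦ t * c₃ * Real.exp (-(1 / 4) * ‖η⁻¹ • (x - x₁)‖ ^ 2) with hg
  have hcomp : ∀ (b : ℝ), 0 < b →
      Integrable (fun x ↦ Real.exp (-b * ‖η⁻¹ • (x - x₁)‖ ^ 2)) := by
    intro b hb
    exact ((integrable_exp_neg_mul_norm_sq (X := X) hb).comp_smul
      (inv_pos.2 hη0).ne').comp_sub_right x₁
  have hψk : ∀ s ∈ Icc (0 : ℝ) 1, ∀ x, ‖movingGaussian x₁ p q η (s, x)‖ ≤ k x := fun s hs x ↦
    norm_complexGaussian_add_le (hsm s hs p hpA) (hsm s hs q hqA)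
  have hψg : ∀ s ∈ Icc (0 : ℝ) 1, ∀ x ∈ Metric.closedBall (0 : X) r₁,
      ‖fderiv ℝ (movingGaussian x₁ p q η) (s, x) (1, 0) -
        fderiv ℝ (movingGaussian x₁ p q η) (s, x) (0, P (x, y₀ + s • (y₁ - y₀)) (y₁ - y₀)) -
        Complex.I * fderiv ℝ (movingGaussian x₁ p q η) (s, x)
          (0, Q (x, y₀ + s • (y₁ - y₀)) (y₁ - y₀))‖ ≤ g x := by
    intro s hs x hx
    refine (norm_fderiv_movingGaussian_sub_le x₁ p q hη0 s x _ _).trans ?_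
    have h1 := norm_frozen_coefficient_sub_le h.convex h.subset h.lt h.contDiffOn_P h.P_le
      h.fderiv_P_le hB hA hκ ht ht1 hz₀ hx₁ hy₀ hy₁ hy₁t hy₀t hs hx
    have h2 := norm_frozen_coefficient_sub_le h.convex h.subset h.lt h.contDiffOn_Q h.Q_le
      h.fderiv_Q_le hB hA hκ ht ht1 hz₀ hx₁ hy₀ hy₁ hy₁t hy₀t hs hx
    rw [← hη, ← hc₂] at h1 h2
    have h3 := hψk s hs x
    have h4 := hsm s hs p hpA
    have h5 := hsm s hs q hqA
    set u := ‖η⁻¹ • (x - x₁)‖ with hu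
    have hu0 : 0 ≤ u := norm_nonneg _
    have h6 : ‖η⁻¹ • (x - x₁) + (s - 1) • p‖ + ‖(s - 1) • q‖ ≤ (1 + 2 * A₂) * (1 + u) := by
      have := norm_add_le (η⁻¹ • (x - x₁)) ((s - 1) • p)
      nlinarith
    have h7 : ‖η • p - P (x, y₀ + s • (y₁ - y₀)) (y₁ - y₀)‖ +
        ‖η • q - Q (x, y₀ + s • (y₁ - y₀)) (y₁ - y₀)‖ ≤ 2 * (B * t ^ 2 * c₂ * (1 + u)) := by
      linarith
    calc _ ≤ k x * (2 * η⁻¹ * ((1 + 2 * A₂) * (1 + u)) * (2 * (B * t ^ 2 * c₂ * (1 + u)))) := by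
          have := hη0.le
          gcongr
      _ = t * (Real.exp (2 * A₂ ^ 2) * (4 * κ⁻¹ * B * c₂ * (1 + 2 * A₂))) *
          ((1 + u) ^ 2 * Real.exp (-(1 / 2) * u ^ 2)) := by
          have hkx : k x = Real.exp (2 * A₂ ^ 2) * Real.exp (-(1 / 2) * u ^ 2) := rfl
          rw [hkx, show η⁻¹ = κ⁻¹ * t⁻¹ by rw [hη, mul_inv]]
          field_simp
          ring
      _ ≤ t * (Real.exp (2 * A₂ ^ 2) * (4 * κ⁻¹ * B * c₂ * (1 + 2 * A₂))) *
          (8 * Real.exp (-(1 / 4) * u ^ 2)) := by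
          exact mul_le_mul_of_nonneg_left (one_add_norm_sq_mul_exp_le u) (by positivity)
      _ = g x := by
          rw [hg, hc₃]
          ring
  have main := h.norm_integral_sub_integral_le volume hy₀ hy₁ (contDiff_movingGaussian x₁ p q η)
    ((hcomp (1 / 4) (by norm_num)).const_mul (t * c₃)) (fun x ↦ by positivity)
    ((hcomp (1 / 2) (by norm_num)).const_mul _) hψk hψg
  -- pass to the variable `ξ = (x - x₁) / η`
  set d := (η ^ Module.finrank ℝ X)⁻¹ with hd
  have hd0 : 0 ≤ d := by positivity
  have s1 : d • (∫ x, F (x, y₁) * movingGaussian x₁ p q η (1, x)) =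
      ∫ ξ, F (x₁ + η • ξ, y₁) * complexGaussian ξ 0 := by
    rw [← integral_comp_add_smul (fun x ↦ F (x, y₁) * movingGaussian x₁ p q η (1, x)) x₁ hη0]
    congr 1
    ext ξ
    simp [movingGaussian, inv_smul_smul₀ hη0.ne']
  have s0 : d • (∫ x, F (x, y₀) * movingGaussian x₁ p q η (0, x)) =
      ∫ ξ, F (x₁ + η • ξ, y₀) * complexGaussian (ξ + -p) (-q) := by
    rw [← integral_comp_add_smul (fun x ↦ F (x, y₀) * movingGaussian x₁ p q η (0, x)) x₁ hη0]
    congr 1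
    ext ξ
    simp [movingGaussian, inv_smul_smul₀ hη0.ne']
  have sb : ∀ b : ℝ, d * ∫ x, Real.exp (-b * ‖η⁻¹ • (x - x₁)‖ ^ 2) =
      ∫ ξ : X, Real.exp (-b * ‖ξ‖ ^ 2) := by
    intro b
    rw [← smul_eq_mul, ← integral_comp_add_smul
      (fun x ↦ Real.exp (-b * ‖η⁻¹ • (x - x₁)‖ ^ 2)) x₁ hη0]
    congr 1
    ext ξ
    simp only [add_sub_cancel_left, inv_smul_smul₀ hη0.ne']
  rw [← s1, ← s0, ← smul_sub, norm_smul, Real.norm_of_nonneg hd0]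
  have hyy : ‖y₁ - y₀‖ ≤ (A + 1) * t := by
    have := _root_.norm_sub_le y₁ y₀
    nlinarith
  calc d * ‖(∫ x, F (x, y₁) * movingGaussian x₁ p q η (1, x)) -
        ∫ x, F (x, y₀) * movingGaussian x₁ p q η (0, x)‖
      ≤ d * (M * (∫ x, g x) + (C + 2 * ‖traceCLM X‖ * B * M) * ‖y₁ - y₀‖ * ∫ x, k x) := by
        gcongr
    _ = M * (t * c₃ * I₄) + (C + 2 * ‖traceCLM X‖ * B * M) * ‖y₁ - y₀‖ *
          (Real.exp (2 * A₂ ^ 2) * I₂) := by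
        rw [hg, hk, integral_const_mul, integral_const_mul, hI₄, hI₂, ← sb, ← sb]
        ring
    _ ≤ M * (t * c₃ * I₄) + (C + 2 * ‖traceCLM X‖ * B * M) * ((A + 1) * t) *
          (Real.exp (2 * A₂ ^ 2) * I₂) := by
        gcongr
    _ = _ := by ring

end Averages

section AveragesLimit

variable {X : Type*} [NormedAddCommGroup X] [InnerProductSpace ℝ X]

lemma continuous_complexGaussian_comp (x₁ p q : X) (η : ℝ) :
    Continuous fun x ↦ complexGaussian (η⁻¹ • (x - x₁) + p) q := by
  unfold complexGaussian
  fun_prop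

variable [FiniteDimensional ℝ X] [MeasurableSpace X] [BorelSpace X]

lemma integrable_complexGaussian_comp (x₁ p q : X) {η : ℝ} (hη : 0 < η) :
    Integrable fun x ↦ complexGaussian (η⁻¹ • (x - x₁) + p) q := by
  have h1 := ((integrable_exp_neg_mul_norm_sq (X := X) (b := 1 / 2) (by norm_num)).comp_smul
    (inv_pos.2 hη).ne').comp_sub_right x₁
  refine (h1.const_mul (Real.exp (2 * (max ‖p‖ ‖q‖) ^ 2))).mono'
    (continuous_complexGaussian_comp x₁ p q η).aestronglyMeasurable
    (Eventually.of_forall fun x ↦ ?_)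
  exact norm_complexGaussian_add_le (le_max_left _ _) (le_max_right _ _)

/-- The mass of a Gaussian outside the ball of radius `η R`, where `η` is its width. -/
lemma setIntegral_norm_complexGaussian_comp_le (x₁ : X) {p q : X} {A η R : ℝ} (hp : ‖p‖ ≤ A)
    (hq : ‖q‖ ≤ A) (hη : 0 < η) (hR : 0 ≤ R) :
    (η ^ Module.finrank ℝ X)⁻¹ * ∫ x in (Metric.closedBall x₁ (η * R))ᶜ,
      ‖complexGaussian (η⁻¹ • (x - x₁) + p) q‖ ≤
    Real.exp (2 * A ^ 2) * Real.exp (-(1 / 4) * R ^ 2) *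
      ∫ ξ : X, Real.exp (-(1 / 4) * ‖ξ‖ ^ 2) := by
  have hd : (η ^ Module.finrank ℝ X)⁻¹ * ∫ x, Real.exp (-(1 / 4) * ‖η⁻¹ • (x - x₁)‖ ^ 2) =
      ∫ ξ : X, Real.exp (-(1 / 4) * ‖ξ‖ ^ 2) := by
    rw [← smul_eq_mul, ← integral_comp_add_smul
      (fun x ↦ Real.exp (-(1 / 4) * ‖η⁻¹ • (x - x₁)‖ ^ 2)) x₁ hη]
    congr 1
    ext ξ
    simp only [add_sub_cancel_left, inv_smul_smul₀ hη.ne']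
  have hi : Integrable fun x ↦ Real.exp (-(1 / 4) * ‖η⁻¹ • (x - x₁)‖ ^ 2) :=
    ((integrable_exp_neg_mul_norm_sq (X := X) (b := 1 / 4) (by norm_num)).comp_smul
      (inv_pos.2 hη).ne').comp_sub_right x₁
  have hm : MeasurableSet (Metric.closedBall x₁ (η * R))ᶜ :=
    Metric.isClosed_closedBall.measurableSet.compl
  rw [← hd, mul_left_comm]
  refine mul_le_mul_of_nonneg_left ?_ (by positivity)
  rw [← integral_const_mul]
  refine (setIntegral_mono_on (integrable_complexGaussian_comp x₁ p q hη).norm.integrableOn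
    (hi.const_mul _).integrableOn hm fun x hx ↦ ?_).trans
    (setIntegral_le_integral (hi.const_mul _) (Eventually.of_forall fun x ↦ by positivity))
  refine (norm_complexGaussian_add_le hp hq).trans ?_
  rw [mem_compl_iff, mem_closedBall_iff_norm, not_le] at hx
  have h1 : R ≤ ‖η⁻¹ • (x - x₁)‖ := by
    rw [norm_smul, Real.norm_of_nonneg (inv_pos.2 hη).le, le_inv_mul_iff₀ hη]
    exact hx.le
  rw [← Real.exp_add, ← Real.exp_add, ← Real.exp_add, Real.exp_le_exp]
  nlinarith

lemma integral_complexGaussian_comp (x₁ p q : X) {η : ℝ} (hη : 0 < η) :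
    (η ^ Module.finrank ℝ X)⁻¹ • ∫ x, complexGaussian (η⁻¹ • (x - x₁) + p) q =
      (Real.pi : ℂ) ^ (Module.finrank ℝ X / 2 : ℂ) := by
  rw [← integral_comp_add_smul (fun x ↦ complexGaussian (η⁻¹ • (x - x₁) + p) q) x₁ hη,
    ← integral_complexGaussian_add p q]
  congr 1
  ext ξ
  simp only [add_sub_cancel_left, inv_smul_smul₀ hη.ne']

/-- Gaussian averages of a locally integrable function near a Lebesgue point, over a window. -/
lemma norm_setIntegral_mul_complexGaussian_sub_le {f : X → ℂ} (hf : LocallyIntegrable f)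
    {x₀ x₁ p q : X} {A η R δ : ℝ} (hp : ‖p‖ ≤ A) (hq : ‖q‖ ≤ A) (hη : 0 < η) (hR : 0 ≤ R)
    (hδ : Metric.closedBall x₁ (η * R) ⊆ Metric.closedBall x₀ δ) :
    ‖(η ^ Module.finrank ℝ X)⁻¹ • (∫ x in Metric.closedBall x₁ (η * R),
        f x * complexGaussian (η⁻¹ • (x - x₁) + p) q) -
      f x₀ * (Real.pi : ℂ) ^ (Module.finrank ℝ X / 2 : ℂ)‖ ≤
    Real.exp (2 * A ^ 2) * ((η ^ Module.finrank ℝ X)⁻¹ *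
      ∫ x in Metric.closedBall x₀ δ, ‖f x - f x₀‖) +
    ‖f x₀‖ * (Real.exp (2 * A ^ 2) * Real.exp (-(1 / 4) * R ^ 2) *
      ∫ ξ : X, Real.exp (-(1 / 4) * ‖ξ‖ ^ 2)) := by
  set d := (η ^ Module.finrank ℝ X)⁻¹ with hd
  have hd0 : 0 ≤ d := by positivity
  set T := Metric.closedBall x₁ (η * R) with hT
  have hTm : MeasurableSet T := Metric.isClosed_closedBall.measurableSet
  set Ψ : X → ℂ := fun x ↦ complexGaussian (η⁻¹ • (x - x₁) + p) q with hΨ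
  have hΨi : Integrable Ψ := integrable_complexGaussian_comp x₁ p q hη
  have hΨb : ∀ x, ‖Ψ x‖ ≤ Real.exp (2 * A ^ 2) := fun x ↦ by
    refine (norm_complexGaussian_add_le hp hq).trans ?_
    have : Real.exp (-(1 / 2) * ‖η⁻¹ • (x - x₁)‖ ^ 2) ≤ 1 := by
      rw [Real.exp_le_one_iff]
      nlinarith [sq_nonneg ‖η⁻¹ • (x - x₁)‖]
    nlinarith [Real.exp_pos (2 * A ^ 2)]
  have hfT : IntegrableOn f T := hf.integrableOn_isCompact (isCompact_closedBall _ _)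
  have hfδ : IntegrableOn f (Metric.closedBall x₀ δ) :=
    hf.integrableOn_isCompact (isCompact_closedBall _ _)
  have hfΨ : IntegrableOn (fun x ↦ f x * Ψ x) T :=
    hfT.mul_bdd (c := Real.exp (2 * A ^ 2)) hΨi.aestronglyMeasurable.restrict
      (Eventually.of_forall hΨb)
  have hsub : IntegrableOn (fun x ↦ f x - f x₀) (Metric.closedBall x₀ δ) :=
    hfδ.sub (integrableOn_const (isCompact_closedBall _ _).measure_lt_top.ne)
  have e : d • (∫ x in T, f x * Ψ x) - f x₀ * (Real.pi : ℂ) ^ (Module.finrank ℝ X / 2 : ℂ) =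
      d • (∫ x in T, (f x - f x₀) * Ψ x) - f x₀ * (d • ∫ x in Tᶜ, Ψ x) := by
    rw [← integral_complexGaussian_comp x₁ p q hη, ← hd, ← integral_add_compl hTm hΨi]
    have h1 : ∫ x in T, (f x - f x₀) * Ψ x = (∫ x in T, f x * Ψ x) - f x₀ * ∫ x in T, Ψ x := by
      rw [← integral_const_mul, ← integral_sub hfΨ (hΨi.integrableOn.const_mul _)]
      congr 1
      ext x
      ring
    rw [h1]
    simp only [Complex.real_smul]
    ring
  rw [e]
  refine (norm_sub_le _ _).trans (add_le_add ?_ ?_)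
  · rw [norm_smul, Real.norm_of_nonneg hd0, mul_left_comm]
    refine mul_le_mul_of_nonneg_left ?_ hd0
    calc ‖∫ x in T, (f x - f x₀) * Ψ x‖
        ≤ ∫ x in T, Real.exp (2 * A ^ 2) * ‖f x - f x₀‖ := by
          refine norm_integral_le_of_norm_le ((hsub.mono_set hδ).norm.const_mul _)
            (Eventually.of_forall fun x ↦ ?_)
          rw [norm_mul, mul_comm]
          exact mul_le_mul_of_nonneg_right (hΨb x) (norm_nonneg _)
      _ ≤ _ := by
          rw [integral_const_mul]
          refine mul_le_mul_of_nonneg_left ?_ (Real.exp_pos _).le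
          exact setIntegral_mono_set hsub.norm (Eventually.of_forall fun x ↦ norm_nonneg _)
            hδ.eventuallyLE
  · rw [norm_mul]
    refine mul_le_mul_of_nonneg_left ?_ (norm_nonneg _)
    rw [norm_smul, Real.norm_of_nonneg hd0]
    refine le_trans ?_ (setIntegral_norm_complexGaussian_comp_le x₁ hp hq hη hR)
    exact mul_le_mul_of_nonneg_left (norm_integral_le_integral_norm _) hd0

/-- At almost every point of the edge, all Gaussian averages of width comparable to the distance to
the edge converge to the same limit, uniformly over non-tangential approach. The limit is the value
of a weak boundary limit of `F` at a Lebesgue point. -/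
theorem IsTubeSolution.ae_exists_gaussian_limit {F : X × X → ℂ} {O : Set X}
    {P Q : X × X → X →L[ℝ] X} {r₁ r₂ M B C : ℝ} (h : IsTubeSolution F O P Q r₁ r₂ M B C)
    {e : X} (he : ∀ᶠ ε in 𝓝[>] (0 : ℝ), ε • e ∈ O) :
    ∀ᵐ x₀ : X, x₀ ∈ Metric.ball (0 : X) r₂ → ∃ L : ℂ, ∀ A κ : ℝ, 0 ≤ A → 0 < κ → ∀ ε > 0,
      ∃ t₀ > 0, ∀ t : ℝ, 0 < t → t < t₀ → ∀ x₁ : X, ‖x₁ - x₀‖ ≤ A * t →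
      ∀ y₁ ∈ O, ‖y₁‖ ≤ A * t →
      ‖(∫ ξ, F (x₁ + (κ * t) • ξ, y₁) * complexGaussian ξ 0) -
        L * (Real.pi : ℂ) ^ (Module.finrank ℝ X / 2 : ℂ)‖ ≤ ε := by
  have hM := h.M_nonneg
  have hB := h.B_nonneg
  -- The planes `X × {ε • e}` approach the edge; an ultrafilter replaces a choice of subsequence.
  let l : Ultrafilter ℝ := Ultrafilter.of (𝓝[>] (0 : ℝ))
  have hl : (l : Filter ℝ) ≤ 𝓝[>] (0 : ℝ) := Ultrafilter.of_le _
  have hcont : ∀ y ∈ O, Continuous fun x ↦ F (x, y) := fun y hy ↦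
    h.contDiffOn.continuousOn.comp_continuous (by fun_prop) fun x ↦ ⟨mem_univ _, hy⟩
  obtain ⟨f, hf2, hf⟩ := exists_weak_limit_of_bounded (volume : Measure X) l
    (fun ε x ↦ F (x, ε • e)) (M := M) (r := r₁)
    (hl (he.mono fun ε hε ↦ (hcont _ hε).aestronglyMeasurable))
    (hl (he.mono fun ε hε x ↦ h.norm_le x _ hε))
    (hl (he.mono fun ε hε x hx ↦ h.eq_zero _ hε x hx))
  have hfl : LocallyIntegrable f := hf2.locallyIntegrable (by norm_num)
  filter_upwards [IsUnifLocDoublingMeasure.ae_tendsto_average_norm_sub volume hfl 1]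
    with x₀ hleb hx₀
  have hleb' : Tendsto (fun δ ↦ ⨍ y in Metric.closedBall x₀ δ, ‖f y - f x₀‖) (𝓝[>] (0 : ℝ)) (𝓝 0) :=
    hleb (fun _ ↦ x₀) (fun δ ↦ δ) tendsto_id (by
      filter_upwards [self_mem_nhdsWithin] with δ hδ
      exact Metric.mem_closedBall_self (by rw [one_mul]; exact le_of_lt hδ))
  refine ⟨f x₀, fun A κ hA hκ ε hε ↦ ?_⟩
  obtain ⟨c, hc, hct⟩ := h.exists_norm_integral_gaussian_sub_le hA hκ
  set A₂ : ℝ := κ⁻¹ * (B * A) with hA₂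
  set k₀ := Real.exp (2 * A₂ ^ 2) with hk₀
  set I₄ : ℝ := ∫ ξ : X, Real.exp (-(1 / 4) * ‖ξ‖ ^ 2) with hI₄
  have hI₄0 : 0 ≤ I₄ := integral_nonneg fun ξ ↦ (Real.exp_pos _).le
  set n := Module.finrank ℝ X with hn
  -- the radius of the window
  obtain ⟨R, hR0, hR⟩ : ∃ R : ℝ, 0 < R ∧
      (M + ‖f x₀‖) * (k₀ * Real.exp (-(1 / 4) * R ^ 2) * I₄) < ε / 3 := by
    have h1 : Tendsto (fun R : ℝ ↦ -(1 / 4) * R ^ 2) atTop atBot :=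
      (tendsto_pow_atTop two_ne_zero).const_mul_atTop_of_neg (by norm_num)
    have h2 : Tendsto (fun R : ℝ ↦ (M + ‖f x₀‖) * (k₀ * Real.exp (-(1 / 4) * R ^ 2) * I₄)) atTop
        (𝓝 ((M + ‖f x₀‖) * (k₀ * 0 * I₄))) :=
      (((Real.tendsto_exp_atBot.comp h1).const_mul k₀).mul_const I₄).const_mul _
    rw [mul_zero, zero_mul, mul_zero] at h2
    obtain ⟨R, hR1, hR2⟩ := ((eventually_gt_atTop 0).and
      (h2.eventually (gt_mem_nhds (by positivity : 0 < ε / 3)))).exists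
    exact ⟨R, hR1, hR2⟩
  set a := A + κ * R with ha
  have ha0 : 0 < a := by positivity
  set v := volume.real (Metric.ball (0 : X) 1) with hv
  set m := k₀ * (κ ^ n)⁻¹ * (a ^ n * v) with hm
  have hm0 : 0 ≤ m := by positivity
  obtain ⟨δ₁, hδ₁, hδ⟩ : ∃ δ₁ > 0, ∀ δ, 0 < δ → δ < δ₁ →
      ⨍ y in Metric.closedBall x₀ δ, ‖f y - f x₀‖ < ε / 3 / (m + 1) := by
    have h1 := hleb'.eventually (gt_mem_nhds (by positivity : 0 < ε / 3 / (m + 1)))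
    obtain ⟨δ₁, hδ₁, h2⟩ := mem_nhdsGT_iff_exists_Ioo_subset.1 h1
    exact ⟨δ₁, hδ₁, fun δ h3 h4 ↦ h2 ⟨h3, h4⟩⟩
  refine ⟨min 1 (min (δ₁ / a) (ε / 3 / (c + 1))), by positivity,
    fun t ht htt x₁ hx₁ y₁ hy₁ hy₁t ↦ ?_⟩
  have ht1 : t ≤ 1 := (htt.trans_le (min_le_left _ _)).le
  have htδ : a * t < δ₁ := by
    have := htt.trans_le ((min_le_right _ _).trans (min_le_left _ _))
    rwa [lt_div_iff₀ ha0, mul_comm] at this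
  have htc : c * t ≤ ε / 3 := by
    have h1 := (htt.trans_le ((min_le_right _ _).trans (min_le_right _ _))).le
    rw [le_div_iff₀ (by positivity)] at h1
    nlinarith
  set η := κ * t with hη
  have hη0 : 0 < η := by positivity
  have hr₂ : 0 < r₂ := by
    rw [mem_ball_zero_iff] at hx₀
    exact (norm_nonneg _).trans_lt hx₀
  have hz₀ : (x₀, (0 : X)) ∈ Metric.ball (0 : X × X) r₂ := by
    rw [mem_ball_zero_iff] at hx₀ ⊢
    rw [Prod.norm_def]
    exact max_lt hx₀ (by simpa using hr₂)
  have hlin : ∀ T : X →L[ℝ] X, ‖T‖ ≤ B → ‖-(η⁻¹ • T y₁)‖ ≤ A₂ := by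
    intro T hT
    rw [norm_neg, norm_smul, Real.norm_of_nonneg (inv_pos.2 hη0).le]
    calc η⁻¹ * ‖T y₁‖ ≤ η⁻¹ * (B * (A * t)) := by
          gcongr
          exact (T.le_of_opNorm_le hT y₁).trans (by gcongr)
      _ = A₂ := by rw [hη, hA₂]; field_simp
  set p := -(η⁻¹ • P (x₀, 0) y₁) with hp
  set q := -(η⁻¹ • Q (x₀, 0) y₁) with hq
  have hpA : ‖p‖ ≤ A₂ := hlin _ (h.P_le _ hz₀)
  have hqA : ‖q‖ ≤ A₂ := hlin _ (h.Q_le _ hz₀)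
  set d := (η ^ n)⁻¹ with hd
  have hd0 : 0 ≤ d := by positivity
  set T := Metric.closedBall x₁ (η * R) with hT
  have hTm : MeasurableSet T := Metric.isClosed_closedBall.measurableSet
  set Ψ : X → ℂ := fun x ↦ complexGaussian (η⁻¹ • (x - x₁) + p) q with hΨ
  have hΨi : Integrable Ψ := integrable_complexGaussian_comp x₁ p q hη0
  have hΨc : Continuous Ψ := continuous_complexGaussian_comp x₁ p q η
  set I := ∫ ξ, F (x₁ + η • ξ, y₁) * complexGaussian ξ 0 with hI
  have hψ2 : MemLp (T.indicator Ψ) 2 volume := by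
    obtain ⟨b, hb⟩ := (isCompact_closedBall x₁ (η * R)).exists_bound_of_continuousOn
      hΨc.continuousOn
    refine (memLp_indicator_const 2 hTm b (Or.inr
      (isCompact_closedBall x₁ (η * R)).measure_lt_top.ne)).mono
      (hΨc.aestronglyMeasurable.indicator hTm) (Eventually.of_forall fun x ↦ ?_)
    by_cases hx : x ∈ T
    · simp only [indicator_of_mem hx]
      exact (hb x hx).trans (le_abs_self b)
    · simp [indicator_of_notMem hx]
  have hlim := hf _ hψ2
  have hind : ∀ u : X → ℂ, ∫ x, u x * T.indicator Ψ x = ∫ x in T, u x * Ψ x := by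
    intro u
    rw [← integral_indicator hTm]
    congr 1
    ext x
    by_cases hx : x ∈ T <;> simp [hx]
  simp only [hind] at hlim
  set τ := k₀ * Real.exp (-(1 / 4) * R ^ 2) * I₄ with hτ
  have htail : d * ∫ x in Tᶜ, ‖Ψ x‖ ≤ τ :=
    setIntegral_norm_complexGaussian_comp_le x₁ hpA hqA hη0 hR0.le
  -- Transport from `y₁` to `ε • e`, then `ε → 0` in the window `T`; outside, `‖F‖ ≤ M` is used.
  have hstep1 : ‖I - d • ∫ x in T, f x * Ψ x‖ ≤ c * t + M * τ := by
    refine le_of_tendsto ((hlim.const_smul d).const_sub I).norm ?_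
    have hsmall : ∀ᶠ ε in 𝓝[>] (0 : ℝ), ‖ε • e‖ ≤ t ^ 2 := by
      have h1 : Tendsto (fun ε : ℝ ↦ ‖ε • e‖) (𝓝[>] 0) (𝓝 ‖(0 : ℝ) • e‖) :=
        ((by fun_prop : Continuous fun ε : ℝ ↦ ‖ε • e‖).tendsto 0).mono_left nhdsWithin_le_nhds
      rw [zero_smul, norm_zero] at h1
      exact (h1.eventually (gt_mem_nhds (by positivity : 0 < t ^ 2))).mono fun _ h ↦ h.le
    refine hl ((he.and hsmall).mono fun ε hε ↦ ?_)
    have h1 := hct t ht ht1 x₀ hx₀ x₁ hx₁ (ε • e) hε.1 y₁ hy₁ hy₁t hε.2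
    rw [← hη, ← hp, ← hq, ← hI] at h1
    have h2 : ∫ ξ, F (x₁ + η • ξ, ε • e) * complexGaussian (ξ + p) q =
        d • ∫ x, F (x, ε • e) * Ψ x := by
      rw [← integral_comp_add_smul (fun x ↦ F (x, ε • e) * Ψ x) x₁ hη0]
      congr 1
      ext ξ
      simp only [hΨ, add_sub_cancel_left, inv_smul_smul₀ hη0.ne']
    have hFΨ : Integrable fun x ↦ F (x, ε • e) * Ψ x :=
      hΨi.bdd_mul (c := M) (hcont _ hε.1).aestronglyMeasurable
        (Eventually.of_forall fun x ↦ h.norm_le x _ hε.1)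
    have h3 : ‖d • ∫ x in Tᶜ, F (x, ε • e) * Ψ x‖ ≤ M * τ := by
      rw [norm_smul, Real.norm_of_nonneg hd0]
      calc d * ‖∫ x in Tᶜ, F (x, ε • e) * Ψ x‖ ≤ d * ∫ x in Tᶜ, M * ‖Ψ x‖ := by
            gcongr
            refine norm_integral_le_of_norm_le (hΨi.norm.integrableOn.const_mul _)
              (Eventually.of_forall fun x ↦ ?_)
            rw [norm_mul]
            exact mul_le_mul_of_nonneg_right (h.norm_le x _ hε.1) (norm_nonneg _)
        _ = M * (d * ∫ x in Tᶜ, ‖Ψ x‖) := by rw [integral_const_mul]; ring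
        _ ≤ M * τ := by gcongr
    rw [h2, ← integral_add_compl hTm hFΨ, smul_add] at h1
    have e4 : I - d • ∫ x in T, F (x, ε • e) * Ψ x = (I - (d • (∫ x in T, F (x, ε • e) * Ψ x) +
        d • ∫ x in Tᶜ, F (x, ε • e) * Ψ x)) + d • ∫ x in Tᶜ, F (x, ε • e) * Ψ x := by ring
    rw [e4]
    exact (norm_add_le _ _).trans (add_le_add h1 h3)
  have hsub : T ⊆ Metric.closedBall x₀ (a * t) := by
    refine Metric.closedBall_subset_closedBall' ?_
    rw [dist_eq_norm, ha, hη]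
    nlinarith
  have hstep2 := norm_setIntegral_mul_complexGaussian_sub_le hfl hpA hqA hη0 hR0.le hsub
  have hat : 0 < a * t := by positivity
  -- the Lebesgue point property at `x₀`
  have havg : k₀ * (d * ∫ x in Metric.closedBall x₀ (a * t), ‖f x - f x₀‖) ≤ ε / 3 := by
    have h1 := hδ (a * t) hat htδ
    rw [setAverage_eq, smul_eq_mul, Measure.addHaar_real_closedBall _ _ hat.le, ← hn] at h1
    set S := ∫ x in Metric.closedBall x₀ (a * t), ‖f x - f x₀‖
    have hv0 : 0 < v := ENNReal.toReal_pos
      (Metric.measure_ball_pos volume (0 : X) one_pos).ne' Metric.isBounded_ball.measure_lt_top.ne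
    have e1 : k₀ * (d * S) = m * ((((a * t) ^ n * v)⁻¹) * S) := by
      rw [hm, hd, hη, mul_pow, mul_pow]
      field_simp
    rw [e1]
    calc m * ((((a * t) ^ n * v)⁻¹) * S) ≤ m * (ε / 3 / (m + 1)) := by gcongr
      _ ≤ (m + 1) * (ε / 3 / (m + 1)) := by gcongr; linarith
      _ = ε / 3 := by field_simp
  calc ‖I - f x₀ * (Real.pi : ℂ) ^ (n / 2 : ℂ)‖
      = ‖(I - d • ∫ x in T, f x * Ψ x) + (d • (∫ x in T, f x * Ψ x) -
        f x₀ * (Real.pi : ℂ) ^ (n / 2 : ℂ))‖ := by congr 1; ring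
    _ ≤ (c * t + M * τ) + (k₀ * (d * ∫ x in Metric.closedBall x₀ (a * t), ‖f x - f x₀‖) +
        ‖f x₀‖ * τ) := (norm_add_le _ _).trans (add_le_add hstep1 hstep2)
    _ ≤ ε := by linarith

end AveragesLimit

/-! ### Non-tangential limits in adapted coordinates -/

section Smoothing

variable {X : Type*} [NormedAddCommGroup X] [InnerProductSpace ℝ X] [FiniteDimensional ℝ X]
  [MeasurableSpace X] [BorelSpace X]

lemma integral_norm_sub_translate_le {E : Type*} [NormedAddCommGroup E] [NormedSpace ℝ E]
    [FiniteDimensional ℝ E] [MeasurableSpace E] [BorelSpace E] (μ : Measure E) [μ.IsAddHaarMeasure]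
    {χ : E → ℝ} {D : ℝ} (hχ : ContDiff ℝ 1 χ) (hχs : tsupport χ ⊆ Metric.closedBall 0 1)
    (hχd : ∀ w, ‖fderiv ℝ χ w‖ ≤ D) (δ : E) :
    ∫ w, |χ w - χ (w - δ)| ∂μ ≤ 2 * (D * ‖δ‖) * μ.real (Metric.closedBall 0 1) := by
  have hD : 0 ≤ D := le_trans (ContinuousLinearMap.opNorm_nonneg _) (hχd 0)
  have hm : MeasurableSet (Metric.closedBall (0 : E) 1) := Metric.isClosed_closedBall.measurableSet
  have hχ0 : ∀ w ∉ Metric.closedBall (0 : E) 1, χ w = 0 := fun w hw ↦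
    image_eq_zero_of_notMem_tsupport fun h ↦ hw (hχs h)
  set b : E → ℝ := (Metric.closedBall (0 : E) 1).indicator fun _ ↦ D * ‖δ‖ with hb
  have hb0 : ∀ w, 0 ≤ b w := fun w ↦ indicator_nonneg (fun _ _ ↦ by positivity) w
  have hbi : Integrable b μ := (integrable_indicator_iff hm).2
    (integrableOn_const (isCompact_closedBall (0 : E) 1).measure_lt_top.ne)
  have hbv : ∫ w, b w ∂μ = D * ‖δ‖ * μ.real (Metric.closedBall 0 1) := by
    rw [hb, integral_indicator hm, setIntegral_const, smul_eq_mul, mul_comm]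
  have hle : ∀ w, |χ w - χ (w - δ)| ≤ b w + b (w - δ) := by
    intro w
    have h1 : |χ w - χ (w - δ)| ≤ D * ‖δ‖ := by
      have := convex_univ.norm_image_sub_le_of_norm_fderiv_le (𝕜 := ℝ) (f := χ) (C := D)
        (fun z _ ↦ hχ.differentiable one_ne_zero z) (fun z _ ↦ hχd z) (mem_univ (w - δ))
        (mem_univ w)
      simpa using this
    by_cases hw : w ∈ Metric.closedBall (0 : E) 1
    · have : b w = D * ‖δ‖ := indicator_of_mem hw _
      linarith [hb0 (w - δ)]
    · by_cases hw' : w - δ ∈ Metric.closedBall (0 : E) 1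
      · have : b (w - δ) = D * ‖δ‖ := indicator_of_mem hw' _
        linarith [hb0 w]
      · rw [hχ0 w hw, hχ0 _ hw']
        simpa using add_nonneg (hb0 w) (hb0 (w - δ))
  calc _ ≤ ∫ w, (b w + b (w - δ)) ∂μ :=
        integral_mono_of_nonneg (Eventually.of_forall fun w ↦ abs_nonneg _)
          (hbi.add (hbi.comp_sub_right δ)) (Eventually.of_forall hle)
    _ = _ := by
        rw [integral_add hbi (hbi.comp_sub_right δ), integral_sub_right_eq_self b δ, hbv]
        ring

lemma isAddHaarMeasure_volume_prod : (volume : Measure (X × X)).IsAddHaarMeasure :=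
  inferInstanceAs ((volume : Measure X).prod (volume : Measure X)).IsAddHaarMeasure

lemma integrable_complexGaussian_zero : Integrable fun ξ : X ↦ complexGaussian ξ 0 := by
  simpa using integrable_complexGaussian_comp (0 : X) 0 0 one_pos

/-- Averages at scale `r` change little under a Gaussian smoothing at a smaller scale `s` in the
directions of the first factor. -/
lemma norm_integral_mul_sub_integral_gaussian_le {Φ : X × X → ℂ} {χ : X × X → ℝ} {M D r s : ℝ}
    (hΦ : StronglyMeasurable Φ) (hΦM : ∀ z, ‖Φ z‖ ≤ M) (hχ : ContDiff ℝ 1 χ)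
    (hχs : tsupport χ ⊆ Metric.closedBall 0 1) (hχd : ∀ w, ‖fderiv ℝ χ w‖ ≤ D) (hr : 0 < r)
    (hs : 0 ≤ s) (z : X × X) :
    ‖(∫ w, (χ w : ℂ) * Φ (z + r • w)) * (Real.pi : ℂ) ^ (Module.finrank ℝ X / 2 : ℂ) -
      ∫ w, (χ w : ℂ) * ∫ ξ : X, Φ (z + r • w + s • (ξ, (0 : X))) * complexGaussian ξ 0‖ ≤
    2 * M * D * (s / r) * volume.real (Metric.closedBall (0 : X × X) 1) *
      ∫ ξ : X, Real.exp (-(1 / 2) * ‖ξ‖ ^ 2) := by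
  have := isAddHaarMeasure_volume_prod (X := X)
  have hM : 0 ≤ M := (norm_nonneg _).trans (hΦM 0)
  have hD : 0 ≤ D := le_trans (ContinuousLinearMap.opNorm_nonneg _) (hχd 0)
  have hχc : HasCompactSupport χ :=
    (isCompact_closedBall (0 : X × X) 1).of_isClosed_subset (isClosed_tsupport χ) hχs
  have hχi : Integrable χ := hχ.continuous.integrable_of_hasCompactSupport hχc
  have hg := integrable_complexGaussian_zero (X := X)
  have hγ : ∫ ξ : X, complexGaussian ξ 0 = (Real.pi : ℂ) ^ (Module.finrank ℝ X / 2 : ℂ) := by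
    simpa using integral_complexGaussian_add (0 : X) 0
  have hprod : Integrable (fun p : (X × X) × X ↦ (χ p.1 : ℂ) *
      (Φ (z + r • p.1 + s • (p.2, (0 : X))) * complexGaussian p.2 0)) := by
    have h1 : Integrable (fun p : (X × X) × X ↦ (χ p.1 : ℂ) * complexGaussian p.2 0)
        ((volume : Measure (X × X)).prod (volume : Measure X)) := hχi.ofReal.mul_prod hg
    have h2 : AEStronglyMeasurable (fun p : (X × X) × X ↦ Φ (z + r • p.1 + s • (p.2, (0 : X))))
        ((volume : Measure (X × X)).prod (volume : Measure X)) := by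
      refine (hΦ.comp_measurable ?_).aestronglyMeasurable
      exact Continuous.measurable (by fun_prop)
    refine (h1.bdd_mul h2 (Eventually.of_forall fun p ↦ hΦM _)).congr
      (Eventually.of_forall fun p ↦ ?_)
    simp only
    ring
  have hswap : ∫ w, (χ w : ℂ) * ∫ ξ : X, Φ (z + r • w + s • (ξ, (0 : X))) * complexGaussian ξ 0 =
      ∫ ξ : X, complexGaussian ξ 0 * ∫ w, (χ w : ℂ) * Φ (z + r • w + s • (ξ, (0 : X))) := by
    have h1 := integral_integral_swap (μ := (volume : Measure (X × X))) (ν := (volume : Measure X))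
      (f := fun w ξ ↦ (χ w : ℂ) * (Φ (z + r • w + s • (ξ, (0 : X))) * complexGaussian ξ 0)) hprod
    simp_rw [← integral_const_mul]
    rw [h1]
    congr 1
    ext ξ
    congr 1
    ext w
    ring
  have hshift : ∀ ξ : X, ∫ w, (χ w : ℂ) * Φ (z + r • w + s • (ξ, (0 : X))) =
      ∫ w, (χ (w - (s / r) • (ξ, (0 : X))) : ℂ) * Φ (z + r • w) := by
    intro ξ
    rw [← integral_add_right_eq_self
      (fun w ↦ (χ (w - (s / r) • (ξ, (0 : X))) : ℂ) * Φ (z + r • w)) ((s / r) • (ξ, (0 : X)))]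
    congr 1
    ext w
    rw [add_sub_cancel_right, smul_add, smul_smul, mul_div_cancel₀ _ hr.ne', add_assoc]
  have hΦr : AEStronglyMeasurable (fun w : X × X ↦ Φ (z + r • w)) volume := by
    refine (hΦ.comp_measurable ?_).aestronglyMeasurable
    exact Continuous.measurable (by fun_prop)
  have hI : ∀ δ : X × X, Integrable fun w ↦ (χ (w - δ) : ℂ) * Φ (z + r • w) := fun δ ↦
    (hχi.comp_sub_right δ).ofReal.mul_bdd hΦr (Eventually.of_forall fun p ↦ hΦM _)
  have hI0 : Integrable fun w ↦ (χ w : ℂ) * Φ (z + r • w) := by simpa using hI 0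
  have hdiff : ∀ ξ : X, ‖(∫ w, (χ w : ℂ) * Φ (z + r • w)) -
      ∫ w, (χ (w - (s / r) • (ξ, (0 : X))) : ℂ) * Φ (z + r • w)‖ ≤
      2 * M * D * (s / r) * volume.real (Metric.closedBall (0 : X × X) 1) * ‖ξ‖ := by
    intro ξ
    set δ := (s / r) • (ξ, (0 : X)) with hδ
    have hδn : ‖δ‖ = s / r * ‖ξ‖ := by
      rw [hδ, norm_smul, Real.norm_of_nonneg (by positivity)]
      simp [Prod.norm_def]
    rw [← integral_sub hI0 (hI δ)]
    have h1 : ‖∫ w, ((χ w : ℂ) * Φ (z + r • w) - (χ (w - δ) : ℂ) * Φ (z + r • w))‖ ≤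
        ∫ w, M * |χ w - χ (w - δ)| := by
      refine norm_integral_le_of_norm_le ((hχi.sub (hχi.comp_sub_right δ)).abs.const_mul M)
        (Eventually.of_forall fun w ↦ ?_)
      rw [← sub_mul, norm_mul, ← Complex.ofReal_sub, Complex.norm_real, Real.norm_eq_abs, mul_comm]
      exact mul_le_mul_of_nonneg_right (hΦM _) (abs_nonneg _)
    refine h1.trans ?_
    rw [integral_const_mul]
    calc _ ≤ M * (2 * (D * ‖δ‖) * volume.real (Metric.closedBall (0 : X × X) 1)) := by
          gcongr
          exact integral_norm_sub_translate_le volume hχ hχs hχd δ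
      _ = _ := by rw [hδn]; ring
  rw [hswap, ← hγ, mul_comm, ← integral_mul_const]
  have hi2 : Integrable fun ξ : X ↦ complexGaussian ξ 0 *
      ∫ w, (χ w : ℂ) * Φ (z + r • w + s • (ξ, (0 : X))) := by
    have h1 := hprod.integral_prod_right
    refine h1.congr (Eventually.of_forall fun ξ ↦ ?_)
    simp only
    rw [← integral_const_mul]
    congr 1
    ext w
    ring
  rw [← integral_sub (hg.mul_const _) hi2, ← integral_const_mul]
  refine norm_integral_le_of_norm_le
    ((integrable_exp_neg_mul_norm_sq (X := X) (b := 1 / 2) (by norm_num)).const_mul _)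
    (Eventually.of_forall fun ξ ↦ ?_)
  rw [← mul_sub, norm_mul, hshift]
  have h1 : ‖complexGaussian ξ (0 : X)‖ * ‖ξ‖ ≤ Real.exp (-(1 / 2) * ‖ξ‖ ^ 2) := by
    rw [norm_complexGaussian]
    have h2 : ‖ξ‖ ≤ Real.exp (1 / 2 * ‖ξ‖ ^ 2) := by
      have := Real.add_one_le_exp (1 / 2 * ‖ξ‖ ^ 2)
      nlinarith [sq_nonneg (‖ξ‖ - 1)]
    calc _ ≤ Real.exp (‖(0 : X)‖ ^ 2 - ‖ξ‖ ^ 2) * Real.exp (1 / 2 * ‖ξ‖ ^ 2) := by gcongr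
      _ = _ := by
        rw [← Real.exp_add, norm_zero]
        congr 1
        ring
  calc _ ≤ ‖complexGaussian ξ (0 : X)‖ *
        (2 * M * D * (s / r) * volume.real (Metric.closedBall (0 : X × X) 1) * ‖ξ‖) := by
        gcongr
        exact hdiff ξ
    _ = 2 * M * D * (s / r) * volume.real (Metric.closedBall (0 : X × X) 1) *
        (‖complexGaussian ξ (0 : X)‖ * ‖ξ‖) := by ring
    _ ≤ _ := by gcongr

end Smoothing

section Coefficients

lemma ContDiffAt.exists_eventually_norm_le {V W : Type*} [NormedAddCommGroup V] [NormedSpace ℝ V]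
    [NormedAddCommGroup W] [NormedSpace ℝ W] {T : V → W} {z₀ : V} (hT : ContDiffAt ℝ 1 T z₀) :
    ∃ B : ℝ, 0 ≤ B ∧ ∀ᶠ z in 𝓝 z₀, ContDiffAt ℝ 1 T z ∧ ‖T z‖ ≤ B ∧ ‖fderiv ℝ T z‖ ≤ B := by
  have h1 : ∀ᶠ z in 𝓝 z₀, ‖T z‖ < ‖T z₀‖ + 1 :=
    hT.continuousAt.norm.eventually_lt continuousAt_const (lt_add_one _)
  have h2 : ∀ᶠ z in 𝓝 z₀, ‖fderiv ℝ T z‖ < ‖fderiv ℝ T z₀‖ + 1 :=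
    (hT.fderiv_right (m := 0) (by norm_num)).continuousAt.norm.eventually_lt continuousAt_const
      (lt_add_one _)
  refine ⟨max (‖T z₀‖ + 1) (‖fderiv ℝ T z₀‖ + 1), le_max_of_le_left (by positivity), ?_⟩
  filter_upwards [h1, h2, hT.eventually (by simp)] with z hz1 hz2 hz3
  exact ⟨hz3, hz1.le.trans (le_max_left _ _), hz2.le.trans (le_max_right _ _)⟩

variable {X : Type*} [NormedAddCommGroup X] [NormedSpace ℝ X] [CompleteSpace X]

/-- Near a point where `J` is the standard complex structure, the vectors `(0, v)` are combinations
of `(u, 0)` and `J (u, 0)`, with coefficients as smooth as `J`. -/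
lemma exists_tangential_coefficients {J : X × X → X × X →L[ℝ] X × X} (hJ : ContDiffAt ℝ 1 J 0)
    (hJ0 : ∀ x y : X, J 0 (x, y) = (-y, x)) :
    ∃ P Q : X × X → X →L[ℝ] X, ContDiffAt ℝ 1 P 0 ∧ ContDiffAt ℝ 1 Q 0 ∧
      ∀ᶠ z in 𝓝 (0 : X × X), ∀ v, (0, v) = J z (Q z v, 0) + (P z v, 0) := by
  set β : X × X → X →L[ℝ] X := fun z ↦
    (ContinuousLinearMap.snd ℝ X X).comp ((J z).comp (ContinuousLinearMap.inl ℝ X X)) with hβ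
  set α : X × X → X →L[ℝ] X := fun z ↦
    (ContinuousLinearMap.fst ℝ X X).comp ((J z).comp (ContinuousLinearMap.inl ℝ X X)) with hα
  have hβc : ContDiffAt ℝ 1 β 0 := contDiffAt_const.clm_comp (hJ.clm_comp contDiffAt_const)
  have hαc : ContDiffAt ℝ 1 α 0 := contDiffAt_const.clm_comp (hJ.clm_comp contDiffAt_const)
  have hβ0 : β 0 = (ContinuousLinearEquiv.refl ℝ X : X →L[ℝ] X) := by
    ext u
    simp [hβ, hJ0]
  have hQ : ContDiffAt ℝ 1 (fun z ↦ (β z).inverse) 0 := by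
    refine ContDiffAt.comp (g := ContinuousLinearMap.inverse) 0 ?_ hβc
    rw [hβ0]
    exact contDiffAt_map_inverse _
  refine ⟨fun z ↦ -(α z).comp (β z).inverse, fun z ↦ (β z).inverse, (hαc.clm_comp hQ).neg, hQ, ?_⟩
  have hinv : ∀ᶠ z in 𝓝 (0 : X × X), β z ∈ range ((↑) : (X ≃L[ℝ] X) → X →L[ℝ] X) := by
    refine hβc.continuousAt.eventually_mem ?_
    rw [hβ0]
    exact ContinuousLinearEquiv.nhds _
  filter_upwards [hinv] with z ⟨e, he⟩ v
  have h1 : β z ((β z).inverse v) = v := by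
    rw [← he]
    simp
  refine Prod.ext ?_ ?_
  · change 0 = α z ((β z).inverse v) + -(α z ((β z).inverse v))
    rw [add_neg_cancel]
  · change v = β z ((β z).inverse v) + 0
    rw [h1, add_zero]

end Coefficients

section Tube

variable {n : ℕ}

/-- The truncated positive orthant. -/
def orthantBall (n : ℕ) (r : ℝ) : Set (EuclideanSpace ℝ (Fin n)) :=
  {y | y ∈ Metric.ball 0 r ∧ ∀ j, 0 < y j}

lemma isOpen_orthantBall (n : ℕ) (r : ℝ) : IsOpen (orthantBall n r) := by
  refine Metric.isOpen_ball.inter ?_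
  have : {y : EuclideanSpace ℝ (Fin n) | ∀ j, 0 < y j} = ⋂ j, {y | 0 < y j} := by
    ext y
    simp
  change IsOpen {y : EuclideanSpace ℝ (Fin n) | ∀ j, 0 < y j}
  rw [this]
  exact isOpen_iInter_of_finite fun j ↦ isOpen_lt continuous_const (by fun_prop)

lemma convex_orthantBall (n : ℕ) (r : ℝ) : Convex ℝ (orthantBall n r) := by
  intro x hx y hy a b ha hb hab
  refine ⟨convex_ball 0 r hx.1 hy.1 ha hb hab, fun j ↦ ?_⟩
  change 0 < a * x j + b * y j
  rcases ha.eq_or_lt with h | h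
  · have : b = 1 := by linarith
    subst this
    simpa [← h] using hy.2 j
  · have := mul_pos h (hx.2 j)
    have := mul_nonneg hb (hy.2 j).le
    linarith

/-- A bounded function with bounded `∂̄` on a wedge, cut off in the directions of the edge, solves a
tube equation: on a vector `(0, v) = J (Q v, 0) + (P v, 0)` its differential is, up to a bounded
error, that of `F` on `P v` plus `i` times that on `Q v`. -/
lemma exists_isTubeSolution {r M C : ℝ} (hr : 0 < r)
    {J : EuclideanSpace ℝ (Fin n) × EuclideanSpace ℝ (Fin n) →
      EuclideanSpace ℝ (Fin n) × EuclideanSpace ℝ (Fin n) →L[ℝ]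
      EuclideanSpace ℝ (Fin n) × EuclideanSpace ℝ (Fin n)}
    (hJ : ContDiffOn ℝ 1 J (Metric.ball 0 r)) (hJ0 : ∀ x y, J 0 (x, y) = (-y, x))
    {F : EuclideanSpace ℝ (Fin n) × EuclideanSpace ℝ (Fin n) → ℂ}
    (hF : ContDiffOn ℝ 1 F {z | z ∈ Metric.ball 0 r ∧ ∀ j, 0 < z.2 j})
    (hM : ∀ z ∈ Metric.ball 0 r, (∀ j, 0 < z.2 j) → ‖F z‖ ≤ M) (hM0 : 0 ≤ M)
    (hC : ∀ z ∈ Metric.ball 0 r, (∀ j, 0 < z.2 j) → ∀ v,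
      ‖fderiv ℝ F z v + Complex.I * fderiv ℝ F z (J z v)‖ ≤ C * ‖v‖) (hC0 : 0 ≤ C) :
    ∃ r₂ B C', 0 < r₂ ∧ r₂ ≤ r ∧ ∃ P Q Ft,
      IsTubeSolution Ft (orthantBall n r₂) P Q (r₂ / 2) r₂ M B C' ∧
      ∀ x ∈ Metric.ball 0 (r₂ / 4), ∀ y, Ft (x, y) = F (x, y) := by
  obtain ⟨P, Q, hP, hQ, hPQ⟩ := exists_tangential_coefficients
    (hJ.contDiffAt (Metric.ball_mem_nhds 0 hr)) hJ0
  obtain ⟨B₁, hB₁, hPB⟩ := hP.exists_eventually_norm_le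
  obtain ⟨B₂, hB₂, hQB⟩ := hQ.exists_eventually_norm_le
  obtain ⟨r', hr', h'⟩ := Metric.eventually_nhds_iff_ball.1 (hPQ.and (hPB.and hQB))
  set r₂ := min r r' with hr₂
  have hr₂0 : 0 < r₂ := lt_min hr hr'
  have hb : ∀ z ∈ Metric.ball (0 : EuclideanSpace ℝ (Fin n) × EuclideanSpace ℝ (Fin n)) r₂,
      z ∈ Metric.ball 0 r ∧ z ∈ Metric.ball 0 r' := fun z hz ↦
    ⟨Metric.ball_subset_ball (min_le_left _ _) hz, Metric.ball_subset_ball (min_le_right _ _) hz⟩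
  have hmk : ∀ x ∈ Metric.ball (0 : EuclideanSpace ℝ (Fin n)) r₂,
      ∀ y ∈ Metric.ball (0 : EuclideanSpace ℝ (Fin n)) r₂, (x, y) ∈ Metric.ball (0 :
        EuclideanSpace ℝ (Fin n) × EuclideanSpace ℝ (Fin n)) r₂ := by
    intro x hx y hy
    rw [mem_ball_zero_iff] at hx hy ⊢
    exact max_lt hx hy
  let χ : ContDiffBump (0 : EuclideanSpace ℝ (Fin n)) := ⟨r₂ / 4, r₂ / 2, by linarith, by linarith⟩
  have hχ : ContDiff ℝ 1 χ := χ.contDiff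
  obtain ⟨K, hK⟩ : ∃ K, ∀ x, ‖fderiv ℝ χ x‖ ≤ K := by
    refine (χ.hasCompactSupport.fderiv (𝕜 := ℝ)).exists_bound_of_continuous
      (hχ.continuous_fderiv one_ne_zero)
  have hK0 : 0 ≤ K := le_trans (ContinuousLinearMap.opNorm_nonneg _) (hK 0)
  have hχ0 : ∀ x ∉ Metric.closedBall (0 : EuclideanSpace ℝ (Fin n)) (r₂ / 2), χ x = 0 := by
    intro x hx
    refine χ.zero_of_le_dist ?_
    rw [Metric.mem_closedBall, not_le] at hx
    exact hx.le
  set B := max B₁ B₂ with hB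
  have hWo : IsOpen {z : EuclideanSpace ℝ (Fin n) × EuclideanSpace ℝ (Fin n) |
      z ∈ Metric.ball 0 r ∧ ∀ j, 0 < z.2 j} := by
    have : {z : EuclideanSpace ℝ (Fin n) × EuclideanSpace ℝ (Fin n) | ∀ j, 0 < z.2 j} =
        ⋂ j, {z | 0 < z.2 j} := by
      ext y
      simp
    refine Metric.isOpen_ball.inter ?_
    change IsOpen {z : EuclideanSpace ℝ (Fin n) × EuclideanSpace ℝ (Fin n) | ∀ j, 0 < z.2 j}
    rw [this]
    exact isOpen_iInter_of_finite fun j ↦ isOpen_lt continuous_const (by fun_prop)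
  have hFd : ∀ x ∈ Metric.ball (0 : EuclideanSpace ℝ (Fin n)) r₂, ∀ y ∈ orthantBall n r₂,
      ContDiffAt ℝ 1 F (x, y) := fun x hx y hy ↦
    hF.contDiffAt (hWo.mem_nhds ⟨(hb _ (hmk x hx y hy.1)).1, hy.2⟩)
  refine ⟨r₂, B, C * B + M * K * B + M * K * B, hr₂0, min_le_left _ _, P, Q,
    fun z ↦ (χ z.1 : ℂ) * F z,
    ⟨isOpen_orthantBall n r₂, convex_orthantBall n r₂, fun y hy ↦ hy.1, by linarith, ?_, ?_, ?_,
      fun z hz ↦ (h' z (hb z hz).2).2.1.1.contDiffWithinAt,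
      fun z hz ↦ (h' z (hb z hz).2).2.2.1.contDiffWithinAt,
      fun z hz ↦ (h' z (hb z hz).2).2.1.2.1.trans (le_max_left _ _),
      fun z hz ↦ (h' z (hb z hz).2).2.2.2.1.trans (le_max_right _ _),
      fun z hz ↦ (h' z (hb z hz).2).2.1.2.2.trans (le_max_left _ _),
      fun z hz ↦ (h' z (hb z hz).2).2.2.2.2.trans (le_max_right _ _),
      hB₁.trans (le_max_left _ _), ?_, hM0, ?_⟩, ?_⟩
  · rintro ⟨x, y⟩ ⟨-, hy⟩
    by_cases hx : x ∈ Metric.ball (0 : EuclideanSpace ℝ (Fin n)) r₂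
    · refine ContDiffAt.contDiffWithinAt ?_
      exact (Complex.ofRealCLM.contDiff.contDiffAt.comp (x, y)
        (hχ.contDiffAt.comp (x, y) contDiffAt_fst)).mul (hFd x hx y hy)
    · refine ContDiffAt.contDiffWithinAt ?_
      have h1 : ∀ᶠ z : EuclideanSpace ℝ (Fin n) × EuclideanSpace ℝ (Fin n) in 𝓝 (x, y),
          (χ z.1 : ℂ) * F z = 0 := by
        have h2 : x ∈ (Metric.closedBall (0 : EuclideanSpace ℝ (Fin n)) (r₂ / 2))ᶜ := by
          rw [mem_compl_iff, Metric.mem_closedBall, not_le]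
          rw [Metric.mem_ball, not_lt] at hx
          linarith
        have h3 := continuousAt_fst.eventually_mem (x := (x, y))
          (Metric.isClosed_closedBall.isOpen_compl.mem_nhds h2)
        filter_upwards [h3] with z hz
        rw [hχ0 _ hz, Complex.ofReal_zero, zero_mul]
      exact contDiffAt_const.congr_of_eventuallyEq h1
  · intro y _ x hx
    change (χ x : ℂ) * F (x, y) = 0
    rw [hχ0 x hx, Complex.ofReal_zero, zero_mul]
  · intro x y hy
    change ‖(χ x : ℂ) * F (x, y)‖ ≤ M
    by_cases hx : x ∈ Metric.closedBall (0 : EuclideanSpace ℝ (Fin n)) (r₂ / 2)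
    · have hx' := Metric.closedBall_subset_ball (by linarith : r₂ / 2 < r₂) hx
      rw [norm_mul, Complex.norm_real, Real.norm_of_nonneg χ.nonneg]
      calc _ ≤ 1 * M := mul_le_mul χ.le_one (hM _ (hb _ (hmk x hx' y hy.1)).1 hy.2)
            (norm_nonneg _) zero_le_one
        _ = M := one_mul M
    · rw [hχ0 x hx, Complex.ofReal_zero, zero_mul, norm_zero]
      exact hM0
  · have : 0 ≤ B := hB₁.trans (le_max_left _ _)
    positivity
  · intro x hx y hy v
    have hz := hb _ (hmk x hx y hy.1)
    obtain ⟨hz1, hz2, hz3⟩ := h' _ hz.2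
    have hd := (hFd x hx y hy).differentiableAt one_ne_zero
    have h1 : HasFDerivAt (fun z : EuclideanSpace ℝ (Fin n) × EuclideanSpace ℝ (Fin n) ↦
        (χ z.1 : ℂ)) (Complex.ofRealCLM.comp ((fderiv ℝ χ x).comp
          (ContinuousLinearMap.fst ℝ _ _))) (x, y) :=
      Complex.ofRealCLM.hasFDerivAt.comp (x, y)
        (HasFDerivAt.comp (g := χ) (f := Prod.fst) (x, y)
          (hχ.differentiable one_ne_zero x).hasFDerivAt hasFDerivAt_fst)
    have h2 := (h1.mul hd.hasFDerivAt).fderiv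
    have h3 : ∀ u w, fderiv ℝ (fun z : EuclideanSpace ℝ (Fin n) × EuclideanSpace ℝ (Fin n) ↦
        (χ z.1 : ℂ) * F z) (x, y) (u, w) =
        (χ x : ℂ) * fderiv ℝ F (x, y) (u, w) + F (x, y) * (fderiv ℝ χ x u : ℝ) := by
      intro u w
      change fderiv ℝ (fun z : EuclideanSpace ℝ (Fin n) × EuclideanSpace ℝ (Fin n) ↦
        (χ z.1 : ℂ) * F z) (x, y) = _ at h2
      rw [h2]
      rfl
    rw [h3, h3, h3, map_zero, Complex.ofReal_zero, mul_zero, add_zero]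
    have h4 : fderiv ℝ F (x, y) (0, v) = fderiv ℝ F (x, y) (J (x, y) (Q (x, y) v, 0)) +
        fderiv ℝ F (x, y) (P (x, y) v, 0) := by
      rw [← map_add, ← hz1 v]
    have hF1 : ‖F (x, y)‖ ≤ M := hM _ hz.1 hy.2
    have hQv : ‖Q (x, y) v‖ ≤ B * ‖v‖ :=
      ((Q (x, y)).le_opNorm v).trans (by gcongr; exact hz3.2.1.trans (le_max_right _ _))
    have hPv : ‖P (x, y) v‖ ≤ B * ‖v‖ :=
      ((P (x, y)).le_opNorm v).trans (by gcongr; exact hz2.2.1.trans (le_max_left _ _))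
    have h5 : ‖fderiv ℝ F (x, y) (Q (x, y) v, 0) +
        Complex.I * fderiv ℝ F (x, y) (J (x, y) (Q (x, y) v, 0))‖ ≤ C * (B * ‖v‖) := by
      refine (hC _ hz.1 hy.2 _).trans ?_
      gcongr
      rw [Prod.norm_def]
      simpa using hQv
    have h6 : ∀ u, ‖F (x, y) * (fderiv ℝ χ x u : ℝ)‖ ≤ M * (K * ‖u‖) := by
      intro u
      rw [norm_mul, Complex.norm_real]
      refine mul_le_mul hF1 (((fderiv ℝ χ x).le_opNorm u).trans ?_) (norm_nonneg _) hM0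
      gcongr
      exact hK x
    have h7 : (χ x : ℂ) * fderiv ℝ F (x, y) (0, v) -
        ((χ x : ℂ) * fderiv ℝ F (x, y) (P (x, y) v, 0) + F (x, y) * (fderiv ℝ χ x (P (x, y) v) : ℝ))
        - Complex.I * ((χ x : ℂ) * fderiv ℝ F (x, y) (Q (x, y) v, 0) +
          F (x, y) * (fderiv ℝ χ x (Q (x, y) v) : ℝ)) =
        -(Complex.I * (χ x : ℂ) * (fderiv ℝ F (x, y) (Q (x, y) v, 0) +
          Complex.I * fderiv ℝ F (x, y) (J (x, y) (Q (x, y) v, 0)))) -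
        F (x, y) * (fderiv ℝ χ x (P (x, y) v) : ℝ) -
        Complex.I * (F (x, y) * (fderiv ℝ χ x (Q (x, y) v) : ℝ)) := by
      rw [h4]
      linear_combination ((χ x : ℂ) * fderiv ℝ F (x, y) (J (x, y) (Q (x, y) v, 0))) *
        Complex.I_mul_I
    rw [h7]
    refine (norm_sub_le _ _).trans ((add_le_add_left (norm_sub_le _ _) _).trans ?_)
    rw [norm_neg, norm_mul, norm_mul, norm_mul Complex.I (F (x, y) * _), Complex.norm_I, one_mul,
      one_mul, Complex.norm_real, Real.norm_of_nonneg χ.nonneg]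
    have h8 : χ x * ‖fderiv ℝ F (x, y) (Q (x, y) v, 0) +
        Complex.I * fderiv ℝ F (x, y) (J (x, y) (Q (x, y) v, 0))‖ ≤ 1 * (C * (B * ‖v‖)) :=
      mul_le_mul χ.le_one h5 (norm_nonneg _) zero_le_one
    have h9 : M * (K * ‖P (x, y) v‖) ≤ M * (K * (B * ‖v‖)) := by gcongr
    have h10 : M * (K * ‖Q (x, y) v‖) ≤ M * (K * (B * ‖v‖)) := by gcongr
    linarith [h6 (P (x, y) v), h6 (Q (x, y) v)]
  · intro x hx y
    change (χ x : ℂ) * F (x, y) = F (x, y)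
    have h1 : χ x = 1 := χ.one_of_mem_closedBall (Metric.ball_subset_closedBall hx)
    rw [h1, Complex.ofReal_one, one_mul]

end Tube

section Combination

/-- A limit criterion with two auxiliary small parameters `κ` and `ε`. -/
lemma tendsto_nhdsWithin_of_forall_exists_norm_sub_mul_le {E : Type*} [SeminormedAddCommGroup E]
    {f : E → ℂ} {S : Set E} {a : E} {L : ℂ} {q K N v : ℝ} (hq : 0 < q) (hK : 0 ≤ K) (hN : 0 ≤ N)
    (hv : 0 ≤ v) (h : ∀ κ > 0, ∀ ε > 0, ∃ d₀ > 0, ∀ z ∈ S, ‖z - a‖ < d₀ →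
      ‖f z - L‖ * q ≤ K * ‖z - a‖ + N * κ + ε * v) :
    Tendsto f (𝓝[S] a) (𝓝 L) := by
  rw [Metric.tendsto_nhdsWithin_nhds]
  intro η hη
  have hηq : 0 < η * q := mul_pos hη hq
  have hb : ∀ x : ℝ, 0 ≤ x → x * (η * q / (4 * (x + 1))) ≤ η * q / 4 := by
    intro x hx
    have : x * (η * q / (4 * (x + 1))) = η * q / 4 * (x / (x + 1)) := by field_simp
    rw [this]
    refine mul_le_of_le_one_right (by positivity) ?_
    rw [div_le_one (by positivity)]
    linarith
  obtain ⟨d₀, hd₀, h⟩ := h (η * q / (4 * (N + 1))) (by positivity) (η * q / (4 * (v + 1)))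
    (by positivity)
  refine ⟨min d₀ (η * q / (4 * (K + 1))), by positivity, fun z hz hzd ↦ ?_⟩
  rw [dist_eq_norm] at hzd ⊢
  have h1 := h z hz (hzd.trans_le (min_le_left _ _))
  have h2 : K * ‖z - a‖ ≤ η * q / 4 :=
    (mul_le_mul_of_nonneg_left (hzd.trans_le (min_le_right _ _)).le hK).trans (hb K hK)
  have h3 := hb N hN
  have h4 := hb v hv
  have h5 : ‖f z - L‖ * q < η * q := by linarith
  exact lt_of_mul_lt_mul_right h5 hq.le

variable {X : Type*} [NormedAddCommGroup X] [InnerProductSpace ℝ X] [FiniteDimensional ℝ X]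
  [MeasurableSpace X] [BorelSpace X]

lemma norm_integral_ofReal_mul_sub_le {V : Type*} [NormedAddCommGroup V] [NormedSpace ℝ V]
    [FiniteDimensional ℝ V] [MeasurableSpace V] [BorelSpace V] (μ : Measure V)
    [IsFiniteMeasureOnCompacts μ] {χ : V → ℝ} {g : V → ℂ} {a : ℂ} {ε : ℝ} (hχ : Continuous χ)
    (hχs : tsupport χ ⊆ Metric.closedBall 0 1) (hχ1 : ∀ w, |χ w| ≤ 1)
    (hg : AEStronglyMeasurable g μ) (hga : ∀ w ∈ Metric.closedBall 0 1, ‖g w - a‖ ≤ ε) :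
    ‖(∫ w, (χ w : ℂ) * g w ∂μ) - (∫ w, χ w ∂μ : ℝ) * a‖ ≤
      ε * μ.real (Metric.closedBall 0 1) := by
  have hχ0 : ∀ w ∉ Metric.closedBall (0 : V) 1, χ w = 0 := fun w hw ↦
    image_eq_zero_of_notMem_tsupport fun h ↦ hw (hχs h)
  have hm : MeasurableSet (Metric.closedBall (0 : V) 1) := Metric.isClosed_closedBall.measurableSet
  have hχi : Integrable χ μ := hχ.integrable_of_hasCompactSupport
    ((isCompact_closedBall (0 : V) 1).of_isClosed_subset (isClosed_tsupport χ) hχs)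
  have hε : 0 ≤ ε := (norm_nonneg _).trans (hga 0 (Metric.mem_closedBall_self zero_le_one))
  have hle : ∀ w, ‖(χ w : ℂ) * (g w - a)‖ ≤
      (Metric.closedBall (0 : V) 1).indicator (fun _ ↦ ε) w := by
    intro w
    by_cases hw : w ∈ Metric.closedBall (0 : V) 1
    · rw [indicator_of_mem hw, norm_mul, Complex.norm_real]
      calc _ ≤ 1 * ε := mul_le_mul (hχ1 w) (hga w hw) (norm_nonneg _) zero_le_one
        _ = ε := one_mul ε
    · rw [indicator_of_notMem hw, hχ0 w hw, Complex.ofReal_zero, zero_mul, norm_zero]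
  have hbi : Integrable ((Metric.closedBall (0 : V) 1).indicator fun _ ↦ ε) μ :=
    (integrable_indicator_iff hm).2
      (integrableOn_const (isCompact_closedBall (0 : V) 1).measure_lt_top.ne)
  have hi : Integrable (fun w ↦ (χ w : ℂ) * (g w - a)) μ :=
    hbi.mono' ((Complex.continuous_ofReal.comp hχ).aestronglyMeasurable.mul
      (hg.sub aestronglyMeasurable_const)) (Eventually.of_forall hle)
  have hia : Integrable (fun w ↦ (χ w : ℂ) * a) μ := hχi.ofReal.mul_const a
  have h1 : ∫ w, (χ w : ℂ) * g w ∂μ = (∫ w, (χ w : ℂ) * (g w - a) ∂μ) + ∫ w, (χ w : ℂ) * a ∂μ := by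
    rw [← integral_add hi hia]
    congr 1
    ext w
    ring
  have h2 : ∫ w, (χ w : ℂ) * a ∂μ = (∫ w, χ w ∂μ : ℝ) * a := by
    rw [integral_mul_const, integral_complex_ofReal]
  rw [h1, h2, add_sub_cancel_right]
  refine (norm_integral_le_of_norm_le hbi (Eventually.of_forall hle)).trans_eq ?_
  rw [integral_indicator hm, setIntegral_const, smul_eq_mul, mul_comm]

/-- A measurable bounded extension of `F`, so that its averages may be smoothed without regard to
the domain of `F`. -/
lemma IsTubeSolution.exists_stronglyMeasurable_extension {F : X × X → ℂ} {O : Set X}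
    {P Q : X × X → X →L[ℝ] X} {r₁ r₂ M B C : ℝ} (h : IsTubeSolution F O P Q r₁ r₂ M B C) :
    ∃ Φ : X × X → ℂ, StronglyMeasurable Φ ∧ (∀ w, ‖Φ w‖ ≤ M) ∧
      ∀ x, ∀ y ∈ O, Φ (x, y) = F (x, y) := by
  classical
  refine ⟨(univ ×ˢ O).indicator F, ?_, fun w ↦ ?_, fun x y hy ↦ indicator_of_mem (by simpa) _⟩
  · refine Measurable.stronglyMeasurable ?_
    rw [← piecewise_eq_indicator]
    exact h.contDiffOn.continuousOn.measurable_piecewise continuousOn_const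
      (isOpen_univ.prod h.isOpen).measurableSet
  · by_cases hw : w ∈ (univ : Set X) ×ˢ O
    · rw [indicator_of_mem hw]
      exact h.norm_le w.1 w.2 hw.2
    · rw [indicator_of_notMem hw, norm_zero]
      exact h.M_nonneg

/-- If the Gaussian averages of `F` at scale `s` about the points of a ball are close to `L`, then
`F` is close to `L` at the centre, provided that `F` is close there to its average over the ball:
this average changes little under the Gaussian smoothing. -/
lemma norm_sub_mul_le_of_gaussian {z : X × X} {r R s M D b ε : ℝ}
    {F Φ : X × X → ℂ} {χ : X × X → ℝ} {L : ℂ}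
    (hχ : ContDiff ℝ 1 χ) (hχs : tsupport χ ⊆ Metric.closedBall 0 1) (hχ1 : ∀ w, |χ w| ≤ 1)
    (hχd : ∀ w, ‖fderiv ℝ χ w‖ ≤ D)
    (hb : ‖F z * (∫ w, χ w : ℝ) - ∫ w, (χ w : ℂ) * F (z + r • w)‖ ≤ b)
    (hr : 0 < r) (hrR : r < R) (hs : 0 ≤ s) (hΦ : StronglyMeasurable Φ) (hΦM : ∀ w, ‖Φ w‖ ≤ M)
    (hΦF : ∀ w ∈ Metric.ball z R, Φ w = F w)
    (hL : ∀ w ∈ Metric.ball z R, ‖(∫ ξ : X, Φ (w + s • (ξ, (0 : X))) * complexGaussian ξ 0) -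
      L * (Real.pi : ℂ) ^ (Module.finrank ℝ X / 2 : ℂ)‖ ≤ ε) :
    ‖F z - L‖ * ((∫ w, χ w) * ‖(Real.pi : ℂ) ^ (Module.finrank ℝ X / 2 : ℂ)‖) ≤
      b * ‖(Real.pi : ℂ) ^ (Module.finrank ℝ X / 2 : ℂ)‖ +
      2 * M * D * (s / r) * volume.real (Metric.closedBall (0 : X × X) 1) *
        (∫ ξ : X, Real.exp (-(1 / 2) * ‖ξ‖ ^ 2)) +
      ε * volume.real (Metric.closedBall (0 : X × X) 1) := by
  have := isAddHaarMeasure_volume_prod (X := X)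
  set p : ℂ := (Real.pi : ℂ) ^ (Module.finrank ℝ X / 2 : ℂ) with hp
  have hmem : ∀ w ∈ Metric.closedBall (0 : X × X) 1, z + r • w ∈ Metric.ball z R := by
    intro w hw
    rw [mem_closedBall_zero_iff] at hw
    rw [mem_ball_iff_norm, add_sub_cancel_left, norm_smul, Real.norm_of_nonneg hr.le]
    nlinarith
  have hI : ∫ w, (χ w : ℂ) * F (z + r • w) = ∫ w, (χ w : ℂ) * Φ (z + r • w) := by
    congr 1
    ext w
    by_cases hw : w ∈ Metric.closedBall (0 : X × X) 1
    · rw [hΦF _ (hmem w hw)]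
    · have : χ w = 0 := image_eq_zero_of_notMem_tsupport fun h ↦ hw (hχs h)
      rw [this, Complex.ofReal_zero, zero_mul, zero_mul]
  rw [hI] at hb
  have h2 := norm_integral_mul_sub_integral_gaussian_le hΦ hΦM hχ hχs hχd hr hs z
  have hms : StronglyMeasurable fun w : X × X ↦
      ∫ ξ : X, Φ (z + r • w + s • (ξ, (0 : X))) * complexGaussian ξ 0 := by
    refine StronglyMeasurable.integral_prod_right' (ν := (volume : Measure X))
      (f := fun q : (X × X) × X ↦ Φ (z + r • q.1 + s • (q.2, (0 : X))) * complexGaussian q.2 0) ?_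
    refine StronglyMeasurable.mul (hΦ.comp_measurable (Continuous.measurable (by fun_prop))) ?_
    have hc : Continuous fun ξ : X ↦ complexGaussian ξ 0 := by
      simpa using continuous_complexGaussian_comp (0 : X) 0 0 1
    exact (hc.comp continuous_snd).stronglyMeasurable
  have h3 := norm_integral_ofReal_mul_sub_le (volume : Measure (X × X)) hχ.continuous hχs hχ1
    hms.aestronglyMeasurable (fun w hw ↦ hL _ (hmem w hw))
  set A := ∫ w, (χ w : ℂ) * Φ (z + r • w)
  set A' := ∫ w, (χ w : ℂ) * ∫ ξ : X, Φ (z + r • w + s • (ξ, (0 : X))) * complexGaussian ξ 0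
  set m := ∫ w, χ w with hm
  have h4 : (F z - L) * (m * p) = (F z * m - A) * p + (A * p - A') + (A' - m * (L * p)) := by ring
  have h5 : ‖F z - L‖ * (m * ‖p‖) ≤ ‖(F z - L) * (m * p)‖ := by
    rw [norm_mul, norm_mul, Complex.norm_real]
    gcongr
    exact le_abs_self m
  refine h5.trans ?_
  rw [h4]
  refine (norm_add_le _ _).trans (add_le_add ((norm_add_le _ _).trans (add_le_add ?_ h2)) h3)
  rw [norm_mul]
  gcongr

end Combination

section Limit

variable {n : ℕ}

/-- Existence of non-tangential limits when the edge is `ℝⁿ × {0}`, the wedge is given by the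
positive orthant, and the almost complex structure is standard at the origin. -/
theorem ae_exists_tendsto_orthant (hn : 0 < n) {r M C : ℝ} (hr : 0 < r)
    {J : EuclideanSpace ℝ (Fin n) × EuclideanSpace ℝ (Fin n) →
      EuclideanSpace ℝ (Fin n) × EuclideanSpace ℝ (Fin n) →L[ℝ]
      EuclideanSpace ℝ (Fin n) × EuclideanSpace ℝ (Fin n)}
    (hJ : ContDiffOn ℝ 1 J (Metric.ball 0 r))
    (hJ2 : ∀ z ∈ Metric.ball 0 r, ∀ v, J z (J z v) = -v) (hJ0 : ∀ x y, J 0 (x, y) = (-y, x))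
    {F : EuclideanSpace ℝ (Fin n) × EuclideanSpace ℝ (Fin n) → ℂ}
    (hF : ContDiffOn ℝ 1 F {z | z ∈ Metric.ball 0 r ∧ ∀ j, 0 < z.2 j})
    (hM : ∀ z ∈ Metric.ball 0 r, (∀ j, 0 < z.2 j) → ‖F z‖ ≤ M)
    (hC : ∀ z ∈ Metric.ball 0 r, (∀ j, 0 < z.2 j) → ∀ v,
      ‖fderiv ℝ F z v + Complex.I * fderiv ℝ F z (J z v)‖ ≤ C * ‖v‖) :
    ∃ r' > 0, ∀ᵐ x₀ : EuclideanSpace ℝ (Fin n), x₀ ∈ Metric.ball 0 r' → ∃ L : ℂ, ∀ c > 0,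
      Tendsto F (𝓝[{z | ∀ j, 0 < z.2 j ∧ c * ‖z - (x₀, 0)‖ ≤ z.2 j}] (x₀, 0)) (𝓝 L) := by
  set M' := max M 0 with hM'
  set C' := max C 0 with hC'
  have hM0 : 0 ≤ M' := le_max_right _ _
  have hC0 : 0 ≤ C' := le_max_right _ _
  replace hM : ∀ z ∈ Metric.ball 0 r, (∀ j, 0 < z.2 j) → ‖F z‖ ≤ M' :=
    fun z hz hz' ↦ (hM z hz hz').trans (le_max_left _ _)
  replace hC : ∀ z ∈ Metric.ball 0 r, (∀ j, 0 < z.2 j) → ∀ v,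
      ‖fderiv ℝ F z v + Complex.I * fderiv ℝ F z (J z v)‖ ≤ C' * ‖v‖ :=
    fun z hz hz' v ↦ (hC z hz hz' v).trans (by gcongr; exact le_max_left _ _)
  clear_value M' C'
  have := isAddHaarMeasure_volume_prod (X := EuclideanSpace ℝ (Fin n))
  obtain ⟨BJ, hBJ, hJB⟩ := (hJ.contDiffAt (Metric.ball_mem_nhds 0 hr)).exists_eventually_norm_le
  obtain ⟨r₃, hr₃, hJB⟩ := Metric.eventually_nhds_iff_ball.1 hJB
  obtain ⟨r₂, B, C₂, hr₂, hr₂r, P, Q, Ft, hT, hFt⟩ :=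
    exists_isTubeSolution hr hJ hJ0 hF hM hM0 hC hC0
  obtain ⟨D, m, hm, hχ⟩ := exists_invariant_weight
    (volume : Measure (EuclideanSpace ℝ (Fin n) × EuclideanSpace ℝ (Fin n))) hBJ
  have hD : 0 ≤ D := by
    obtain ⟨χ, -, -, -, h, -⟩ := hχ (J 0) (hJB 0 (Metric.mem_ball_self hr₃)).2.1
      (hJ2 0 (Metric.mem_ball_self hr))
    exact le_trans (ContinuousLinearMap.opNorm_nonneg _) (h 0)
  obtain ⟨Φ, hΦs, hΦM, hΦO⟩ := hT.exists_stronglyMeasurable_extension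
  set ρ := min (r₂ / 4) r₃ with hρ
  have hρ0 : 0 < ρ := lt_min (by linarith) hr₃
  have hρr₂ : ρ ≤ r₂ / 4 := min_le_left _ _
  have hρr₃ : ρ ≤ r₃ := min_le_right _ _
  clear_value ρ
  have he : ∀ᶠ ε in 𝓝[>] (0 : ℝ), ε • (WithLp.toLp 2 fun _ ↦ 1 : EuclideanSpace ℝ (Fin n)) ∈
      orthantBall n r₂ := by
    have h1 : Tendsto (fun ε : ℝ ↦ ε • (WithLp.toLp 2 fun _ ↦ 1 : EuclideanSpace ℝ (Fin n)))
        (𝓝[>] 0) (𝓝 0) := by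
      refine Tendsto.mono_left ?_ nhdsWithin_le_nhds
      have : Continuous fun ε : ℝ ↦ ε • (WithLp.toLp 2 fun _ ↦ 1 : EuclideanSpace ℝ (Fin n)) := by
        fun_prop
      simpa using this.tendsto 0
    filter_upwards [h1.eventually_mem (Metric.ball_mem_nhds 0 hr₂), self_mem_nhdsWithin]
      with ε hε hε0
    refine ⟨hε, fun j ↦ ?_⟩
    simpa using hε0
  refine ⟨ρ / 2, by positivity, ?_⟩
  filter_upwards [hT.ae_exists_gaussian_limit he] with x₀ hx₀ hx₀ρ
  rw [mem_ball_zero_iff] at hx₀ρ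
  obtain ⟨L, hL⟩ := hx₀ (by rw [mem_ball_zero_iff]; linarith)
  refine ⟨L, ?_⟩
  -- It suffices to treat apertures `c ≤ 1`, the regions being decreasing in `c`.
  suffices h : ∀ c > 0, c ≤ 1 →
      Tendsto F (𝓝[{z | ∀ j, 0 < z.2 j ∧ c * ‖z - (x₀, 0)‖ ≤ z.2 j}] (x₀, 0)) (𝓝 L) by
    intro c hc
    refine (h (min c 1) (lt_min hc one_pos) (min_le_right _ _)).mono_left (nhdsWithin_mono _ ?_)
    intro z hz j
    exact ⟨(hz j).1, le_trans (by gcongr; exact min_le_left _ _) (hz j).2⟩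
  intro c hc hc1
  set p : ℝ := ‖(Real.pi : ℂ) ^ (Module.finrank ℝ (EuclideanSpace ℝ (Fin n)) / 2 : ℂ)‖ with hp
  have hp0 : 0 < p := by
    rw [hp, norm_pos_iff]
    exact Complex.cpow_ne_zero_iff.2 (Or.inl (by exact_mod_cast Real.pi_pos.ne'))
  set v : ℝ := volume.real
    (Metric.closedBall (0 : EuclideanSpace ℝ (Fin n) × EuclideanSpace ℝ (Fin n)) 1) with hv
  have hv0 : 0 ≤ v := measureReal_nonneg
  set G : ℝ := ∫ ξ : EuclideanSpace ℝ (Fin n), Real.exp (-(1 / 2) * ‖ξ‖ ^ 2) with hG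
  have hG0 : 0 ≤ G := integral_nonneg fun ξ ↦ (Real.exp_pos _).le
  set C₁ : ℝ := (C' + M' * (D * BJ + ‖traceCLM (EuclideanSpace ℝ (Fin n) ×
    EuclideanSpace ℝ (Fin n))‖ * BJ)) * v with hC₁
  have hC₁0 : 0 ≤ C₁ := by positivity
  -- The estimate at a point at distance `d` from the vertex, for the averages at scale `c * d / 2`
  -- and the Gaussian smoothing at scale `κ * d`.
  have key : ∀ κ > 0, ∀ ε > 0, ∃ d₀ > 0, ∀ z : EuclideanSpace ℝ (Fin n) × EuclideanSpace ℝ (Fin n),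
      (∀ j, 0 < z.2 j ∧ c * ‖z - (x₀, 0)‖ ≤ z.2 j) → ‖z - (x₀, 0)‖ < d₀ →
      ‖F z - L‖ * (m * p) ≤
        C₁ * p * ‖z - (x₀, 0)‖ + 4 * M' * D * (κ / c) * v * G + ε * v := by
    intro κ hκ ε hε
    obtain ⟨t₀, ht₀, hL⟩ := hL 2 κ (by norm_num) hκ ε hε
    refine ⟨min t₀ (ρ / 4), lt_min ht₀ (by positivity), fun z hz hzd ↦ ?_⟩
    set d := ‖z - (x₀, 0)‖ with hd
    have hdt : d < t₀ := hzd.trans_le (min_le_left _ _)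
    have hdρ : d < ρ / 4 := hzd.trans_le (min_le_right _ _)
    have hd0 : 0 < d := by
      rw [hd, norm_pos_iff]
      intro h
      have h1 : z = (x₀, 0) := sub_eq_zero.1 h
      have h2 := (hz ⟨0, hn⟩).1
      rw [h1] at h2
      exact lt_irrefl _ h2
    clear_value d
    have hcd : c * d ≤ d := by nlinarith
    -- Points of the ball of radius `c * d` about `z`.
    have hball : ∀ w ∈ Metric.ball z (c * d), ‖w - (x₀, 0)‖ ≤ 2 * d ∧ w ∈ Metric.ball 0 ρ ∧
        (∀ j, 0 < w.2 j) := by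
      intro w hw
      rw [mem_ball_iff_norm] at hw
      have h1 : ‖w - (x₀, 0)‖ ≤ 2 * d := by
        calc _ = ‖(w - z) + (z - (x₀, 0))‖ := by rw [sub_add_sub_cancel]
          _ ≤ _ := (norm_add_le _ _).trans (by linarith)
      refine ⟨h1, ?_, fun j ↦ ?_⟩
      · rw [mem_ball_zero_iff]
        have h2 : ‖((x₀, 0) : EuclideanSpace ℝ (Fin n) × EuclideanSpace ℝ (Fin n))‖ = ‖x₀‖ := by
          simp [Prod.norm_def]
        calc ‖w‖ = ‖(w - (x₀, 0)) + (x₀, 0)‖ := by rw [sub_add_cancel]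
          _ ≤ _ := norm_add_le _ _
          _ < ρ := by rw [h2]; linarith
      · have h2 : |w.2 j - z.2 j| < c * d := by
          calc |w.2 j - z.2 j| = ‖(w - z).2 j‖ := rfl
            _ ≤ ‖(w - z).2‖ := PiLp.norm_apply_le _ _
            _ ≤ ‖w - z‖ := norm_snd_le _
            _ < _ := hw
        have h3 := (hz j).2
        have h4 := abs_lt.1 h2
        linarith [h4.1]
    have hρr : ∀ w ∈ Metric.ball (0 : EuclideanSpace ℝ (Fin n) × EuclideanSpace ℝ (Fin n)) ρ,
        w ∈ Metric.ball 0 r := fun w hw ↦ Metric.ball_subset_ball (by linarith) hw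
    have hρr' : ∀ w ∈ Metric.ball (0 : EuclideanSpace ℝ (Fin n) × EuclideanSpace ℝ (Fin n)) ρ,
        w ∈ Metric.ball 0 r₃ := fun w hw ↦ Metric.ball_subset_ball hρr₃ hw
    have hzm := hball z (Metric.mem_ball_self (by positivity))
    obtain ⟨χ, hχ1, hχs, hχb, hχd, hχJ, hχm⟩ := hχ (J z) (hJB z (hρr' z hzm.2.1)).2.1
      (hJ2 z (hρr z hzm.2.1))
    have hO : ∀ w ∈ Metric.ball z (c * d),
        w.2 ∈ orthantBall n r₂ ∧ w.1 ∈ Metric.ball 0 (r₂ / 4) := by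
      intro w hw
      have h2 := (hball w hw).2.1
      rw [mem_ball_zero_iff] at h2
      refine ⟨⟨?_, (hball w hw).2.2⟩, ?_⟩
      · rw [mem_ball_zero_iff]
        linarith [norm_snd_le w]
      · rw [mem_ball_zero_iff]
        linarith [norm_fst_le w]
    have hgauss : ∀ w ∈ Metric.ball z (c * d),
        ‖(∫ ξ : EuclideanSpace ℝ (Fin n), Φ (w + (κ * d) • (ξ, (0 : EuclideanSpace ℝ (Fin n)))) *
          complexGaussian ξ 0) - L * (Real.pi : ℂ) ^
          (Module.finrank ℝ (EuclideanSpace ℝ (Fin n)) / 2 : ℂ)‖ ≤ ε := by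
      intro w hw
      have h2 := (hball w hw).1
      have h3 := hL d hd0 hdt w.1 ((norm_fst_le (w - (x₀, 0))).trans h2) w.2 (hO w hw).1
        (by simpa using (norm_snd_le (w - (x₀, 0))).trans h2)
      refine le_trans (le_of_eq ?_) h3
      congr 3
      ext ξ
      have h4 : w + (κ * d) • (ξ, (0 : EuclideanSpace ℝ (Fin n))) = (w.1 + (κ * d) • ξ, w.2) := by
        refine Prod.ext rfl ?_
        simp
      rw [h4, hΦO _ _ (hO w hw).1]
    have h0 := norm_mul_integral_sub_integral_le volume
      (fun w hw ↦ (hJB w (hρr' w (hball w hw).2.1)).1.contDiffWithinAt)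
      (fun w hw ↦ (hJB w (hρr' w (hball w hw).2.1)).2.2)
      (fun w hw ↦ hJ2 w (hρr w (hball w hw).2.1))
      (hF.mono fun w hw ↦ ⟨hρr w (hball w hw).2.1, (hball w hw).2.2⟩)
      (fun w hw ↦ hM w (hρr w (hball w hw).2.1) (hball w hw).2.2)
      (fun w hw ↦ hC w (hρr w (hball w hw).2.1) (hball w hw).2.2) hC0 hχ1 hχs hχb hχd hχJ
      (r := c * d / 2) (by positivity) (by linarith [mul_pos hc hd0])
    have h1 := norm_sub_mul_le_of_gaussian (z := z) (r := c * d / 2) (R := c * d) (s := κ * d)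
      hχ1 hχs hχb hχd h0 (by positivity) (by linarith [mul_pos hc hd0]) (by positivity) hΦs hΦM
      (fun w hw ↦ by rw [← hFt _ (hO w hw).2, ← hΦO _ _ (hO w hw).1]) hgauss
    calc ‖F z - L‖ * (m * p) ≤ ‖F z - L‖ * ((∫ w, χ w) * p) := by gcongr
      _ ≤ C₁ * (c * d / 2) * p + 2 * M' * D * (κ * d / (c * d / 2)) * v * G + ε * v := h1
      _ ≤ _ := by
        have h2 : κ * d / (c * d / 2) = 2 * (κ / c) := by field_simp
        have h3 : C₁ * (c * d / 2) * p ≤ C₁ * d * p := by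
          gcongr
          linarith
        rw [h2]
        linarith
  refine tendsto_nhdsWithin_of_forall_exists_norm_sub_mul_le (q := m * p) (K := C₁ * p)
    (N := 4 * M' * D * v * G / c) (v := v) (by positivity) (by positivity) (by positivity) hv0
    fun κ hκ ε hε ↦ ?_
  obtain ⟨d₀, hd₀, h⟩ := key κ hκ ε hε
  exact ⟨d₀, hd₀, fun z hz hzd ↦ (h z hz hzd).trans_eq (by ring)⟩

end Limit

/-! ### Local coordinates -/

section Coordinates

variable {n : ℕ} {M : Type*} [TopologicalSpace M]
    [ChartedSpace (ModelR n) M] [IsManifold 𝓘(ℝ, ModelR n) ∞ M]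

/-- The coordinates of tangent vectors with respect to the chart at `p₀`. -/
abbrev tangentCoord (p₀ p : M) : TangentSpace 𝓘(ℝ, ModelR n) p →L[ℝ] ModelR n :=
  (trivializationAt (ModelR n) (TangentSpace 𝓘(ℝ, ModelR n)) p₀).continuousLinearMapAt ℝ p

/-- The tangent vector with given coordinates with respect to the chart at `p₀`. -/
abbrev tangentOfCoord (p₀ p : M) : ModelR n →L[ℝ] TangentSpace 𝓘(ℝ, ModelR n) p :=
  (trivializationAt (ModelR n) (TangentSpace 𝓘(ℝ, ModelR n)) p₀).symmL ℝ p

lemma mem_baseSet_of_mem_source {p₀ p : M} (hp : p ∈ (chartAt (ModelR n) p₀).source) :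
    p ∈ (trivializationAt (ModelR n) (TangentSpace 𝓘(ℝ, ModelR n)) p₀).baseSet := by
  simpa using hp

lemma tangentCoord_tangentOfCoord {p₀ p : M} (hp : p ∈ (chartAt (ModelR n) p₀).source)
    (v : ModelR n) : tangentCoord p₀ p (tangentOfCoord p₀ p v) = v :=
  Bundle.Trivialization.continuousLinearMapAt_symmL _ (mem_baseSet_of_mem_source hp) v

lemma tangentOfCoord_tangentCoord {p₀ p : M} (hp : p ∈ (chartAt (ModelR n) p₀).source)
    (v : TangentSpace 𝓘(ℝ, ModelR n) p) : tangentOfCoord p₀ p (tangentCoord p₀ p v) = v :=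
  Bundle.Trivialization.symmL_continuousLinearMapAt _ (mem_baseSet_of_mem_source hp) v

/-- The differential of a function on `M`, computed in the chart at `p₀`. -/
lemma mfderiv_eq_fderiv_comp_tangentCoord {E : Type*} [NormedAddCommGroup E] [NormedSpace ℝ E]
    {f : M → E} {p₀ p : M} (hp : p ∈ (chartAt (ModelR n) p₀).source)
    (hf : MDifferentiableAt 𝓘(ℝ, ModelR n) 𝓘(ℝ, E) f p) (v : TangentSpace 𝓘(ℝ, ModelR n) p) :
    mfderiv 𝓘(ℝ, ModelR n) 𝓘(ℝ, E) f p v =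
      fderiv ℝ (f ∘ (chartAt (ModelR n) p₀).symm) (chartAt (ModelR n) p₀ p)
        (tangentCoord p₀ p v) := by
  set φ := chartAt (ModelR n) p₀ with hφ
  have hφm : MDifferentiableAt 𝓘(ℝ, ModelR n) 𝓘(ℝ, ModelR n) φ p :=
    mdifferentiableAt_atlas (chart_mem_atlas _ p₀) hp
  have hφs : MDifferentiableAt 𝓘(ℝ, ModelR n) 𝓘(ℝ, ModelR n) φ.symm (φ p) :=
    mdifferentiableAt_atlas_symm (chart_mem_atlas _ p₀) (φ.map_source hp)
  have hf' : MDifferentiableAt 𝓘(ℝ, ModelR n) 𝓘(ℝ, E) (f ∘ φ.symm) (φ p) := by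
    refine MDifferentiableAt.comp (φ p) ?_ hφs
    rwa [φ.left_inv hp]
  have hev : f =ᶠ[𝓝 p] (f ∘ φ.symm) ∘ φ := by
    filter_upwards [φ.open_source.mem_nhds hp] with q hq
    simp [φ.left_inv hq]
  have h1 : tangentCoord p₀ p = mfderiv 𝓘(ℝ, ModelR n) 𝓘(ℝ, ModelR n) φ p := by
    have := TangentBundle.continuousLinearMapAt_trivializationAt (I := 𝓘(ℝ, ModelR n)) hp
    simpa using this
  rw [hev.mfderiv_eq, mfderiv_comp p hf' hφm, mfderiv_eq_fderiv, h1]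
  rfl

/-- The matrix of `J` in the chart at `p₀` is smooth at `p₀`. -/
lemma contDiffAt_coordinates (𝒥 : AlmostComplexStructure n M) (p₀ : M) :
    ContDiffAt ℝ ∞ (fun z : ModelR n ↦
      (tangentCoord p₀ ((chartAt (ModelR n) p₀).symm z)).comp
        ((𝒥.J ((chartAt (ModelR n) p₀).symm z)).comp
          (tangentOfCoord p₀ ((chartAt (ModelR n) p₀).symm z)))) (chartAt (ModelR n) p₀ p₀) := by
  have h1 := (contMDiffAt_hom_bundle _).1 (𝒥.contMDiff p₀)
  have h2 : ContMDiffAt 𝓘(ℝ, ModelR n) 𝓘(ℝ, ModelR n →L[ℝ] ModelR n) ∞ (fun p : M ↦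
      (tangentCoord p₀ p).comp ((𝒥.J p).comp (tangentOfCoord p₀ p))) p₀ := h1.2
  have h3 : ContMDiffAt 𝓘(ℝ, ModelR n) 𝓘(ℝ, ModelR n) ∞ (chartAt (ModelR n) p₀).symm
      (chartAt (ModelR n) p₀ p₀) :=
    (contMDiffOn_chart_symm (I := 𝓘(ℝ, ModelR n))).contMDiffAt
      ((chartAt (ModelR n) p₀).open_target.mem_nhds (mem_chart_target _ p₀))
  have h4 := ContMDiffAt.comp (chartAt (ModelR n) p₀ p₀) (by
    rwa [(chartAt (ModelR n) p₀).left_inv (mem_chart_source _ p₀)]) h3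
  exact h4.contDiffAt

/-- Near `p₀`, the length of a tangent vector is bounded by that of its coordinates. -/
lemma exists_eventually_sqrt_inner_le (g : Bundle.ContMDiffRiemannianMetric 𝓘(ℝ, ModelR n) ∞
    (ModelR n) (fun p : M ↦ TangentSpace 𝓘(ℝ, ModelR n) p)) (p₀ : M) :
    ∃ K, 0 ≤ K ∧ ∀ᶠ p in 𝓝 p₀, ∀ v, Real.sqrt (g.inner p (tangentOfCoord p₀ p v)
      (tangentOfCoord p₀ p v)) ≤ K * ‖v‖ := by
  let : Bundle.RiemannianBundle (fun p : M ↦ TangentSpace 𝓘(ℝ, ModelR n) p) :=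
    ⟨g.toRiemannianMetric⟩
  have : IsContinuousRiemannianBundle (ModelR n) (fun p : M ↦ TangentSpace 𝓘(ℝ, ModelR n) p) :=
    ⟨⟨g.inner, g.contMDiff.continuous, fun _ _ _ ↦ rfl⟩⟩
  obtain ⟨C, hC, h⟩ := eventually_norm_symmL_trivializationAt_lt (ModelR n)
    (fun p : M ↦ TangentSpace 𝓘(ℝ, ModelR n) p) p₀
  refine ⟨C, hC.le, ?_⟩
  filter_upwards [h] with p hp v
  refine le_trans (le_of_eq ?_) (ContinuousLinearMap.le_of_opNorm_le _ hp.le v)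
  rw [norm_eq_sqrt_real_inner]
  rfl

end Coordinates

/-! ### Flattening a totally real edge -/

section Flattening

variable {n : ℕ} {V : Type*} [NormedAddCommGroup V] [NormedSpace ℝ V]

/-- Coordinates in which the edge `ρ = 0` is `ℝⁿ × {0}`, the wedge `ρ < 0` is given by the positive
orthant, and the almost complex structure is standard at the base point. -/
lemma exists_adapted_chart [FiniteDimensional ℝ V] (hV : Module.finrank ℝ V = 2 * n) {J : V →L[ℝ] V}
    (hJ : ∀ v, J (J v) = -v) {ρ : V → EuclideanSpace ℝ (Fin n)} {z₀ : V}
    (hρ : ContDiffAt ℝ 2 ρ z₀) (hρ0 : ρ z₀ = 0)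
    (hinj : ∀ v, fderiv ℝ ρ z₀ v = 0 → fderiv ℝ ρ z₀ (J v) = 0 → v = 0) :
    ∃ Θ : OpenPartialHomeomorph V (EuclideanSpace ℝ (Fin n) × EuclideanSpace ℝ (Fin n)),
      z₀ ∈ Θ.source ∧ Θ z₀ = 0 ∧ ContDiffAt ℝ 2 Θ z₀ ∧ ContDiffAt ℝ 2 Θ.symm 0 ∧
      (∀ z, (Θ z).2 = -ρ z) ∧
      ∀ v, fderiv ℝ Θ z₀ (J v) = (-(fderiv ℝ Θ z₀ v).2, (fderiv ℝ Θ z₀ v).1) := by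
  set T : V →L[ℝ] EuclideanSpace ℝ (Fin n) × EuclideanSpace ℝ (Fin n) :=
    (-(fderiv ℝ ρ z₀).comp J).prod (-fderiv ℝ ρ z₀) with hT
  have hTv : ∀ v, T v = (-fderiv ℝ ρ z₀ (J v), -fderiv ℝ ρ z₀ v) := fun v ↦ rfl
  have hTinj : Function.Injective T := by
    rw [injective_iff_map_eq_zero]
    intro v hv
    rw [hTv, Prod.mk_eq_zero, neg_eq_zero, neg_eq_zero] at hv
    exact hinj v hv.2 hv.1
  have hdim : Module.finrank ℝ V =
      Module.finrank ℝ (EuclideanSpace ℝ (Fin n) × EuclideanSpace ℝ (Fin n)) := by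
    rw [Module.finrank_prod, finrank_euclideanSpace_fin, hV, two_mul]
  set e := (LinearEquiv.ofInjectiveOfFinrankEq T.toLinearMap hTinj hdim).toContinuousLinearEquiv
    with he
  have heT : (e : V →L[ℝ] EuclideanSpace ℝ (Fin n) × EuclideanSpace ℝ (Fin n)) = T := by
    ext1 v
    rfl
  set θ : V → EuclideanSpace ℝ (Fin n) × EuclideanSpace ℝ (Fin n) := fun z ↦
    (-fderiv ℝ ρ z₀ (J (z - z₀)), -ρ z) with hθ
  have hθc : ContDiffAt ℝ 2 θ z₀ := by
    refine ContDiffAt.prodMk ?_ hρ.neg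
    exact ContDiff.contDiffAt (by fun_prop)
  have hθd : HasFDerivAt θ (e : V →L[ℝ] _) z₀ := by
    rw [heT]
    refine HasFDerivAt.prodMk ?_ (hρ.differentiableAt two_ne_zero).hasFDerivAt.neg
    exact (((fderiv ℝ ρ z₀).comp J).hasFDerivAt.comp z₀ ((hasFDerivAt_id z₀).sub_const z₀)).neg
  have hθ0 : θ z₀ = 0 := by
    simp [hθ, hρ0]
  refine ⟨hθc.toOpenPartialHomeomorph θ hθd two_ne_zero,
    hθc.mem_toOpenPartialHomeomorph_source hθd two_ne_zero, hθ0, hθc, ?_, fun z ↦ rfl, fun v ↦ ?_⟩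
  · have := hθc.to_localInverse hθd two_ne_zero
    rw [hθ0] at this
    exact this
  · change fderiv ℝ θ z₀ (J v) = (-(fderiv ℝ θ z₀ v).2, (fderiv ℝ θ z₀ v).1)
    rw [hθd.fderiv, heT, hTv, hTv, hJ, map_neg, neg_neg]

/-- Non-tangential limits exist at almost every point in adapted coordinates. -/
lemma ae_exists_tendsto_comp_symm (hn : 0 < n)
    {Θ : OpenPartialHomeomorph V (EuclideanSpace ℝ (Fin n) × EuclideanSpace ℝ (Fin n))} {z₀ : V}
    (hz₀ : z₀ ∈ Θ.source) (hΘ0 : Θ z₀ = 0) (hΘ : ContDiffAt ℝ 2 Θ z₀)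
    (hΘs : ContDiffAt ℝ 2 Θ.symm 0) {J : V → V →L[ℝ] V} (hJ : ContDiffAt ℝ 1 J z₀)
    (hJ2 : ∀ᶠ z in 𝓝 z₀, ∀ v, J z (J z v) = -v)
    (hJΘ : ∀ v, fderiv ℝ Θ z₀ (J z₀ v) = (-(fderiv ℝ Θ z₀ v).2, (fderiv ℝ Θ z₀ v).1))
    {F : V → ℂ} {M C : ℝ}
    (hF : ∀ᶠ z in 𝓝 z₀, (∀ j, 0 < (Θ z).2 j) → ContDiffAt ℝ 1 F z ∧ ‖F z‖ ≤ M ∧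
      ∀ v, ‖fderiv ℝ F z v + Complex.I * fderiv ℝ F z (J z v)‖ ≤ C * ‖v‖) :
    ∃ r > 0, ∀ᵐ x₀ : EuclideanSpace ℝ (Fin n), x₀ ∈ Metric.ball 0 r → ∃ L : ℂ, ∀ c > 0,
      Tendsto (F ∘ Θ.symm)
        (𝓝[{z | ∀ j, 0 < z.2 j ∧ c * ‖z - (x₀, 0)‖ ≤ z.2 j}] (x₀, 0)) (𝓝 L) := by
  set Ψ := Θ.symm with hΨ
  have h0t : (0 : EuclideanSpace ℝ (Fin n) × EuclideanSpace ℝ (Fin n)) ∈ Θ.target := by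
    rw [← hΘ0]
    exact Θ.map_source hz₀
  have hΨ0 : Ψ 0 = z₀ := by
    rw [← hΘ0]
    exact Θ.left_inv hz₀
  have hΨc : Tendsto Ψ (𝓝 0) (𝓝 z₀) := by
    have := hΘs.continuousAt
    rwa [ContinuousAt, hΨ0] at this
  set J₁ : EuclideanSpace ℝ (Fin n) × EuclideanSpace ℝ (Fin n) → _ := fun z ↦
    (fderiv ℝ Θ (Ψ z)).comp ((J (Ψ z)).comp (fderiv ℝ Ψ z)) with hJ₁
  have hΨ1 : ContDiffAt ℝ 1 Ψ 0 := hΘs.of_le (by norm_num)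
  have hdΨ : ContDiffAt ℝ 1 (fderiv ℝ Ψ) 0 := hΘs.fderiv_right (by norm_num)
  have hdΘ : ContDiffAt ℝ 1 (fun z ↦ fderiv ℝ Θ (Ψ z)) 0 := by
    refine ContDiffAt.comp (g := fderiv ℝ Θ) 0 ?_ hΨ1
    rw [hΨ0]
    exact hΘ.fderiv_right (by norm_num)
  have hJ₁c : ContDiffAt ℝ 1 J₁ 0 := by
    refine hdΘ.clm_comp (ContDiffAt.clm_comp ?_ hdΨ)
    refine ContDiffAt.comp (g := J) 0 ?_ hΨ1
    rwa [hΨ0]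
  -- The differentials of `Θ` and `Ψ` are inverse to each other.
  have hinv : ∀ᶠ z in 𝓝 (0 : EuclideanSpace ℝ (Fin n) × EuclideanSpace ℝ (Fin n)),
      DifferentiableAt ℝ Ψ z ∧ (∀ v, fderiv ℝ Θ (Ψ z) (fderiv ℝ Ψ z v) = v) ∧
      (∀ v, fderiv ℝ Ψ z (fderiv ℝ Θ (Ψ z) v) = v) := by
    have h1 : ∀ᶠ z in 𝓝 (0 : EuclideanSpace ℝ (Fin n) × EuclideanSpace ℝ (Fin n)),
        ContDiffAt ℝ 1 Ψ z := hΨ1.eventually (by simp)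
    have h2 : ∀ᶠ z in 𝓝 (0 : EuclideanSpace ℝ (Fin n) × EuclideanSpace ℝ (Fin n)),
        ContDiffAt ℝ 1 Θ (Ψ z) :=
      hΨc.eventually ((hΘ.of_le (by norm_num)).eventually (by simp))
    filter_upwards [h1, h2, Θ.open_target.mem_nhds h0t] with z hz1 hz2 hz3
    have hd1 := hz1.differentiableAt one_ne_zero
    have hd2 := hz2.differentiableAt one_ne_zero
    refine ⟨hd1, fun v ↦ ?_, fun v ↦ ?_⟩
    · have h3 : Θ ∘ Ψ =ᶠ[𝓝 z] id := by
        filter_upwards [Θ.open_target.mem_nhds hz3] with w hw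
        exact Θ.right_inv hw
      have h4 := h3.fderiv_eq (𝕜 := ℝ)
      rw [fderiv_comp z hd2 hd1, fderiv_id] at h4
      exact congrArg (fun A : _ →L[ℝ] _ ↦ A v) h4
    · have h3 : Ψ ∘ Θ =ᶠ[𝓝 (Ψ z)] id := by
        filter_upwards [Θ.open_source.mem_nhds (Θ.map_target hz3)] with w hw
        exact Θ.left_inv hw
      have h4 := h3.fderiv_eq (𝕜 := ℝ)
      have hΘΨ : Θ (Ψ z) = z := Θ.right_inv hz3
      rw [fderiv_comp (Ψ z) (by rwa [hΘΨ]) hd2, fderiv_id, hΘΨ] at h4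
      exact congrArg (fun A : _ →L[ℝ] _ ↦ A v) h4
  obtain ⟨B, hB, hBd⟩ := hΨ1.exists_eventually_norm_le
  have hF1 : ∀ᶠ z in 𝓝 (0 : EuclideanSpace ℝ (Fin n) × EuclideanSpace ℝ (Fin n)),
      (∀ j, 0 < z.2 j) → ContDiffAt ℝ 1 (F ∘ Ψ) z ∧ ‖(F ∘ Ψ) z‖ ≤ M ∧
      ∀ v, ‖fderiv ℝ (F ∘ Ψ) z v + Complex.I * fderiv ℝ (F ∘ Ψ) z (J₁ z v)‖ ≤
        max C 0 * B * ‖v‖ := by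
    filter_upwards [hΨc.eventually hF, hinv, hBd, Θ.open_target.mem_nhds h0t]
      with z hz1 hz2 hz3 hz4 hz
    have hΘΨ : Θ (Ψ z) = z := Θ.right_inv hz4
    obtain ⟨h1, h2, h3⟩ := hz1 (by rwa [hΘΨ])
    refine ⟨h1.comp z hz3.1, h2, fun v ↦ ?_⟩
    rw [fderiv_comp z (h1.differentiableAt one_ne_zero) hz2.1]
    have h4 : fderiv ℝ Ψ z (J₁ z v) = J (Ψ z) (fderiv ℝ Ψ z v) := hz2.2.2 _
    rw [ContinuousLinearMap.comp_apply, ContinuousLinearMap.comp_apply, h4]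
    refine (h3 _).trans ?_
    rw [mul_assoc]
    refine mul_le_mul (le_max_left _ _) ?_ (norm_nonneg _) (le_max_right _ _)
    exact ContinuousLinearMap.le_of_opNorm_le _ hz3.2.2 v
  have hJ₁2 : ∀ᶠ z in 𝓝 (0 : EuclideanSpace ℝ (Fin n) × EuclideanSpace ℝ (Fin n)),
      ∀ v, J₁ z (J₁ z v) = -v := by
    filter_upwards [hΨc.eventually hJ2, hinv] with z hz1 hz2 v
    have h4 : fderiv ℝ Ψ z (J₁ z v) = J (Ψ z) (fderiv ℝ Ψ z v) := hz2.2.2 _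
    change fderiv ℝ Θ (Ψ z) (J (Ψ z) (fderiv ℝ Ψ z (J₁ z v))) = -v
    rw [h4, hz1, map_neg, hz2.2.1]
  have hJ₁0 : ∀ x y : EuclideanSpace ℝ (Fin n), J₁ 0 (x, y) = (-y, x) := by
    intro x y
    have h1 := hinv.self_of_nhds.2.1 (x, y)
    rw [hΨ0] at h1
    change fderiv ℝ Θ (Ψ 0) (J (Ψ 0) (fderiv ℝ Ψ 0 (x, y))) = (-y, x)
    rw [hΨ0, hJΘ, h1]
  obtain ⟨r, hr, h⟩ := Metric.eventually_nhds_iff_ball.1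
    ((hJ₁c.eventually (by simp)).and (hJ₁2.and hF1))
  exact ae_exists_tendsto_orthant hn hr (fun z hz ↦ (h z hz).1.contDiffWithinAt)
    (fun z hz ↦ (h z hz).2.1) hJ₁0 (fun z hz ↦ ((h z hz.1).2.2 hz.2).1.contDiffWithinAt)
    (fun z hz hz' ↦ ((h z hz).2.2 hz').2.1) (fun z hz hz' ↦ ((h z hz).2.2 hz').2.2)

lemma hausdorffMeasure_eq_zero_of_volume_eq_zero {s : Set (EuclideanSpace ℝ (Fin n))}
    (hs : volume s = 0) : μH[(n : ℝ)] s = 0 := by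
  exact Measure.absolutelyContinuous_isAddHaarMeasure
    (μH[(n : ℝ)] : Measure (EuclideanSpace ℝ (Fin n))) volume hs

/-- A limit in the regions `c * ‖w - (x, 0)‖ ≤ w.2 j` in adapted coordinates is a limit in the
regions `c * ‖w - z‖ ≤ -ρ w j` in the original ones. -/
lemma tendsto_of_tendsto_comp_symm {V : Type*} [NormedAddCommGroup V]
    {Θ : OpenPartialHomeomorph V (EuclideanSpace ℝ (Fin n) × EuclideanSpace ℝ (Fin n))}
    {ρ : V → EuclideanSpace ℝ (Fin n)} (hΘρ : ∀ z, (Θ z).2 = -ρ z) {K : NNReal} {S : Set V} {z : V}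
    (hS : S ∈ 𝓝 z) (hK : LipschitzOnWith K Θ S) (hz : z ∈ Θ.source) (hρz : ρ z = 0) {F : V → ℂ}
    {L : ℂ} (hL : ∀ c > 0, Tendsto (F ∘ Θ.symm)
      (𝓝[{w | ∀ j, 0 < w.2 j ∧ c * ‖w - ((Θ z).1, 0)‖ ≤ w.2 j}] ((Θ z).1, 0)) (𝓝 L))
    {c : ℝ} (hc : 0 < c) :
    Tendsto F (𝓝[{w | ∀ j, ρ w j < 0 ∧ c * ‖w - z‖ ≤ -ρ w j}] z) (𝓝 L) := by
  have hz2 : Θ z = ((Θ z).1, 0) := by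
    refine Prod.ext rfl ?_
    rw [hΘρ, hρz, neg_zero]
  have h1 := hL (c / (K + 1)) (by positivity)
  rw [← hz2] at h1
  have h2 : Tendsto Θ (𝓝[{w | ∀ j, ρ w j < 0 ∧ c * ‖w - z‖ ≤ -ρ w j}] z)
      (𝓝[{w | ∀ j, 0 < w.2 j ∧ c / (K + 1) * ‖w - Θ z‖ ≤ w.2 j}] (Θ z)) := by
    refine tendsto_nhdsWithin_iff.2 ⟨(Θ.continuousAt hz).mono_left nhdsWithin_le_nhds, ?_⟩
    filter_upwards [self_mem_nhdsWithin, mem_nhdsWithin_of_mem_nhds hS] with w hw hwS j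
    have h3 : (Θ w).2 j = -ρ w j := by
      rw [hΘρ]
      rfl
    have h4 : ‖Θ w - Θ z‖ ≤ (K + 1) * ‖w - z‖ := by
      have := hK.dist_le_mul w hwS z (mem_of_mem_nhds hS)
      rw [dist_eq_norm, dist_eq_norm] at this
      nlinarith [norm_nonneg (w - z)]
    rw [h3]
    refine ⟨neg_pos.2 (hw j).1, le_trans ?_ (hw j).2⟩
    calc c / (K + 1) * ‖Θ w - Θ z‖ ≤ c / (K + 1) * ((K + 1) * ‖w - z‖) := by gcongr
      _ = c * ‖w - z‖ := by field_simp
  refine (h1.comp h2).congr' ?_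
  filter_upwards [mem_nhdsWithin_of_mem_nhds (Θ.open_source.mem_nhds hz)] with w hw
  change F (Θ.symm (Θ w)) = F w
  rw [Θ.left_inv hw]

variable [FiniteDimensional ℝ V] [MeasurableSpace V] [BorelSpace V]

/-- The points of a totally real edge near `z₀` at which a bounded function with bounded `∂̄` on the
wedge `ρ < 0` has no limit in the regions `c * ‖w - z‖ ≤ -ρ w j` form a null set. -/
theorem exists_nhds_hausdorffMeasure_eq_zero (hn : 0 < n) (hV : Module.finrank ℝ V = 2 * n)
    {J : V → V →L[ℝ] V} {z₀ : V} (hJ : ContDiffAt ℝ 1 J z₀)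
    (hJ2 : ∀ᶠ z in 𝓝 z₀, ∀ v, J z (J z v) = -v) {ρ : V → EuclideanSpace ℝ (Fin n)}
    (hρ : ContDiffAt ℝ 2 ρ z₀) (hρ0 : ρ z₀ = 0)
    (hinj : ∀ v, fderiv ℝ ρ z₀ v = 0 → fderiv ℝ ρ z₀ (J z₀ v) = 0 → v = 0)
    {F : V → ℂ} {M C : ℝ}
    (hF : ∀ᶠ z in 𝓝 z₀, (∀ j, ρ z j < 0) → ContDiffAt ℝ 1 F z ∧ ‖F z‖ ≤ M ∧
      ∀ v, ‖fderiv ℝ F z v + Complex.I * fderiv ℝ F z (J z v)‖ ≤ C * ‖v‖) :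
    ∃ U ∈ 𝓝 z₀, μH[(n : ℝ)] {z | z ∈ U ∧ ρ z = 0 ∧ ¬ ∃ L : ℂ, ∀ c > 0,
      Tendsto F (𝓝[{w | ∀ j, ρ w j < 0 ∧ c * ‖w - z‖ ≤ -ρ w j}] z) (𝓝 L)} = 0 := by
  obtain ⟨Θ, hz₀, hΘ0, hΘ, hΘs, hΘρ, hΘJ⟩ :=
    exists_adapted_chart hV hJ2.self_of_nhds hρ hρ0 hinj
  obtain ⟨r, hr, h⟩ := ae_exists_tendsto_comp_symm hn hz₀ hΘ0 hΘ hΘs hJ hJ2 hΘJ (F := F) (M := M)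
    (C := C) (by
      filter_upwards [hF] with z hz hz'
      refine hz fun j ↦ ?_
      have := hz' j
      rw [hΘρ] at this
      exact neg_pos.1 this)
  obtain ⟨K₁, S₁, hS₁, hK₁⟩ := (hΘ.of_le (by norm_num)).exists_lipschitzOnWith
  obtain ⟨K₂, S₂, hS₂, hK₂⟩ := (hΘs.of_le (by norm_num)).exists_lipschitzOnWith
  obtain ⟨r₂, hr₂, hrS₂⟩ := Metric.mem_nhds_iff.1 hS₂
  have hU : ∀ᶠ z in 𝓝 z₀, z ∈ Θ.source ∧ S₁ ∈ 𝓝 z ∧ Θ z ∈ Metric.ball 0 (min r r₂) := by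
    have h1 : Tendsto Θ (𝓝 z₀) (𝓝 0) := by
      have := Θ.continuousAt hz₀
      rwa [ContinuousAt, hΘ0] at this
    filter_upwards [Θ.open_source.mem_nhds hz₀, eventually_mem_nhds_iff.2 hS₁,
      h1.eventually_mem (Metric.ball_mem_nhds 0 (lt_min hr hr₂))] with z hz1 hz2 hz3
    exact ⟨hz1, hz2, hz3⟩
  refine ⟨_, hU, ?_⟩
  set N : Set (EuclideanSpace ℝ (Fin n)) := {x | x ∈ Metric.ball 0 (min r r₂) ∧ ¬ ∃ L : ℂ, ∀ c > 0,
      Tendsto (F ∘ Θ.symm) (𝓝[{z | ∀ j, 0 < z.2 j ∧ c * ‖z - (x, 0)‖ ≤ z.2 j}] (x, 0)) (𝓝 L)}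
    with hN
  have hN0 : volume N = 0 := by
    refine measure_mono_null ?_ (ae_iff.1 h)
    intro x hx h'
    exact hx.2 (h' (Metric.ball_subset_ball (min_le_left _ _) hx.1))
  have hlip : LipschitzOnWith K₂ (fun x : EuclideanSpace ℝ (Fin n) ↦ Θ.symm (x, 0)) N := by
    refine LipschitzOnWith.of_dist_le_mul fun x hx y hy ↦ ?_
    have hm : ∀ x ∈ N, ((x, 0) : EuclideanSpace ℝ (Fin n) × EuclideanSpace ℝ (Fin n)) ∈ S₂ := by
      intro x hx
      refine hrS₂ (Metric.ball_subset_ball (min_le_right r r₂) ?_)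
      have := hx.1
      rw [mem_ball_zero_iff] at this ⊢
      have h0 : ‖((x, 0) : EuclideanSpace ℝ (Fin n) × EuclideanSpace ℝ (Fin n))‖ = ‖x‖ := by
        simp [Prod.norm_def]
      rwa [h0]
    refine (hK₂.dist_le_mul _ (hm x hx) _ (hm y hy)).trans_eq ?_
    simp [Prod.dist_eq]
  have himg := hlip.hausdorffMeasure_image_le (d := n) (Nat.cast_nonneg n)
  rw [hausdorffMeasure_eq_zero_of_volume_eq_zero hN0, mul_zero] at himg
  refine measure_mono_null ?_ (le_antisymm himg bot_le)
  rintro z ⟨⟨hz1, hz2, hz3⟩, hz4, hz5⟩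
  have hz6 : Θ z = ((Θ z).1, 0) := by
    refine Prod.ext rfl ?_
    rw [hΘρ, hz4, neg_zero]
  refine ⟨(Θ z).1, ⟨?_, ?_⟩, ?_⟩
  · rw [mem_ball_zero_iff] at hz3 ⊢
    exact (norm_fst_le _).trans_lt hz3
  · rintro ⟨L, hL⟩
    exact hz5 ⟨L, fun c hc ↦ tendsto_of_tendsto_comp_symm hΘρ hz2 hK₁ hz1 hz4 hL hc⟩
  · change Θ.symm ((Θ z).1, 0) = z
    rw [← hz6, Θ.left_inv hz1]

end Flattening

/-! ### Non-tangential cones -/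

section Cones

variable {n : ℕ}

/-- A nonzero linear form which is nonpositive on an open cone is negative there. -/
lemma apply_neg_of_angle_lt {E : Type*} [NormedAddCommGroup E] [InnerProductSpace ℝ E]
    {ℓ : E →L[ℝ] ℝ} (hℓ : ℓ ≠ 0) {v : E} (hv : v ≠ 0) {θ : ℝ}
    (h : ∀ w, InnerProductGeometry.angle v w < θ → ℓ w ≤ 0) {w : E} (hw : w ≠ 0)
    (hwθ : InnerProductGeometry.angle v w < θ) : ℓ w < 0 := by
  refine lt_of_le_of_ne (h w hwθ) fun h0 ↦ hℓ ?_
  by_contra hne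
  obtain ⟨u, hu⟩ : ∃ u, 0 < ℓ u := by
    by_contra! hle
    refine hne (ContinuousLinearMap.ext fun u ↦ le_antisymm (hle u) ?_)
    have := hle (-u)
    rw [map_neg] at this
    simpa using this
  have hc : ContinuousAt (fun s : ℝ ↦ InnerProductGeometry.angle v (w + s • u)) 0 := by
    have h1 : ContinuousAt (fun y : E × E ↦ InnerProductGeometry.angle y.1 y.2)
        (v, w + (0 : ℝ) • u) :=
      InnerProductGeometry.continuousAt_angle hv (by simpa using hw)
    exact ContinuousAt.comp (f := fun s : ℝ ↦ (v, w + s • u)) h1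
      (Continuous.continuousAt (by fun_prop))
  have h2 : ∀ᶠ s in 𝓝[>] (0 : ℝ), InnerProductGeometry.angle v (w + s • u) < θ :=
    nhdsWithin_le_nhds (hc.eventually_lt continuousAt_const (by simpa using hwθ))
  obtain ⟨s, hs, hs0⟩ := (h2.and self_mem_nhdsWithin).exists
  have h3 := h _ hs
  rw [map_add, map_smul, h0, zero_add, smul_eq_mul] at h3
  exact absurd (mul_pos (mem_Ioi.1 hs0) hu) (not_lt.2 h3)

/-- A defining function which is negative on a cone decays at least linearly in the distance to the
vertex on every smaller cone. -/
lemma exists_mul_norm_le_neg {σ : ModelR n → ℝ} {ℓ : ModelR n →L[ℝ] ℝ} {a v : ModelR n}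
    {θ θ' r : ℝ} (hσ : HasFDerivAt σ ℓ a) (hσ0 : σ a = 0) (hℓ : ℓ ≠ 0) (hv : v ≠ 0)
    (hθ : θ < θ') (hr : 0 < r) (hneg : ∀ x ∈ circularCone a v θ' r, σ x ≤ 0) :
    ∃ c > 0, ∀ᶠ x in 𝓝 a, x ∈ circularCone a v θ r → c * ‖x - a‖ ≤ -σ x := by
  have hle : ∀ w, InnerProductGeometry.angle v w < θ' → ℓ w ≤ 0 := by
    intro w hw
    have h1 : Tendsto (fun t : ℝ ↦ t⁻¹ • (σ (a + t • w) - σ a)) (𝓝[>] 0) (𝓝 (ℓ w)) :=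
      ((hσ.hasLineDerivAt w).tendsto_slope_zero).mono_left
        (nhdsWithin_mono _ fun t ht ↦ ne_of_gt ht)
    refine le_of_tendsto h1 ?_
    have h2 : ∀ᶠ t in 𝓝[>] (0 : ℝ), ‖t • w‖ < r := by
      have : ContinuousAt (fun t : ℝ ↦ ‖t • w‖) 0 := Continuous.continuousAt (by fun_prop)
      exact nhdsWithin_le_nhds (this.eventually_lt continuousAt_const (by simpa using hr))
    filter_upwards [h2, self_mem_nhdsWithin] with t ht ht0
    have ht0' : 0 < t := ht0
    rw [hσ0, sub_zero, smul_eq_mul]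
    refine mul_nonpos_of_nonneg_of_nonpos (inv_nonneg.2 ht0'.le) (hneg _ ⟨?_, ?_⟩)
    · rwa [add_sub_cancel_left, InnerProductGeometry.angle_smul_right_of_pos _ _ ht0']
    · rwa [add_sub_cancel_left]
  have hlt : ∀ w, w ≠ 0 → InnerProductGeometry.angle v w < θ' → ℓ w < 0 := fun w hw hw' ↦
    apply_neg_of_angle_lt hℓ hv hle hw hw'
  -- By compactness, `ℓ w ≤ -2 c ‖w‖` on the smaller cone.
  obtain ⟨c, hc, hcℓ⟩ : ∃ c > 0, ∀ w, InnerProductGeometry.angle v w < θ →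
      ℓ w ≤ -(2 * c) * ‖w‖ := by
    set S : Set (ModelR n) := {w | ‖w‖ = 1 ∧ Real.arccos (inner ℝ v w / ‖v‖) ≤ θ} with hS
    have hSc : IsCompact S := by
      refine (isCompact_sphere (0 : ModelR n) 1).of_isClosed_subset ?_ fun w hw ↦ ?_
      · refine (isClosed_eq continuous_norm continuous_const).inter ?_
        refine isClosed_le (f := fun w ↦ Real.arccos (inner ℝ v w / ‖v‖)) ?_ continuous_const
        exact Real.continuous_arccos.comp (by fun_prop)
      · rw [mem_sphere_zero_iff_norm]
        exact hw.1
    have hang : ∀ w : ModelR n, ‖w‖ = 1 →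
        Real.arccos (inner ℝ v w / ‖v‖) = InnerProductGeometry.angle v w := by
      intro w hw
      rw [InnerProductGeometry.angle, hw, mul_one]
    obtain ⟨c, hc, hcS⟩ : ∃ c > 0, ∀ w ∈ S, ℓ w ≤ -(2 * c) := by
      rcases S.eq_empty_or_nonempty with h | h
      · exact ⟨1, one_pos, by simp [h]⟩
      · obtain ⟨w₀, hw₀, hmax⟩ := hSc.exists_isMaxOn h ℓ.continuous.continuousOn
        have h0 : ℓ w₀ < 0 := by
          refine hlt w₀ (fun h ↦ ?_) ?_
          · have := hw₀.1
            simp [h] at this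
          · rw [← hang w₀ hw₀.1]
            exact hw₀.2.trans_lt hθ
        refine ⟨-ℓ w₀ / 2, by linarith, fun w hw ↦ ?_⟩
        have : ℓ w ≤ ℓ w₀ := hmax hw
        linarith
    refine ⟨c, hc, fun w hw ↦ ?_⟩
    rcases eq_or_ne w 0 with rfl | hw0
    · simp
    · have hwn : 0 < ‖w‖ := norm_pos_iff.2 hw0
      have hn1 : ‖‖w‖⁻¹ • w‖ = 1 := by
        rw [norm_smul, norm_inv, norm_norm, inv_mul_cancel₀ hwn.ne']
      have h1 := hcS (‖w‖⁻¹ • w) ⟨hn1, by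
        rw [hang _ hn1, InnerProductGeometry.angle_smul_right_of_pos _ _ (inv_pos.2 hwn)]
        exact hw.le⟩
      rw [map_smul, smul_eq_mul, inv_mul_le_iff₀ hwn] at h1
      linarith
  refine ⟨c, hc, ?_⟩
  filter_upwards [(hasFDerivAt_iff_isLittleO.1 hσ).def hc] with x hx hxc
  rw [hσ0, sub_zero, Real.norm_eq_abs] at hx
  have h1 := hcℓ _ hxc.1
  linarith [(abs_le.1 hx).2]

end Cones

/-! ### Totally real edges -/

section TotallyReal

/-- If `T (J v) = -i T v`, the image of `T` is a complex subspace, so that `T` is surjective as soon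
as its values on some `n` vectors are independent over `ℂ`; then it is injective, by dimension. -/
lemma injective_of_det_ne_zero {n : ℕ} {E : Type*} [AddCommGroup E] [Module ℝ E]
    [FiniteDimensional ℝ E] (hE : Module.finrank ℝ E = 2 * n) (J : E → E)
    (T : E →ₗ[ℝ] (Fin n → ℂ)) (hT : ∀ v, T (J v) = -Complex.I • T v) {v : Fin n → E}
    (hv : (Matrix.of fun i j ↦ T (v j) i).det ≠ 0) : Function.Injective T := by
  have hdim : Module.finrank ℝ E = Module.finrank ℝ (Fin n → ℂ) := by
    rw [Module.finrank_pi_fintype, hE]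
    simp [mul_comm]
  rw [LinearMap.injective_iff_surjective_of_finrank_eq_finrank hdim]
  intro u
  set A : Matrix (Fin n) (Fin n) ℂ := Matrix.of fun i j ↦ T (v j) i with hA
  set c := A⁻¹.mulVec u with hc
  have hAc : A.mulVec c = u := by
    rw [hc, Matrix.mulVec_mulVec, Matrix.mul_nonsing_inv _ (isUnit_iff_ne_zero.2 hv),
      Matrix.one_mulVec]
  -- The coefficient `c j` acts on `v j` through the complex structure `-J`.
  refine ⟨∑ j, ((c j).re • v j - (c j).im • J (v j)), ?_⟩
  rw [← hAc]
  ext i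
  simp only [map_sum, map_sub, map_smul, hT, Finset.sum_apply, Pi.sub_apply, Pi.smul_apply,
    Matrix.mulVec, dotProduct, hA, Matrix.of_apply]
  refine Finset.sum_congr rfl fun j _ ↦ ?_
  conv_rhs => rw [← Complex.re_add_im (c j)]
  simp only [Complex.real_smul, smul_eq_mul]
  ring

variable {n : ℕ} {M : Type*} [TopologicalSpace M]
    [ChartedSpace (ModelR n) M] [IsManifold 𝓘(ℝ, ModelR n) ∞ M]

lemma AlmostComplexStructure.dbar_ofReal_apply (𝒥 : AlmostComplexStructure n M) {ρ : M → ℝ} {p : M}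
    (hρ : MDifferentiableAt 𝓘(ℝ, ModelR n) 𝓘(ℝ, ℝ) ρ p) (v : TangentSpace 𝓘(ℝ, ModelR n) p) :
    𝒥.dbar (fun q ↦ (ρ q : ℂ)) p v = (1 / 2 : ℂ) *
      (Complex.ofReal (mfderiv 𝓘(ℝ, ModelR n) 𝓘(ℝ, ℝ) ρ p v) +
        Complex.I * Complex.ofReal (mfderiv 𝓘(ℝ, ModelR n) 𝓘(ℝ, ℝ) ρ p (𝒥.J p v))) := by
  have h1 : mfderiv 𝓘(ℝ, ModelR n) 𝓘(ℝ, ℂ) (fun q ↦ (ρ q : ℂ)) p =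
      Complex.ofRealCLM.comp (mfderiv 𝓘(ℝ, ModelR n) 𝓘(ℝ, ℝ) ρ p) := by
    have h2 : HasMFDerivAt 𝓘(ℝ, ℝ) 𝓘(ℝ, ℂ) Complex.ofRealCLM (ρ p) Complex.ofRealCLM :=
      Complex.ofRealCLM.hasMFDerivAt
    exact (h2.comp p hρ.hasMFDerivAt).mfderiv
  unfold AlmostComplexStructure.dbar AlmostComplexStructure.diffC
  rw [h1]
  rfl

lemma AlmostComplexStructure.mfderiv_ne_zero_of_dbarWedge_ne_zero (𝒥 : AlmostComplexStructure n M)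
    {k : ℕ} {ρ : Fin k → M → ℝ} {p : M}
    (hρ : ∀ j, MDifferentiableAt 𝓘(ℝ, ModelR n) 𝓘(ℝ, ℝ) (ρ j) p)
    {v : Fin k → TangentSpace 𝓘(ℝ, ModelR n) p} (hv : 𝒥.dbarWedge ρ p v ≠ 0) (j : Fin k) :
    mfderiv 𝓘(ℝ, ModelR n) 𝓘(ℝ, ℝ) (ρ j) p ≠ 0 := by
  intro h
  refine hv (Matrix.det_eq_zero_of_row_eq_zero j fun i ↦ ?_)
  rw [Matrix.of_apply, 𝒥.dbar_ofReal_apply (hρ j), h]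
  change (1 / 2 : ℂ) * (Complex.ofReal (0 : ℝ) + Complex.I * Complex.ofReal (0 : ℝ)) = 0
  simp

/-- The tangent space of a totally real edge contains no complex line. -/
lemma AlmostComplexStructure.eq_zero_of_dbarWedge_ne_zero (𝒥 : AlmostComplexStructure n M)
    {ρ : Fin n → M → ℝ} {p : M} (hρ : ∀ j, MDifferentiableAt 𝓘(ℝ, ModelR n) 𝓘(ℝ, ℝ) (ρ j) p)
    {v : Fin n → TangentSpace 𝓘(ℝ, ModelR n) p} (hv : 𝒥.dbarWedge ρ p v ≠ 0)
    {w : TangentSpace 𝓘(ℝ, ModelR n) p}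
    (hw : ∀ j, mfderiv 𝓘(ℝ, ModelR n) 𝓘(ℝ, ℝ) (ρ j) p w = 0)
    (hJw : ∀ j, mfderiv 𝓘(ℝ, ModelR n) 𝓘(ℝ, ℝ) (ρ j) p (𝒥.J p w) = 0) : w = 0 := by
  have hfd : FiniteDimensional ℝ (TangentSpace 𝓘(ℝ, ModelR n) p) :=
    inferInstanceAs (FiniteDimensional ℝ (ModelR n))
  set T : TangentSpace 𝓘(ℝ, ModelR n) p →ₗ[ℝ] (Fin n → ℂ) :=
    LinearMap.pi fun i ↦ (𝒥.dbar (fun q ↦ (ρ i q : ℂ)) p).toLinearMap with hT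
  have hTi : ∀ u i, T u i = 𝒥.dbar (fun q ↦ (ρ i q : ℂ)) p u := fun u i ↦ rfl
  have hdim : Module.finrank ℝ (TangentSpace 𝓘(ℝ, ModelR n) p) = 2 * n :=
    finrank_euclideanSpace_fin (𝕜 := ℝ) (n := 2 * n)
  have hTJ : ∀ u, T (𝒥.J p u) = -Complex.I • T u := by
    intro u
    ext i
    rw [Pi.smul_apply, hTi, hTi, 𝒥.dbar_ofReal_apply (hρ i), 𝒥.dbar_ofReal_apply (hρ i),
      𝒥.sq_eq_neg, map_neg, smul_eq_mul]
    have hneg : Complex.ofReal (-mfderiv 𝓘(ℝ, ModelR n) 𝓘(ℝ, ℝ) (ρ i) p u) =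
        -Complex.ofReal (mfderiv 𝓘(ℝ, ModelR n) 𝓘(ℝ, ℝ) (ρ i) p u) := Complex.ofReal_neg _
    rw [hneg]
    linear_combination (1 / 2 * Complex.ofReal (mfderiv 𝓘(ℝ, ModelR n) 𝓘(ℝ, ℝ) (ρ i) p (𝒥.J p u))) *
      Complex.I_mul_I
  have hinj := injective_of_det_ne_zero hdim (𝒥.J p) T hTJ hv
  refine hinj ?_
  rw [map_zero]
  ext i
  rw [hTi, 𝒥.dbar_ofReal_apply (hρ i), hw, hJw]
  change (1 / 2 : ℂ) * (Complex.ofReal (0 : ℝ) + Complex.I * Complex.ofReal (0 : ℝ)) = 0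
  simp

end TotallyReal

/-! ### Passage to the manifold -/

section Manifold

variable {n : ℕ} {M : Type*} [TopologicalSpace M] [ChartedSpace (ModelR n) M]

lemma contDiffAt_transition {φ φ' : OpenPartialHomeomorph M (ModelR n)}
    (hφ : φ ∈ IsManifold.maximalAtlas 𝓘(ℝ, ModelR n) ∞ M)
    (hφ' : φ' ∈ IsManifold.maximalAtlas 𝓘(ℝ, ModelR n) ∞ M) {p : M} (hp : p ∈ φ.source)
    (hp' : p ∈ φ'.source) : ContDiffAt ℝ ∞ (φ' ∘ φ.symm) (φ p) := by
  have h1 : ContMDiffAt 𝓘(ℝ, ModelR n) 𝓘(ℝ, ModelR n) ∞ φ.symm (φ p) :=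
    contMDiffAt_symm_of_mem_maximalAtlas hφ (φ.map_source hp)
  have h2 : ContMDiffAt 𝓘(ℝ, ModelR n) 𝓘(ℝ, ModelR n) ∞ φ' p :=
    contMDiffAt_of_mem_maximalAtlas hφ' hp'
  have h3 := ContMDiffAt.comp (φ p) (by rwa [φ.left_inv hp]) h1
  exact h3.contDiffAt

lemma contDiffAt_comp_symm {E : Type*} [NormedAddCommGroup E] [NormedSpace ℝ E] {m : WithTop ℕ∞}
    (hm : m ≤ ∞) {φ : OpenPartialHomeomorph M (ModelR n)}
    (hφ : φ ∈ IsManifold.maximalAtlas 𝓘(ℝ, ModelR n) ∞ M) {p : M} (hp : p ∈ φ.source) {f : M → E}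
    (hf : ContMDiffAt 𝓘(ℝ, ModelR n) 𝓘(ℝ, E) m f p) : ContDiffAt ℝ m (f ∘ φ.symm) (φ p) := by
  have h1 : ContMDiffAt 𝓘(ℝ, ModelR n) 𝓘(ℝ, ModelR n) m φ.symm (φ p) :=
    (contMDiffAt_symm_of_mem_maximalAtlas hφ (φ.map_source hp)).of_le hm
  have h3 := ContMDiffAt.comp (φ p) (by rwa [φ.left_inv hp]) h1
  exact h3.contDiffAt

lemma isOpen_wedge {k : ℕ} {ρ : Fin k → M → ℝ} (hρ : ∀ j, Continuous (ρ j)) :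
    IsOpen (wedge ρ) := by
  have : wedge ρ = ⋂ j, {p | ρ j p < 0} := by
    ext p
    simp [wedge]
  rw [this]
  exact isOpen_iInter_of_finite fun j ↦ isOpen_lt (hρ j) continuous_const

/-- A limit in the regions `c * ‖w - φ p‖ ≤ -ρ w` in one chart is a non-tangential limit: every
non-tangential cone, in whatever chart, is contained in such a region near its vertex. -/
lemma hasNontangentialLimit_of_tendsto {k : ℕ} {ρ : Fin k → M → ℝ}
    {φ₀ : OpenPartialHomeomorph M (ModelR n)}
    (hφ₀ : φ₀ ∈ IsManifold.maximalAtlas 𝓘(ℝ, ModelR n) ∞ M) {p : M} (hp : p ∈ φ₀.source)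
    (hρ : ∀ j, MDifferentiableAt 𝓘(ℝ, ModelR n) 𝓘(ℝ, ℝ) (ρ j) p)
    (hρ0 : p ∈ edge ρ) (hdρ : ∀ j, mfderiv 𝓘(ℝ, ModelR n) 𝓘(ℝ, ℝ) (ρ j) p ≠ 0)
    {F : M → ℂ} {L : ℂ} (hL : ∀ c > 0, Tendsto (F ∘ φ₀.symm)
      (𝓝[{w | ∀ j, ρ j (φ₀.symm w) < 0 ∧ c * ‖w - φ₀ p‖ ≤ -ρ j (φ₀.symm w)}] (φ₀ p)) (𝓝 L)) :
    HasNontangentialLimit n (wedge ρ) F p L := by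
  rintro K ⟨φ, hφ, hpφ, v, θ, θ', r, hv, hθ, hθθ', hr, hcone, hconeW, rfl⟩
  have hsymm : MDifferentiableAt 𝓘(ℝ, ModelR n) 𝓘(ℝ, ModelR n) φ.symm (φ p) :=
    (contMDiffAt_symm_of_mem_maximalAtlas hφ (φ.map_source hpφ)).mdifferentiableAt (by simp)
  have hφm : MDifferentiableAt 𝓘(ℝ, ModelR n) 𝓘(ℝ, ModelR n) φ p :=
    (contMDiffAt_of_mem_maximalAtlas hφ hpφ).mdifferentiableAt (by simp)
  have hσd : ∀ j, MDifferentiableAt 𝓘(ℝ, ModelR n) 𝓘(ℝ, ℝ) (ρ j ∘ φ.symm) (φ p) := fun j ↦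
    MDifferentiableAt.comp (φ p) (by rw [φ.left_inv hpφ]; exact hρ j) hsymm
  have hσ0 : ∀ j, (ρ j ∘ φ.symm) (φ p) = 0 := fun j ↦ by
    rw [Function.comp_apply, φ.left_inv hpφ]
    exact hρ0 j
  have hℓ : ∀ j, fderiv ℝ (ρ j ∘ φ.symm) (φ p) ≠ 0 := by
    intro j h0
    refine hdρ j ?_
    have hev : ρ j =ᶠ[𝓝 p] (ρ j ∘ φ.symm) ∘ φ := by
      filter_upwards [φ.open_source.mem_nhds hpφ] with q hq
      simp [φ.left_inv hq]
    rw [hev.mfderiv_eq, mfderiv_comp p (hσd j) hφm, mfderiv_eq_fderiv, h0]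
    exact ContinuousLinearMap.zero_comp _
  obtain ⟨B, S, hS, hB⟩ :=
    ((contDiffAt_transition hφ hφ₀ hpφ hp).of_le (by simp : (1 : WithTop ℕ∞) ≤ ∞)
      ).exists_lipschitzOnWith
  have hc : ∀ j, ∀ᶠ c in 𝓝[>] (0 : ℝ), ∀ᶠ x in 𝓝 (φ p), x ∈ circularCone (φ p) v θ r →
      c * ‖x - φ p‖ ≤ -(ρ j ∘ φ.symm) x := by
    intro j
    obtain ⟨c, hc, h⟩ := exists_mul_norm_le_neg
      ((mdifferentiableAt_iff_differentiableAt.1 (hσd j)).hasFDerivAt) (hσ0 j) (hℓ j) hv hθθ' hr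
      (fun x hx ↦ (hconeW ⟨x, hx, rfl⟩ j).le)
    filter_upwards [Ioc_mem_nhdsGT hc] with c' hc'
    filter_upwards [h] with x hx hxc
    exact le_trans (by gcongr; exact hc'.2) (hx hxc)
  obtain ⟨c, hc, hc0⟩ := ((eventually_all.2 hc).and self_mem_nhdsWithin).exists
  replace hc0 : 0 < c := hc0
  rw [← eventually_all] at hc
  have h1 := hL (c / (B + 1)) (by positivity)
  have hcp : Tendsto φ (𝓝 p) (𝓝 (φ p)) := φ.continuousAt hpφ
  have h2 : Tendsto φ₀ (𝓝[φ.symm '' circularCone (φ p) v θ r] p)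
      (𝓝[{w | ∀ j, ρ j (φ₀.symm w) < 0 ∧
        c / (B + 1) * ‖w - φ₀ p‖ ≤ -ρ j (φ₀.symm w)}] (φ₀ p)) := by
    refine tendsto_nhdsWithin_iff.2 ⟨(φ₀.continuousAt hp).mono_left nhdsWithin_le_nhds, ?_⟩
    filter_upwards [self_mem_nhdsWithin,
      mem_nhdsWithin_of_mem_nhds (φ₀.open_source.mem_nhds hp),
      mem_nhdsWithin_of_mem_nhds (φ.open_source.mem_nhds hpφ),
      nhdsWithin_le_nhds (hcp.eventually hc), nhdsWithin_le_nhds (hcp.eventually_mem hS)]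
      with q hq hq0 hqφ hqc hqS j
    obtain ⟨x, hx, rfl⟩ := hq
    have hx' : x ∈ circularCone (φ p) v θ' r := ⟨hx.1.trans hθθ', hx.2⟩
    rw [φ.right_inv (hcone hx')] at hqc hqS
    rw [φ₀.left_inv hq0]
    refine ⟨hconeW ⟨x, hx', rfl⟩ j, le_trans ?_ (hqc j hx)⟩
    have h3 := hB.dist_le_mul x hqS (φ p) (mem_of_mem_nhds hS)
    rw [dist_eq_norm, dist_eq_norm, Function.comp_apply, Function.comp_apply, φ.left_inv hpφ] at h3
    have h4 : ‖φ₀ (φ.symm x) - φ₀ p‖ ≤ (B + 1) * ‖x - φ p‖ := by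
      nlinarith [norm_nonneg (x - φ p)]
    calc _ ≤ c / (B + 1) * ((B + 1) * ‖x - φ p‖) := by gcongr
      _ = c * ‖x - φ p‖ := by field_simp
  refine (h1.comp h2).congr' ?_
  filter_upwards [mem_nhdsWithin_of_mem_nhds (φ₀.open_source.mem_nhds hp)] with q hq
  change F (φ₀.symm (φ₀ q)) = F q
  rw [φ₀.left_inv hq]

variable [IsManifold 𝓘(ℝ, ModelR n) ∞ M]

/-- In the chart at `p₀`, the points of the edge near `p₀` at which `F` has no limit in the regions
`c * ‖w - z‖ ≤ -ρ w` form a null set. -/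
lemma AlmostComplexStructure.exists_nhds_chart_hausdorffMeasure_eq_zero (hn : 0 < n)
    (𝒥 : AlmostComplexStructure n M)
    (g : Bundle.ContMDiffRiemannianMetric 𝓘(ℝ, ModelR n) ∞ (ModelR n)
      (fun p : M ↦ TangentSpace 𝓘(ℝ, ModelR n) p))
    {ρ : Fin n → M → ℝ} (hρ : 𝒥.IsGeneric ρ) {F : M → ℂ}
    (hF : ContMDiffOn 𝓘(ℝ, ModelR n) 𝓘(ℝ, ℂ) 1 F (wedge ρ))
    (hFb : ∃ C : ℝ, ∀ p ∈ wedge ρ, ‖F p‖ ≤ C) (hdF : 𝒥.DbarBoundedOn g F (wedge ρ))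
    {p₀ : M} (hp₀ : p₀ ∈ edge ρ) :
    ∃ U ∈ 𝓝 (chartAt (ModelR n) p₀ p₀), μH[(n : ℝ)] {z | z ∈ U ∧
      (∀ j, ρ j ((chartAt (ModelR n) p₀).symm z) = 0) ∧ ¬ ∃ L : ℂ, ∀ c > 0,
      Tendsto (F ∘ (chartAt (ModelR n) p₀).symm)
        (𝓝[{w | ∀ j, ρ j ((chartAt (ModelR n) p₀).symm w) < 0 ∧
          c * ‖w - z‖ ≤ -ρ j ((chartAt (ModelR n) p₀).symm w)}] z) (𝓝 L)} = 0 := by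
  obtain ⟨Mb, hMb⟩ := hFb
  obtain ⟨C, hC⟩ := hdF
  obtain ⟨K, hK0, hK⟩ := exists_eventually_sqrt_inner_le g p₀
  obtain ⟨v, hv⟩ := hρ.wedge_ne_zero.self_of_nhdsSet p₀ hp₀
  have hρd : ∀ p j, MDifferentiableAt 𝓘(ℝ, ModelR n) 𝓘(ℝ, ℝ) (ρ j) p := fun p j ↦
    (hρ.smooth j p).mdifferentiableAt (by simp)
  set φ := chartAt (ModelR n) p₀ with hφ
  have hφa : φ ∈ IsManifold.maximalAtlas 𝓘(ℝ, ModelR n) ∞ M := IsManifold.chart_mem_maximalAtlas p₀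
  have hp₀s : p₀ ∈ φ.source := mem_chart_source _ p₀
  set z₀ := φ p₀ with hz₀
  have hφz₀ : φ.symm z₀ = p₀ := φ.left_inv hp₀s
  have hφc : Tendsto φ.symm (𝓝 z₀) (𝓝 p₀) := by
    have := φ.symm.continuousAt (φ.map_source hp₀s)
    rwa [ContinuousAt, hφz₀] at this
  set J : ModelR n → ModelR n →L[ℝ] ModelR n := fun z ↦ (tangentCoord p₀ (φ.symm z)).comp
    ((𝒥.J (φ.symm z)).comp (tangentOfCoord p₀ (φ.symm z))) with hJ
  have hJc : ContDiffAt ℝ 1 J z₀ := (contDiffAt_coordinates 𝒥 p₀).of_le (by simp)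
  have htarget := φ.open_target.mem_nhds (φ.map_source hp₀s)
  have hJ2 : ∀ᶠ z in 𝓝 z₀, ∀ v, J z (J z v) = -v := by
    filter_upwards [htarget] with z hz v
    have hs := φ.map_target hz
    change tangentCoord p₀ (φ.symm z) (𝒥.J (φ.symm z) (tangentOfCoord p₀ (φ.symm z)
      (tangentCoord p₀ (φ.symm z) (𝒥.J (φ.symm z) (tangentOfCoord p₀ (φ.symm z) v))))) = -v
    rw [tangentOfCoord_tangentCoord hs, 𝒥.sq_eq_neg, map_neg, tangentCoord_tangentOfCoord hs]
  set ρt : ModelR n → EuclideanSpace ℝ (Fin n) := fun z ↦ WithLp.toLp 2 fun j ↦ ρ j (φ.symm z)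
    with hρt
  have hρc : ∀ j, ContDiffAt ℝ ∞ (ρ j ∘ φ.symm) z₀ := fun j ↦
    contDiffAt_comp_symm le_rfl hφa hp₀s (hρ.smooth j p₀)
  have hρtc : ContDiffAt ℝ 2 ρt z₀ := by
    rw [contDiffAt_euclidean]
    exact fun j ↦ (hρc j).of_le (ENat.LEInfty.out)
  have hρt0 : ρt z₀ = 0 := by
    ext j
    change ρ j (φ.symm z₀) = 0
    rw [hφz₀]
    exact hp₀ j
  have hρtd : ∀ w, fderiv ℝ ρt z₀ w = 0 → ∀ j, fderiv ℝ (ρ j ∘ φ.symm) z₀ w = 0 := by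
    intro w hw j
    have h1 := (EuclideanSpace.proj (𝕜 := ℝ) j).hasFDerivAt.comp z₀
      (hρtc.differentiableAt two_ne_zero).hasFDerivAt
    have h2 : fderiv ℝ (ρ j ∘ φ.symm) z₀ =
        (EuclideanSpace.proj (𝕜 := ℝ) j).comp (fderiv ℝ ρt z₀) := h1.fderiv
    rw [h2, ContinuousLinearMap.comp_apply, hw, map_zero]
  have hinj : ∀ w, fderiv ℝ ρt z₀ w = 0 → fderiv ℝ ρt z₀ (J z₀ w) = 0 → w = 0 := by
    intro w hw hJw
    have h1 := 𝒥.eq_zero_of_dbarWedge_ne_zero (hρd p₀) hv (w := tangentOfCoord p₀ p₀ w)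
      (fun j ↦ by
        rw [mfderiv_eq_fderiv_comp_tangentCoord hp₀s (hρd p₀ j), tangentCoord_tangentOfCoord hp₀s]
        exact hρtd w hw j)
      (fun j ↦ by
        rw [mfderiv_eq_fderiv_comp_tangentCoord hp₀s (hρd p₀ j)]
        have h2 := hρtd _ hJw j
        have h3 : J z₀ w = tangentCoord p₀ p₀ (𝒥.J p₀ (tangentOfCoord p₀ p₀ w)) := by
          have h4 : ∀ q, q = p₀ → tangentCoord p₀ q (𝒥.J q (tangentOfCoord p₀ q w)) =
              tangentCoord p₀ p₀ (𝒥.J p₀ (tangentOfCoord p₀ p₀ w)) := fun q hq ↦ by rw [hq]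
          exact h4 _ hφz₀
        rw [h3] at h2
        exact h2)
    rw [← tangentCoord_tangentOfCoord hp₀s w, h1, map_zero]
  have hW : IsOpen (wedge ρ) := isOpen_wedge fun j ↦ (hρ.smooth j).continuous
  have hFt : ∀ᶠ z in 𝓝 z₀, (∀ j, ρt z j < 0) → ContDiffAt ℝ 1 (F ∘ φ.symm) z ∧
      ‖(F ∘ φ.symm) z‖ ≤ Mb ∧ ∀ v, ‖fderiv ℝ (F ∘ φ.symm) z v +
        Complex.I * fderiv ℝ (F ∘ φ.symm) z (J z v)‖ ≤ 2 * (max C 0 * K) * ‖v‖ := by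
    filter_upwards [htarget, hφc.eventually hK] with z hz hzK hzρ
    have hs := φ.map_target hz
    have hzW : φ.symm z ∈ wedge ρ := hzρ
    have hFz : ContMDiffAt 𝓘(ℝ, ModelR n) 𝓘(ℝ, ℂ) 1 F (φ.symm z) :=
      hF.contMDiffAt (hW.mem_nhds hzW)
    have hφφ : φ (φ.symm z) = z := φ.right_inv hz
    refine ⟨?_, hMb _ hzW, fun v ↦ ?_⟩
    · have := contDiffAt_comp_symm (by simp) hφa hs hFz
      rwa [hφφ] at this
    · have hd := mfderiv_eq_fderiv_comp_tangentCoord hs (hFz.mdifferentiableAt one_ne_zero)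
      rw [← hφ, hφφ] at hd
      have h1 : AlmostComplexStructure.diffC F (φ.symm z) (tangentOfCoord p₀ (φ.symm z) v) =
          fderiv ℝ (F ∘ φ.symm) z v := by
        refine (hd _).trans ?_
        rw [tangentCoord_tangentOfCoord hs]
      have h2 : AlmostComplexStructure.diffC F (φ.symm z)
          (𝒥.J (φ.symm z) (tangentOfCoord p₀ (φ.symm z) v)) = fderiv ℝ (F ∘ φ.symm) z (J z v) :=
        hd _
      have h3 : fderiv ℝ (F ∘ φ.symm) z v + Complex.I * fderiv ℝ (F ∘ φ.symm) z (J z v) =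
          2 * 𝒥.dbar F (φ.symm z) (tangentOfCoord p₀ (φ.symm z) v) := by
        rw [← h1, ← h2]
        change _ = 2 * ((1 / 2 : ℂ) *
          (AlmostComplexStructure.diffC F (φ.symm z) (tangentOfCoord p₀ (φ.symm z) v) +
            Complex.I * AlmostComplexStructure.diffC F (φ.symm z)
              (𝒥.J (φ.symm z) (tangentOfCoord p₀ (φ.symm z) v))))
        ring
      rw [h3, norm_mul, Complex.norm_ofNat, mul_assoc, mul_assoc]
      gcongr
      refine (hC _ hzW _).trans ?_
      exact mul_le_mul (le_max_left _ _) (hzK v) (Real.sqrt_nonneg _) (le_max_right _ _)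
  obtain ⟨U, hU, h⟩ := exists_nhds_hausdorffMeasure_eq_zero hn
    (finrank_euclideanSpace_fin (𝕜 := ℝ) (n := 2 * n)) hJc hJ2 hρtc hρt0 hinj hFt
  refine ⟨U, hU, measure_mono_null ?_ h⟩
  rintro z ⟨hz1, hz2, hz3⟩
  refine ⟨hz1, ?_, hz3⟩
  ext j
  exact hz2 j

end Manifold

end

theorem theorem1 (n : ℕ) (hn : 1 ≤ n)
    (M : Type*) [TopologicalSpace M] [T2Space M] [SecondCountableTopology M]
    [ChartedSpace (ModelR n) M] [IsManifold 𝓘(ℝ, ModelR n) ∞ M]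
    (𝒥 : AlmostComplexStructure n M)
    (g : Bundle.ContMDiffRiemannianMetric 𝓘(ℝ, ModelR n) ∞ (ModelR n)
      (fun p : M ↦ TangentSpace 𝓘(ℝ, ModelR n) p))
    (hg : 𝒥.IsHermitianMetric g)
    (k : ℕ) (ρ : Fin k → M → ℝ) (hρ : 𝒥.IsTotallyReal ρ)
    (F : M → ℂ)
    (hF : ContMDiffOn 𝓘(ℝ, ModelR n) 𝓘(ℝ, ℂ) 1 F (wedge ρ))
    (hFb : ∃ C : ℝ, ∀ p ∈ wedge ρ, ‖F p‖ ≤ C)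
    (hdF : 𝒥.DbarBoundedOn g F (wedge ρ)) :
    IsNullOfDim n n {p ∈ edge ρ | ¬ ∃ L : ℂ, HasNontangentialLimit n (wedge ρ) F p L} := by
  obtain ⟨hgen, hk⟩ := hρ
  subst hk
  intro φ hφ
  refine measure_null_of_locally_null _ fun a ha ↦ ?_
  obtain ⟨p₀, ⟨⟨hp₀, -⟩, hp₀φ⟩, rfl⟩ := ha
  obtain ⟨U, hU, h⟩ := 𝒥.exists_nhds_chart_hausdorffMeasure_eq_zero hn g hgen hF hFb hdF hp₀
  set φ₀ := chartAt (ModelR k) p₀ with hφ₀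
  have hφ₀a : φ₀ ∈ IsManifold.maximalAtlas 𝓘(ℝ, ModelR k) ∞ M :=
    IsManifold.chart_mem_maximalAtlas p₀
  have hp₀s : p₀ ∈ φ₀.source := mem_chart_source _ p₀
  obtain ⟨B, S, hS, hB⟩ :=
    ((contDiffAt_transition hφ₀a hφ hp₀s hp₀φ).of_le (by simp : (1 : WithTop ℕ∞) ≤ ∞)
      ).exists_lipschitzOnWith
  have hφc : Tendsto φ.symm (𝓝 (φ p₀)) (𝓝 p₀) := by
    have := φ.symm.continuousAt (φ.map_source hp₀φ)
    rwa [ContinuousAt, φ.left_inv hp₀φ] at this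
  have hnear : ∀ᶠ x in 𝓝 (φ p₀), φ.symm x ∈ φ₀.source ∧ φ₀ (φ.symm x) ∈ U ∩ S :=
    (hφc.eventually (φ₀.open_source.mem_nhds hp₀s)).and
      (((φ₀.continuousAt hp₀s).tendsto.comp hφc).eventually_mem (inter_mem hU hS))
  refine ⟨_, inter_mem_nhdsWithin _ hnear, ?_⟩
  set N := {z | z ∈ U ∧ (∀ j, ρ j (φ₀.symm z) = 0) ∧ ¬ ∃ L : ℂ, ∀ c > 0,
      Tendsto (F ∘ φ₀.symm) (𝓝[{w | ∀ j, ρ j (φ₀.symm w) < 0 ∧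
          c * ‖w - z‖ ≤ -ρ j (φ₀.symm w)}] z) (𝓝 L)} with hN
  have himg := (hB.mono (inter_subset_right : N ∩ S ⊆ S)).hausdorffMeasure_image_le (d := k)
    (Nat.cast_nonneg k)
  rw [measure_mono_null inter_subset_left h, mul_zero] at himg
  refine measure_mono_null ?_ (le_antisymm himg bot_le)
  rintro _ ⟨⟨p, ⟨⟨hp, hpL⟩, hpφ⟩, rfl⟩, hx1, hx2⟩
  rw [φ.left_inv hpφ] at hx1 hx2
  refine ⟨φ₀ p, ⟨⟨hx2.1, fun j ↦ ?_, ?_⟩, hx2.2⟩, ?_⟩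
  · rw [φ₀.left_inv hx1]
    exact hp j
  · rintro ⟨L, hL⟩
    have hρd : ∀ j, MDifferentiableAt 𝓘(ℝ, ModelR k) 𝓘(ℝ, ℝ) (ρ j) p := fun j ↦
      (hgen.smooth j p).mdifferentiableAt (by simp)
    obtain ⟨v, hv⟩ := hgen.wedge_ne_zero.self_of_nhdsSet p hp
    exact hpL ⟨L, hasNontangentialLimit_of_tendsto hφ₀a hx1 hρd hp
      (𝒥.mfderiv_ne_zero_of_dbarWedge_ne_zero hρd hv) hL⟩
  · change φ (φ₀.symm (φ₀ p)) = φ p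
    rw [φ₀.left_inv hx1]
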